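/- **Setting.** Let $d\in\{2,3\}$, $\Omega^{RVE}=\prod_{\zeta}[0,L_\zeta]$ with all $L_\zeta>0$. The periodic structure $\Omega^\infty\subset\mathbb R^d$ is the interior of the union of all lattice translates of a closed set $\overline\Omega\subset\Omega^{RVE}$ which is a finite union of curvilinear cells (images of $[0,1]^d$ under $C^2$-diffeomorphisms defined near $[0,1]^d$) such that the lattice translates of the cells form a conforming cell decomposition (open faces coincide, with equal dimension, or are disjoint; distinct open cells do not overlap). Put $\Omega=\Omega^\infty\cap\Omega^{RVE}$, $\Gamma^{fict}=\partial\Omega^{RVE}\cap\Omega^\infty$, $\Gamma^{actual}=\partial\Omega^\infty\cap\Omega^{RVE}$; thus $\partial\Omega$ consists of smooth patches (cell faces belonging to no other cell of $\overline\Omega$) joined at edges $C$ (corners if $d=2$), with exterior unit normal $n$ and, on the edges of each patch, outward unit conormal $m$. Let $\mathbb C,h,\epsilon,M,e,\mu$ be constant material tensors with $\mathbb C_{ijkl}=\mathbb C_{jikl}=\mathbb C_{klij}$, $h_{ijklmn}=h_{jiklmn}=h_{lmnijk}$, $\epsilon_{lm}=\epsilon_{ml}$, $M_{mnlk}=M_{lkmn}$,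 $e_{lij}=e_{lji}$, $\mu_{lijk}=\mu_{ljik}$, and (summation convention, commas denote derivatives) $$\mathcal H=\tfrac12\varepsilon_{ij}\mathbb C_{ijkl}\varepsilon_{kl}+\tfrac12\varepsilon_{ij,k}h_{ijklmn}\varepsilon_{lm,n}-\tfrac12E_l\epsilon_{lm}E_m-\tfrac12E_{m,n}M_{mnlk}E_{l,k}-E_le_{lij}\varepsilon_{ij}-\tfrac12E_l\mu_{lijk}\varepsilon_{ij,k}+\tfrac12E_{l,k}\mu_{lijk}\varepsilon_{ij},$$ with $\varepsilon_{ij}=\frac12(u_{i,j}+u_{j,i})$, $E_l=-\phi_{,l}$, and conjugates $\hat\sigma_{ij}=\mathbb C_{ijkl}\varepsilon_{kl}-e_{lij}E_l+\frac12\mu_{lijk}E_{l,k}$, $\tilde\sigma_{ijk}=h_{ijklmn}\varepsilon_{lm,n}-\frac12\mu_{lijk}E_l$, $\hat D_l=\epsilon_{lm}E_m+e_{lij}\varepsilon_{ij}+\frac12\mu_{lijk}\varepsilon_{ij,k}$, $\tilde D_{lk}=M_{mnlk}E_{m,n}-\frac12\mu_{lijk}\varepsilon_{ij}$. With $\nabla^S_jf=f_{,k}(\delta_{kj}-n_kn_j)$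 put on $\partial\Omega$ $$t_i=(\hat\sigma_{ij}-\tilde\sigma_{ijk,k}+\nabla^S_l(n_l)\,\tilde\sigma_{ijk}n_k)n_j-\nabla^S_j(\tilde\sigma_{ijk}n_k),\qquad r_i=\tilde\sigma_{ijk}n_jn_k,$$ $$w=-(\hat D_l-\tilde D_{lk,k}+\nabla^S_i(n_i)\tilde D_{lk}n_k)n_l+\nabla^S_l(\tilde D_{lk}n_k),\qquad \mathfrak r=-\tilde D_{jk}n_jn_k,$$ and on edges $j_i=[\![\tilde\sigma_{ijk}m_jn_k]\!]$, $\wp=-[\![\tilde D_{jk}m_jn_k]\!]$, where $[\![\cdot]\!]$ is the sum over the adjacent boundary patches; $j=0$, $\wp=0$ off the edges. A scalar field is called *high-order periodic of class $C^n$* if it is $C^n$ up to the boundary of $\Omega$ (on a neighbourhood of $\overline\Omega$), takes equal values at lattice-equivalent points of $\overline\Omega$, and its derivative $\partial/\partial\zeta$ takes equal values at points $x$, $x+L_\zeta e_\zeta$ of $\overline\Omega$, for every direction $\zeta$. Let $H^2_{per}(\Omega)$ be the closure in $H^2(\Omega)$ of the high-order periodic fields of class $C^2$. **Hypotheses.**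 Let $u=u^P+\bar\varepsilon\cdot x$, $\phi=\phi^P-\bar E\cdot x$, where the components of $u^P$, and $\phi^P$, are high-order periodic of class $C^4$, $\bar\varepsilon\in\mathbb R^{d\times d}$ is symmetric and $\bar E\in\mathbb R^d$. Assume 1. (Euler–Lagrange, no sources) $(\hat\sigma_{ij}-\tilde\sigma_{ijk,k})_{,j}=0$ and $(\hat D_l-\tilde D_{lk,k})_{,l}=0$ in $\Omega$; 2. (homogeneous Neumann) $t=r=0$, $w=\mathfrak r=0$ on the (open) patches of $\partial\Omega$ at points of $\Gamma^{actual}$, and $j=0$, $\wp=0$ on edges in the interior of $\Omega^{RVE}$; 3. (high-order equilibrium) at opposite points of $\Gamma^{fict}$ on the faces $\zeta=0$ and $\zeta=L_\zeta$ (relative interiors of patches): $t(L_\zeta)+t(0)=0$, $r(L_\zeta)-r(0)=0$, $w(L_\zeta)+w(0)=0$, $\mathfrak r(L_\zeta)-\mathfrak r(0)=0$; and for each $x\in\partial\Omega^{RVE}$ the sums of $j$ and of $\wp$ over all points of $\Omega^{RVE}$ lattice-equivalent to $x$ vanish (on a single pair of faces: $j(L_\zeta)+j(0)=0$, $\wp(L_\zeta)+\wp(0)=0$).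 **Conclusion.** $\hat\sigma_{ij}$ and $\hat D_l$ are integrable on $\Omega$. Define the macroscopic stress and electric displacement by $$\bar\sigma_{ij}=\frac1{|\Omega^{RVE}|}\int_\Omega\hat\sigma_{ij}\,d\Omega,\qquad \bar D_l=\frac1{|\Omega^{RVE}|}\int_\Omega\hat D_l\,d\Omega .$$ For all variations $\delta u=\delta u^P+\delta\bar\varepsilon\cdot x$, $\delta\phi=\delta\phi^P-\delta\bar E\cdot x$ with $\delta u^P_i,\delta\phi^P\in H^2_{per}(\Omega)$, $\delta\bar\varepsilon$ symmetric and $\delta\bar E\in\mathbb R^d$, the bulk enthalpy $\Pi^b=\int_\Omega\mathcal H\,d\Omega$ is finite along $(u+\tau\delta u,\phi+\tau\delta\phi)$ for all $\tau\in\mathbb R$, the integrand below is integrable, and the first variation $\delta\Pi^b=\frac{d}{d\tau}\big|_{\tau=0}\Pi^b$ exists and satisfies $$\delta\Pi^b=\int_\Omega\left(\hat\sigma_{ij}\delta\varepsilon_{ij}-\hat D_l\delta E_l+\tilde\sigma_{ijk}\delta\varepsilon_{ij,k}-\tilde D_{lm}\delta E_{l,m}\right)d\Omega=|\Omega^{RVE}|\left(\bar\sigma_{ij}\delta\bar\varepsilon_{ij}-\bar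 D_l\delta\bar E_l\right).$$ -/

import Mathlib

open MeasureTheory Filter Topology Set

noncomputable section

namespace Flexo

/-- Points (and vectors) of `ℝ^d` in Cartesian coordinates. Euclidean lengths are always written out
explicitly below. -/
abbrev Vec (d : ℕ) := Fin d → ℝ

/-- The partial derivative `f_{,j} = ∂f/∂x_j`. -/
def pd {d : ℕ} (j : Fin d) (f : Vec d → ℝ) : Vec d → ℝ :=
  fun x => fderiv ℝ f x (Pi.single j 1)

/-! ### Periodic structures with piecewise smooth boundary -/

/-- The value `0` or `1` of a chart coordinate on the lower (`false`) or upper (`true`) side. -/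
def sideVal : Bool → ℝ
  | false => 0
  | true => 1

/-- The sign of the outward direction on the lower or upper side. -/
def sideSign : Bool → ℝ
  | false => -1
  | true => 1

/-- The curvilinear cell of a chart `e`: the part of its source that `e` maps to `[0,1]^d`. -/
def cellOf {d : ℕ} (e : OpenPartialHomeomorph (Vec d) (Vec d)) : Set (Vec d) :=
  {x | x ∈ e.source ∧ e x ∈ Icc (0 : Vec d) 1}

/-- The open faces of a curvilinear cell. A face is specified by `s`: the coordinate `a` is free in
`(0,1)` if `s a = none`, and is fixed to `0` or `1` if `s a = some b`. The specification that is
constantly `none` gives the open cell itself. -/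
def openFaceOf {d : ℕ} (e : OpenPartialHomeomorph (Vec d) (Vec d)) (s : Fin d → Option Bool) :
    Set (Vec d) :=
  {x | x ∈ e.source ∧ (∀ a, s a = none → e x a ∈ Ioo (0 : ℝ) 1) ∧
    ∀ a b, s a = some b → e x a = sideVal b}

/-- Translation by the lattice vector `(k_1 L_1, …, k_d L_d)`. -/
def latticeShift {d : ℕ} (L : Vec d) (k : Fin d → ℤ) (x : Vec d) : Vec d :=
  fun i => x i + k i * L i

/-- A representative volume element: a cuboid `[0,L_1] × ⋯ × [0,L_d]` together with the material
region in it, which is a finite union of curvilinear cells (diffeomorphic images of closed cubes,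
of class `C²` up to the boundary) whose lattice translates form a conforming cell decomposition:
two open faces of translated cells coincide or are disjoint, and distinct translated open cells do
not overlap. The boundary of the material is therefore composed of smooth patches
joined at edges (corners if `d = 2`). -/
structure RVE (d : ℕ) where
  /-- side lengths of the unit cell -/
  L : Vec d
  L_pos : ∀ i, 0 < L i
  /-- number of curvilinear cells -/
  N : ℕ
  /-- the curvilinear coordinates of each cell -/
  chart : Fin N → OpenPartialHomeomorph (Vec d) (Vec d)
  chart_contDiffOn : ∀ c, ContDiffOn ℝ 2 (chart c) (chart c).source
  chart_symm_contDiffOn : ∀ c, ContDiffOn ℝ 2 (chart c).symm (chart c).target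
  cube_subset : ∀ c, Icc (0 : Vec d) 1 ⊆ (chart c).target
  cell_subset : ∀ c, cellOf (chart c) ⊆ Icc (0 : Vec d) L
  conforming : ∀ (c c' : Fin N) (s s' : Fin d → Option Bool) (k : Fin d → ℤ),
    (openFaceOf (chart c) s ∩ latticeShift L k '' openFaceOf (chart c') s').Nonempty →
      openFaceOf (chart c) s = latticeShift L k '' openFaceOf (chart c') s' ∧
      {a | s a = none}.ncard = {a | s' a = none}.ncard
  nonoverlapping : ∀ (c c' : Fin N) (k : Fin d → ℤ),
    (openFaceOf (chart c) (fun _ => none) ∩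
      latticeShift L k '' openFaceOf (chart c') (fun _ => none)).Nonempty → c = c' ∧ k = 0

namespace RVE

variable {d : ℕ} (R : RVE d)

/-- The unit cell `Ω^RVE`. -/
def box : Set (Vec d) := Icc 0 R.L

/-- Its volume `|Ω^RVE|`. -/
def boxVolume : ℝ := volume.real R.box

/-- The closed material region in the unit cell (the closure of the domain `Ω`). -/
def region : Set (Vec d) := ⋃ c, cellOf (R.chart c)

/-- The infinite periodic structure `Ω^∞`. -/
def periodicStructure : Set (Vec d) :=
  interior (⋃ k : Fin d → ℤ, latticeShift R.L k '' R.region)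

/-- The domain `Ω = Ω^∞ ∩ Ω^RVE`. -/
def domain : Set (Vec d) := R.periodicStructure ∩ R.box

/-- `Γ^fict = ∂Ω^RVE ∩ Ω^∞`. -/
def fictBoundary : Set (Vec d) := frontier R.box ∩ R.periodicStructure

/-- `Γ^actual = ∂Ω^∞ ∩ Ω^RVE`. -/
def actualBoundary : Set (Vec d) := frontier R.periodicStructure ∩ R.box

/-- A side of a curvilinear cell: the cell, the coordinate that is fixed, and its value. -/
abbrev Side := Fin R.N × Fin d × Bool

/-- The relative interior of a side. -/
def sideInterior (F : R.Side) : Set (Vec d) :=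
  openFaceOf (R.chart F.1) (fun i => if i = F.2.1 then some F.2.2 else none)

/-- The side `F` is a patch of `∂Ω`: no other cell of the RVE is attached to it. -/
def IsBoundaryPatch (F : R.Side) : Prop :=
  ∀ c, c ≠ F.1 → Disjoint (R.sideInterior F) (cellOf (R.chart c))

/-- The relative interior of the edge (codimension two) of the patch `F` at which the coordinate
`a'` takes the value `b'`. It is meant for `a' ≠ F.2.1`. -/
def edgeInterior (F : R.Side) (a' : Fin d) (b' : Bool) : Set (Vec d) :=
  openFaceOf (R.chart F.1)
    (fun i => if i = F.2.1 then some F.2.2 else if i = a' then some b' else none)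

/-- The `j`-th component of the gradient of the curvilinear coordinate `a` of the cell `c`. -/
def coordGrad (c : Fin R.N) (a : Fin d) (j : Fin d) (x : Vec d) : ℝ :=
  pd j (fun y => R.chart c y a) x

/-- The exterior unit normal `n` on the patch `F`, extended to a neighbourhood as the unit normal to
the level sets of the curvilinear coordinate. -/
def normal (F : R.Side) (j : Fin d) (x : Vec d) : ℝ :=
  sideSign F.2.2 * R.coordGrad F.1 F.2.1 j x / √(∑ l, R.coordGrad F.1 F.2.1 l x ^ 2)

/-- The surface derivative `∇^S_j f = f_{,k} (δ_kj - n_k n_j)` on the patch `F`. -/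
def surfGrad (F : R.Side) (j : Fin d) (f : Vec d → ℝ) (x : Vec d) : ℝ :=
  ∑ k, pd k f x * ((if k = j then 1 else 0) - R.normal F k x * R.normal F j x)

/-- The `j`-th component of the surface gradient on `F` of the curvilinear coordinate `a'`. -/
def tangGrad (F : R.Side) (a' : Fin d) (j : Fin d) (x : Vec d) : ℝ :=
  R.surfGrad F j (fun y => R.chart F.1 y a') x

/-- The unit conormal `m` of the patch `F` along its edge `(a', b')`: tangent to `F`, normal to the
edge and pointing out of `F`. -/
def conormal (F : R.Side) (a' : Fin d) (b' : Bool) (j : Fin d) (x : Vec d) : ℝ :=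
  sideSign b' * R.tangGrad F a' j x / √(∑ l, R.tangGrad F a' l x ^ 2)

open Classical in
/-- The jump `⟦A m_j n_k⟧_{jk}` at the point `x` of a second order tensor `A`: the sum of
`A_jk m_j n_k` over all boundary patches with an edge through `x`. It vanishes off the edges. -/
def edgeJump (A : Fin d → Fin d → ℝ) (x : Vec d) : ℝ :=
  ∑ F : R.Side, ∑ a' : Fin d, ∑ b' : Bool,
    if R.IsBoundaryPatch F ∧ a' ≠ F.2.1 ∧ x ∈ R.edgeInterior F a' b' then
      ∑ j, ∑ k, A j k * R.conormal F a' b' j x * R.normal F k x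
    else 0

/-- Scalar fields of class `C^n` up to the boundary of `Ω` with high-order periodicity: values
agree at lattice-equivalent points, and `∂f/∂ζ` agrees on opposite faces `ζ = 0` and `ζ = L_ζ`. -/
structure IsPeriodicField (n : ℕ) (f : Vec d → ℝ) : Prop where
  smooth : ∃ U, IsOpen U ∧ R.region ⊆ U ∧ ContDiffOn ℝ n f U
  periodic : ∀ x ∈ R.region, ∀ k : Fin d → ℤ, latticeShift R.L k x ∈ R.region →
    f (latticeShift R.L k x) = f x
  periodic_deriv : ∀ x ∈ R.region, ∀ ζ : Fin d, latticeShift R.L (Pi.single ζ 1) x ∈ R.region →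
    pd ζ f (latticeShift R.L (Pi.single ζ 1) x) = pd ζ f x

end RVE

/-- A scalar field with its (weak) first and second derivatives. -/
structure Jet2 (d : ℕ) where
  val : Vec d → ℝ
  grad : Fin d → Vec d → ℝ
  hess : Fin d → Fin d → Vec d → ℝ

/-- The classical derivatives of a scalar field, `hess j k = f_{,jk}`. -/
def Jet2.ofFun {d : ℕ} (f : Vec d → ℝ) : Jet2 d where
  val := f
  grad j := pd j f
  hess j k := pd k (pd j f)

/-- The high-order periodic space `H²_per(Ω)`: the closure in `H²(Ω)` of the high-order periodic
fields that are `C²` up to the boundary. -/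
structure RVE.MemPeriodicH2 {d : ℕ} (R : RVE d) (J : Jet2 d) : Prop where
  memLp_val : MemLp J.val 2 (volume.restrict R.domain)
  memLp_grad : ∀ j, MemLp (J.grad j) 2 (volume.restrict R.domain)
  memLp_hess : ∀ j k, MemLp (J.hess j k) 2 (volume.restrict R.domain)
  approx : ∃ f : ℕ → Vec d → ℝ, (∀ m, R.IsPeriodicField 2 (f m)) ∧
    Tendsto (fun m => eLpNorm ((Jet2.ofFun (f m)).val - J.val) 2 (volume.restrict R.domain))
      atTop (𝓝 0) ∧
    (∀ j, Tendsto (fun m => eLpNorm ((Jet2.ofFun (f m)).grad j - J.grad j) 2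
      (volume.restrict R.domain)) atTop (𝓝 0)) ∧
    (∀ j k, Tendsto (fun m => eLpNorm ((Jet2.ofFun (f m)).hess j k - J.hess j k) 2
      (volume.restrict R.domain)) atTop (𝓝 0))

/-! ### Flexoelectric constitutive model -/

/-- The material tensors of a flexoelectric material with their standard symmetries. -/
structure Material (d : ℕ) where
  /-- elasticity `ℂ_ijkl` -/
  C : Fin d → Fin d → Fin d → Fin d → ℝ
  /-- strain-gradient elasticity `h_ijklmn` -/
  h : Fin d → Fin d → Fin d → Fin d → Fin d → Fin d → ℝ
  /-- dielectricity `ϵ_lm` -/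
  κ : Fin d → Fin d → ℝ
  /-- gradient dielectricity `M_mnlk` -/
  M : Fin d → Fin d → Fin d → Fin d → ℝ
  /-- piezoelectricity `e_lij` -/
  e : Fin d → Fin d → Fin d → ℝ
  /-- flexoelectricity `μ_lijk` -/
  μ : Fin d → Fin d → Fin d → Fin d → ℝ
  C_minor : ∀ i j k l, C i j k l = C j i k l
  C_major : ∀ i j k l, C i j k l = C k l i j
  h_minor : ∀ i j k l m n, h i j k l m n = h j i k l m n
  h_major : ∀ i j k l m n, h i j k l m n = h l m n i j k
  κ_symm : ∀ l m, κ l m = κ m l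
  M_major : ∀ m n l k, M m n l k = M l k m n
  e_symm : ∀ l i j, e l i j = e l j i
  μ_symm : ∀ l i j k, μ l i j k = μ l j i k

/-- Pointwise values of the kinematic fields. -/
structure Kin (d : ℕ) where
  /-- strain `ε_ij` -/
  ε : Fin d → Fin d → ℝ
  /-- strain gradient `ε_ij,k` -/
  dε : Fin d → Fin d → Fin d → ℝ
  /-- electric field `E_l` -/
  E : Fin d → ℝ
  /-- electric field gradient `E_l,k` -/
  dE : Fin d → Fin d → ℝ

/-- The perturbed kinematic state `q + τ δq`. -/
def Kin.perturb {d : ℕ} (q : Kin d) (τ : ℝ) (δq : Kin d) : Kin d where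
  ε i j := q.ε i j + τ * δq.ε i j
  dε i j k := q.dε i j k + τ * δq.dε i j k
  E l := q.E l + τ * δq.E l
  dE l k := q.dE l k + τ * δq.dE l k

namespace Material

variable {d : ℕ} (mat : Material d)

/-- The bulk internal enthalpy density `ℋ^Ω` (Lifshitz-invariant form). -/
def enthalpy (q : Kin d) : ℝ :=
  (1 / 2) * (∑ i, ∑ j, ∑ k, ∑ l, q.ε i j * mat.C i j k l * q.ε k l)
  + (1 / 2) * (∑ i, ∑ j, ∑ k, ∑ l, ∑ m, ∑ n, q.dε i j k * mat.h i j k l m n * q.dε l m n)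
  - (1 / 2) * (∑ l, ∑ m, q.E l * mat.κ l m * q.E m)
  - (1 / 2) * (∑ m, ∑ n, ∑ l, ∑ k, q.dE m n * mat.M m n l k * q.dE l k)
  - (∑ l, ∑ i, ∑ j, q.E l * mat.e l i j * q.ε i j)
  - (1 / 2) * (∑ l, ∑ i, ∑ j, ∑ k, q.E l * mat.μ l i j k * q.dε i j k)
  + (1 / 2) * (∑ l, ∑ i, ∑ j, ∑ k, q.dE l k * mat.μ l i j k * q.ε i j)

/-- Cauchy stress `σ̂_ij = ∂ℋ/∂ε_ij`. -/
def cauchy (q : Kin d) (i j : Fin d) : ℝ :=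
  (∑ k, ∑ l, mat.C i j k l * q.ε k l) - (∑ l, mat.e l i j * q.E l)
    + (1 / 2) * (∑ l, ∑ k, mat.μ l i j k * q.dE l k)

/-- Double stress `σ̃_ijk = ∂ℋ/∂ε_ij,k`. -/
def doubleStress (q : Kin d) (i j k : Fin d) : ℝ :=
  (∑ l, ∑ m, ∑ n, mat.h i j k l m n * q.dε l m n) - (1 / 2) * (∑ l, mat.μ l i j k * q.E l)

/-- Local electric displacement `D̂_l = -∂ℋ/∂E_l`. -/
def localD (q : Kin d) (l : Fin d) : ℝ :=
  (∑ m, mat.κ l m * q.E m) + (∑ i, ∑ j, mat.e l i j * q.ε i j)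
    + (1 / 2) * (∑ i, ∑ j, ∑ k, mat.μ l i j k * q.dε i j k)

/-- Double electric displacement `D̃_lk = -∂ℋ/∂E_l,k`. -/
def doubleD (q : Kin d) (l k : Fin d) : ℝ :=
  (∑ m, ∑ n, mat.M m n l k * q.dE m n) - (1 / 2) * (∑ i, ∑ j, mat.μ l i j k * q.ε i j)

/-- The integrand `σ̂_ij δε_ij - D̂_l δE_l + σ̃_ijk δε_ij,k - D̃_lm δE_l,m`. -/
def virtualWork (q δq : Kin d) : ℝ :=
  (∑ i, ∑ j, mat.cauchy q i j * δq.ε i j) - (∑ l, mat.localD q l * δq.E l)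
    + (∑ i, ∑ j, ∑ k, mat.doubleStress q i j k * δq.dε i j k)
    - (∑ l, ∑ m, mat.doubleD q l m * δq.dE l m)

end Material

variable {d : ℕ}

/-- The displacement `u = u^P + ε̄ · x`. -/
def totalDisp (uP : Fin d → Vec d → ℝ) (εbar : Fin d → Fin d → ℝ) : Fin d → Vec d → ℝ :=
  fun i x => uP i x + ∑ j, εbar i j * x j

/-- The electric potential `φ = φ^P - Ē · x`. -/
def totalPot (φP : Vec d → ℝ) (Ebar : Fin d → ℝ) : Vec d → ℝ :=
  fun x => φP x - ∑ l, Ebar l * x l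

/-- Strain `ε_ij = (u_i,j + u_j,i)/2`. -/
def strain (u : Fin d → Vec d → ℝ) (i j : Fin d) : Vec d → ℝ :=
  fun x => (pd j (u i) x + pd i (u j) x) / 2

/-- Electric field `E_l = -φ_,l`. -/
def elecField (φ : Vec d → ℝ) (l : Fin d) : Vec d → ℝ := fun x => -pd l φ x

/-- The kinematic fields of the displacement `u` and the potential `φ`. -/
def kin (u : Fin d → Vec d → ℝ) (φ : Vec d → ℝ) (x : Vec d) : Kin d where
  ε i j := strain u i j x
  dε i j k := pd k (strain u i j) x
  E l := elecField φ l x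
  dE l k := pd k (elecField φ l) x

/-- The kinematic fields of the variations `δu = δu^P + δε̄ · x` and `δφ = δφ^P - δĒ · x`
(with `δε̄` symmetric). -/
def variationKin (δu : Fin d → Jet2 d) (δφ : Jet2 d) (δε : Fin d → Fin d → ℝ) (δE : Fin d → ℝ)
    (x : Vec d) : Kin d where
  ε i j := ((δu i).grad j x + (δu j).grad i x) / 2 + δε i j
  dε i j k := ((δu i).hess j k x + (δu j).hess i k x) / 2
  E l := -(δφ.grad l x) + δE l
  dE l k := -(δφ.hess l k x)

/-! ### Field equations and Neumann quantities of a kinematic field -/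

section Fields

variable (R : RVE d) (mat : Material d) (q : Vec d → Kin d)

/-- `σ̂_ij - σ̃_ijk,k`. -/
def physStress (i j : Fin d) : Vec d → ℝ :=
  fun x => mat.cauchy (q x) i j - ∑ k, pd k (fun y => mat.doubleStress (q y) i j k) x

/-- `D̂_l - D̃_lk,k`. -/
def physD (l : Fin d) : Vec d → ℝ :=
  fun x => mat.localD (q x) l - ∑ k, pd k (fun y => mat.doubleD (q y) l k) x

/-- The Euler–Lagrange equations in `Ω` without body forces and free charges. -/
def EulerLagrange : Prop :=
  ∀ x ∈ R.domain,
    (∀ i, ∑ j, pd j (physStress mat q i j) x = 0) ∧ ∑ l, pd l (physD mat q l) x = 0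

/-- The traction
`t_i = (σ̂_ij - σ̃_ijk,k + ∇^S_l(n_l) σ̃_ijk n_k) n_j - ∇^S_j(σ̃_ijk n_k)` on the patch `F`. -/
def traction (F : R.Side) (i : Fin d) (x : Vec d) : ℝ :=
  (∑ j, (physStress mat q i j x + (∑ l, R.surfGrad F l (R.normal F l) x) *
      ∑ k, mat.doubleStress (q x) i j k * R.normal F k x) * R.normal F j x)
    - ∑ j, R.surfGrad F j (fun y => ∑ k, mat.doubleStress (q y) i j k * R.normal F k y) x

/-- The double traction `r_i = σ̃_ijk n_j n_k` on the patch `F`. -/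
def doubleTraction (F : R.Side) (i : Fin d) (x : Vec d) : ℝ :=
  ∑ j, ∑ k, mat.doubleStress (q x) i j k * R.normal F j x * R.normal F k x

/-- The surface charge density
`w = -(D̂_l - D̃_lk,k + ∇^S_i(n_i) D̃_lk n_k) n_l + ∇^S_l(D̃_lk n_k)` on the patch `F`. -/
def surfaceCharge (F : R.Side) (x : Vec d) : ℝ :=
  -(∑ l, (physD mat q l x + (∑ i, R.surfGrad F i (R.normal F i) x) *
      ∑ k, mat.doubleD (q x) l k * R.normal F k x) * R.normal F l x)
    + ∑ l, R.surfGrad F l (fun y => ∑ k, mat.doubleD (q y) l k * R.normal F k y) x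

/-- The double charge density `𝔯 = -D̃_jk n_j n_k` on the patch `F`. -/
def doubleCharge (F : R.Side) (x : Vec d) : ℝ :=
  -∑ j, ∑ k, mat.doubleD (q x) j k * R.normal F j x * R.normal F k x

/-- The force per unit length `j_i = ⟦σ̃_ijk m_j n_k⟧` at edges. -/
def edgeForce (i : Fin d) (x : Vec d) : ℝ :=
  R.edgeJump (fun j k => mat.doubleStress (q x) i j k) x

/-- The charge per unit length `℘ = -⟦D̃_jk m_j n_k⟧` at edges. -/
def edgeCharge (x : Vec d) : ℝ :=
  -R.edgeJump (fun j k => mat.doubleD (q x) j k) x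

/-- Homogeneous Neumann conditions on the actual boundary: `t = r = 0`, `w = 𝔯 = 0` on the patches
of `Γ^actual`, and `j = 0`, `℘ = 0` on the edges inside the unit cell. -/
structure HomogeneousNeumann : Prop where
  traction_eq : ∀ F, R.IsBoundaryPatch F → ∀ x ∈ R.sideInterior F ∩ R.actualBoundary, ∀ i,
    traction R mat q F i x = 0
  doubleTraction_eq : ∀ F, R.IsBoundaryPatch F → ∀ x ∈ R.sideInterior F ∩ R.actualBoundary, ∀ i,
    doubleTraction R mat q F i x = 0
  surfaceCharge_eq : ∀ F, R.IsBoundaryPatch F → ∀ x ∈ R.sideInterior F ∩ R.actualBoundary,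
    surfaceCharge R mat q F x = 0
  doubleCharge_eq : ∀ F, R.IsBoundaryPatch F → ∀ x ∈ R.sideInterior F ∩ R.actualBoundary,
    doubleCharge R mat q F x = 0
  edgeForce_eq : ∀ x ∈ interior R.box, ∀ i, edgeForce R mat q i x = 0
  edgeCharge_eq : ∀ x ∈ interior R.box, edgeCharge R mat q x = 0

/-- The point `x` of the patch `F` lies on the fictitious boundary in the face `ζ = 0`, and its
translate by `L_ζ` is a point of the patch `G`. -/
def OppositePoints (ζ : Fin d) (F G : R.Side) (x : Vec d) : Prop :=
  R.IsBoundaryPatch F ∧ R.IsBoundaryPatch G ∧ x ∈ R.sideInterior F ∩ R.fictBoundary ∧ x ζ = 0 ∧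
    latticeShift R.L (Pi.single ζ 1) x ∈ R.sideInterior G

/-- High-order equilibrium across the faces of the unit cell:
`t(L_ζ) + t(0) = 0`, `r(L_ζ) - r(0) = 0`, `w(L_ζ) + w(0) = 0`, `𝔯(L_ζ) - 𝔯(0) = 0` on opposite
fictitious faces, and balance of `j` and `℘` on the edges lying in the boundary of the unit cell.
The last condition says that `j` (and `℘`) sums to zero over the lattice-equivalent points of the
unit cell: for a point lying on the faces of one direction `ζ` only this is
`j(L_ζ) + j(0) = 0`, and for points on several faces it follows from these pairwise relations. -/
structure HighOrderEquilibrium : Prop where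
  traction_add : ∀ ζ F G x, OppositePoints R ζ F G x → ∀ i,
    traction R mat q G i (latticeShift R.L (Pi.single ζ 1) x) + traction R mat q F i x = 0
  doubleTraction_sub : ∀ ζ F G x, OppositePoints R ζ F G x → ∀ i,
    doubleTraction R mat q G i (latticeShift R.L (Pi.single ζ 1) x)
      - doubleTraction R mat q F i x = 0
  surfaceCharge_add : ∀ ζ F G x, OppositePoints R ζ F G x →
    surfaceCharge R mat q G (latticeShift R.L (Pi.single ζ 1) x) + surfaceCharge R mat q F x = 0
  doubleCharge_sub : ∀ ζ F G x, OppositePoints R ζ F G x →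
    doubleCharge R mat q G (latticeShift R.L (Pi.single ζ 1) x) - doubleCharge R mat q F x = 0
  edgeForce_sum : ∀ x ∈ frontier R.box, (∀ ζ, x ζ < R.L ζ) → ∀ i,
    ∑ k : Fin d → Fin 2, edgeForce R mat q i (latticeShift R.L (fun ζ => ((k ζ : ℕ) : ℤ)) x) = 0
  edgeCharge_sum : ∀ x ∈ frontier R.box, (∀ ζ, x ζ < R.L ζ) →
    ∑ k : Fin d → Fin 2, edgeCharge R mat q (latticeShift R.L (fun ζ => ((k ζ : ℕ) : ℤ)) x) = 0

/-- The microscopic bulk enthalpy `Π^b` of a kinematic field. -/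
def bulkEnthalpy : ℝ := ∫ x in R.domain, mat.enthalpy (q x)

/-- The macroscopic stress `σ̄_ij = |Ω^RVE|⁻¹ ∫_Ω σ̂_ij`. -/
def macroStress (i j : Fin d) : ℝ :=
  (1 / R.boxVolume) * ∫ x in R.domain, mat.cauchy (q x) i j

/-- The macroscopic electric displacement `D̄_l = |Ω^RVE|⁻¹ ∫_Ω D̂_l`. -/
def macroD (l : Fin d) : ℝ :=
  (1 / R.boxVolume) * ∫ x in R.domain, mat.localD (q x) l

end Fields

end Flexo

end

noncomputable section
namespace Flexo

variable {d k : ℕ}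

/-! ### Partial derivatives -/

/-! The enthalpy is a quadratic form whose polarization is the virtual work (`enthalpy_perturb`).
Its integral along `q + τ δq` is therefore a quadratic polynomial in `τ`, and the linear coefficient
is the first variation (`hasDerivAt_bulkEnthalpy`). By the symmetry of the stresses the virtual work
splits into one term for each component of `δu^P`, one term for `δφ^P`, and a term with the
constants `δε̄`, `δĒ` (`virtualWork_variationKin`). The last one integrates to the macroscopic work,
because the macroscopic quantities are averages. What has to be shown is that periodic fluctuations
do no work. This is one scalar statement: `∫ S_j v_,j + Q_jk v_,jk = 0` for `v` in `H²_per`, where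
`(S, Q)` is either a row of the stresses or the pair of electric displacements.

Both sides of the scalar statement are continuous in `H²`, so `v` may be taken `C²` up to the
boundary. On a single curvilinear cell the Euler–Lagrange equation makes the integrand the
divergence of `P_j v + Q_kj v_,k`, with `P = S - div Q`. The Piola identity transports the
divergence theorem from the cube to the cell. On each side the gradient of `v` is split: the normal
derivative pairs with the double traction, while the tangential part is integrated by parts with the
surface divergence theorem. This leaves the traction times `v` and edge integrals of `Q_jk m_j n_k
v` (`integral_secondGradient`).

Summed over the cells, the side terms cancel. A side has at most one mate, that is, another side
coinciding with it up to a lattice translation, and the normals of mates are opposite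
(`Mate.normal_eq_neg`, `Mate.unique`). For mates inside the same unit cell the traction is odd and
the double traction even in the normal. For mates related by a nontrivial translation, the
translation is along one axis, and high-order equilibrium together with the periodicity of `v` and
`∂v/∂ζ` gives the cancellation (or Neumann conditions do, off `Ω^∞`). A side without mate lies on
the actual boundary, where the Neumann conditions apply.

The edge terms cancel as well. Sides shared by two cells contribute nothing to the jump, so the jump
can be computed with all sides (`edgeJump_eq_sum`). Grouping the edges into lattice classes turns
their total into the balanced sums of jumps over lattice-equivalent points
(`EdgeBalance.sum_edgeWork`). -/

lemma fderiv_apply_eq_sum_pd (f : Vec d → ℝ) (x v : Vec d) :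
    fderiv ℝ f x v = ∑ j, v j * pd j f x := by
  conv_lhs => rw [pi_eq_sum_univ' v]
  simp [pd, map_sum]

lemma pd_comp {Φ : Vec k → Vec d} {f : Vec d → ℝ} {y : Vec k} (hf : DifferentiableAt ℝ f (Φ y))
    (hΦ : DifferentiableAt ℝ Φ y) (a : Fin k) :
    pd a (fun y => f (Φ y)) y = ∑ j, pd j f (Φ y) * pd a (fun y => Φ y j) y := by
  have h1 : fderiv ℝ (fun y => f (Φ y)) y = (fderiv ℝ f (Φ y)).comp (fderiv ℝ Φ y) :=
    fderiv_comp y hf hΦ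
  unfold pd
  rw [h1, ContinuousLinearMap.comp_apply, fderiv_apply_eq_sum_pd]
  refine Finset.sum_congr rfl fun j _ => ?_
  rw [mul_comm, fderiv_apply hΦ]; rfl

lemma pd_congr {f g : Vec d → ℝ} {x : Vec d} (h : f =ᶠ[𝓝 x] g) (j : Fin d) :
    pd j f x = pd j g x := by
  unfold pd; rw [h.fderiv_eq]

lemma pd_add {f g : Vec d → ℝ} {x : Vec d} (hf : DifferentiableAt ℝ f x)
    (hg : DifferentiableAt ℝ g x) (j : Fin d) :
    pd j (fun y => f y + g y) x = pd j f x + pd j g x := by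
  simp only [pd]; rw [fderiv_fun_add hf hg]; rfl

lemma pd_sub {f g : Vec d → ℝ} {x : Vec d} (hf : DifferentiableAt ℝ f x)
    (hg : DifferentiableAt ℝ g x) (j : Fin d) :
    pd j (fun y => f y - g y) x = pd j f x - pd j g x := by
  simp only [pd]; rw [fderiv_fun_sub hf hg]; rfl

lemma pd_neg (f : Vec d → ℝ) (x : Vec d) (j : Fin d) :
    pd j (fun y => -f y) x = -pd j f x := by
  simp only [pd]; rw [fderiv_fun_neg]; rfl

lemma pd_mul {f g : Vec d → ℝ} {x : Vec d} (hf : DifferentiableAt ℝ f x)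
    (hg : DifferentiableAt ℝ g x) (j : Fin d) :
    pd j (fun y => f y * g y) x = pd j f x * g x + f x * pd j g x := by
  simp only [pd]; rw [fderiv_fun_mul hf hg]; simp; ring

lemma pd_const (c : ℝ) (x : Vec d) (j : Fin d) : pd j (fun _ => c) x = 0 := by
  simp [pd]

lemma pd_const_mul {f : Vec d → ℝ} {x : Vec d} (c : ℝ) (hf : DifferentiableAt ℝ f x)
    (j : Fin d) : pd j (fun y => c * f y) x = c * pd j f x := by
  rw [pd_mul (differentiableAt_const c) hf, pd_const]; ring

lemma pd_sum {ι : Type*} {s : Finset ι} {f : ι → Vec d → ℝ} {x : Vec d}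
    (hf : ∀ i ∈ s, DifferentiableAt ℝ (f i) x) (j : Fin d) :
    pd j (fun y => ∑ i ∈ s, f i y) x = ∑ i ∈ s, pd j (f i) x := by
  simp only [pd]; rw [fderiv_fun_sum hf]; simp

lemma pd_coord (i j : Fin d) (x : Vec d) :
    pd j (fun y : Vec d => y i) x = if i = j then 1 else 0 := by
  have : HasFDerivAt (fun y : Vec d => y i) (ContinuousLinearMap.proj (R := ℝ) i) x :=
    (ContinuousLinearMap.proj (R := ℝ) (φ := fun _ : Fin d => ℝ) i).hasFDerivAt
  simp [pd, this.fderiv, Pi.single_apply]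

lemma pd_comm {f : Vec d → ℝ} {x : Vec d} (hf : ContDiffAt ℝ 2 f x) (i j : Fin d) :
    pd i (pd j f) x = pd j (pd i f) x := by
  have hs : IsSymmSndFDerivAt ℝ f x := hf.isSymmSndFDerivAt (by simp)
  have hd : DifferentiableAt ℝ (fderiv ℝ f) x :=
    (hf.fderiv_right (m := 1) (by norm_num)).differentiableAt (by norm_num)
  have key : ∀ i j : Fin d, pd i (pd j f) x
      = fderiv ℝ (fderiv ℝ f) x (Pi.single i 1) (Pi.single j 1) := by
    intro i j
    unfold pd
    rw [fderiv_clm_apply hd (differentiableAt_const _)]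
    simp
  rw [key, key, hs.eq]

lemma contDiffOn_pd {U : Set (Vec d)} (hU : IsOpen U) {n m : ℕ} (hmn : m + 1 ≤ n)
    {f : Vec d → ℝ} (hf : ContDiffOn ℝ n f U) (j : Fin d) : ContDiffOn ℝ m (pd j f) U :=
  (hf.fderiv_of_isOpen hU (by exact_mod_cast hmn)).clm_apply contDiffOn_const

/-! ### Tangent matrices and area densities -/

/-- The matrix whose rows are the tangent vectors `∂P/∂w_α` of a parametrization. -/
def tanMat (P : Vec k → Vec d) (w : Vec k) : Matrix (Fin k) (Fin d) ℝ :=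
  Matrix.of fun α j => pd α (fun y => P y j) w

/-- The density of the `k`-dimensional area in the parameters of `P`. -/
def areaDensity (P : Vec k → Vec d) (w : Vec k) : ℝ :=
  √((tanMat P w * (tanMat P w).transpose).det)

/-- The open unit cube. -/
def openCube (k : ℕ) : Set (Vec k) := univ.pi fun _ => Ioo 0 1

lemma isOpen_openCube (k : ℕ) : IsOpen (openCube k) :=
  isOpen_set_pi finite_univ fun _ _ => isOpen_Ioo

lemma mem_openCube {w : Vec k} : w ∈ openCube k ↔ ∀ i, w i ∈ Ioo (0 : ℝ) 1 := by
  simp [openCube]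

lemma openCube_subset_Icc (k : ℕ) : openCube k ⊆ Icc (0 : Vec k) 1 := fun _ hw =>
  ⟨fun i => (mem_openCube.1 hw i).1.le, fun i => (mem_openCube.1 hw i).2.le⟩

lemma openCube_ae_eq_Icc (k : ℕ) : openCube k =ᵐ[volume] Icc (0 : Vec k) 1 :=
  Measure.univ_pi_Ioo_ae_eq_Icc (f := fun _ => (0 : ℝ)) (g := fun _ => 1)

/-- The tangent vectors are rows, so `tanMat` is the transposed Jacobian and the chain rule appears
with the factors in reversed order. -/
lemma tanMat_comp {l : ℕ} {P : Vec k → Vec d} {T : Vec l → Vec k} {w : Vec l}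
    (hP : DifferentiableAt ℝ P (T w)) (hT : DifferentiableAt ℝ T w) :
    tanMat (fun w => P (T w)) w = tanMat T w * tanMat P (T w) := by
  ext α j
  simp only [tanMat, Matrix.mul_apply, Matrix.of_apply]
  rw [pd_comp (f := fun y => P y j) (differentiableAt_pi.1 hP j) hT]
  exact Finset.sum_congr rfl fun _ _ => mul_comm _ _

lemma tanMat_congr {P Q : Vec k → Vec d} {w : Vec k} (h : P =ᶠ[𝓝 w] Q) :
    tanMat P w = tanMat Q w := by
  ext α j
  exact pd_congr (h.mono fun y hy => by simp only [hy]) α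

lemma det_fderiv {T : Vec k → Vec k} {w : Vec k} (hT : DifferentiableAt ℝ T w) :
    (fderiv ℝ T w).det = (tanMat T w).det := by
  rw [ContinuousLinearMap.det, ← LinearMap.det_toMatrix', ← Matrix.det_transpose]
  congr 1
  ext α j
  simp only [tanMat, Matrix.transpose_apply, LinearMap.toMatrix'_apply, Matrix.of_apply, pd]
  rw [fderiv_apply hT]
  simp

/-- The Gram matrix `G` of the tangents becomes `J G Jᵀ`, and the square root of its determinant
acquires the factor `|det J|`. -/
lemma areaDensity_comp {P : Vec k → Vec d} {T : Vec k → Vec k} {w : Vec k}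
    (hP : DifferentiableAt ℝ P (T w)) (hT : DifferentiableAt ℝ T w) :
    areaDensity (fun w => P (T w)) w = |(fderiv ℝ T w).det| * areaDensity P (T w) := by
  unfold areaDensity
  rw [tanMat_comp hP hT, det_fderiv hT, Matrix.transpose_mul, Matrix.mul_assoc,
    ← Matrix.mul_assoc (tanMat P (T w)), Matrix.det_mul, Matrix.det_mul, Matrix.det_transpose]
  rw [show ∀ a b : ℝ, a * (b * a) = a ^ 2 * b by intros; ring, Real.sqrt_mul (sq_nonneg _),
    Real.sqrt_sq_eq_abs]

lemma areaDensity_congr {P Q : Vec k → Vec d} {w : Vec k} (h : P =ᶠ[𝓝 w] Q) :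
    areaDensity P w = areaDensity Q w := by
  unfold areaDensity; rw [tanMat_congr h]

section Reparam

variable {P P' : Vec k → Vec d} {T : Vec k → Vec k}

lemma areaDensity_reparam
    (hT : DifferentiableOn ℝ T (openCube k)) (himg : T '' openCube k = openCube k)
    (hP' : DifferentiableOn ℝ P' (openCube k)) (h : ∀ w ∈ openCube k, P w = P' (T w))
    (g : Vec d → ℝ) : ∀ w ∈ openCube k, |(fderiv ℝ T w).det| • (g (P' (T w)) * areaDensity P' (T w))
      = g (P w) * areaDensity P w := by
  intro w hw
  have hTw : T w ∈ openCube k := himg ▸ mem_image_of_mem T hw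
  rw [areaDensity_congr (Filter.eventually_of_mem ((isOpen_openCube k).mem_nhds hw) h),
    areaDensity_comp (hP'.differentiableAt ((isOpen_openCube k).mem_nhds hTw))
      (hT.differentiableAt ((isOpen_openCube k).mem_nhds hw)), h w hw, smul_eq_mul]
  ring

/-- Area integrals do not depend on the parametrization. This is what allows integrals over one
geometric face, computed in the charts of two different cells, to be compared. -/
lemma setIntegral_reparam
    (hT : DifferentiableOn ℝ T (openCube k)) (hinj : InjOn T (openCube k))
    (himg : T '' openCube k = openCube k)
    (hP' : DifferentiableOn ℝ P' (openCube k)) (h : ∀ w ∈ openCube k, P w = P' (T w))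
    (g : Vec d → ℝ) :
    ∫ w in openCube k, g (P' w) * areaDensity P' w = ∫ w in openCube k, g (P w) * areaDensity P w := by
  conv_lhs => rw [← himg]
  rw [integral_image_eq_integral_abs_det_fderiv_smul volume (isOpen_openCube k).measurableSet
    (fun w hw => (hT.differentiableAt ((isOpen_openCube k).mem_nhds hw)).hasFDerivAt.hasFDerivWithinAt)
    hinj]
  exact setIntegral_congr_fun (isOpen_openCube k).measurableSet (areaDensity_reparam hT himg hP' h g)

lemma integrableOn_reparam
    (hT : DifferentiableOn ℝ T (openCube k)) (hinj : InjOn T (openCube k))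
    (himg : T '' openCube k = openCube k)
    (hP' : DifferentiableOn ℝ P' (openCube k)) (h : ∀ w ∈ openCube k, P w = P' (T w))
    (g : Vec d → ℝ) (hg : IntegrableOn (fun w => g (P' w) * areaDensity P' w) (openCube k)) :
    IntegrableOn (fun w => g (P w) * areaDensity P w) (openCube k) := by
  rw [← himg] at hg
  rw [integrableOn_image_iff_integrableOn_abs_det_fderiv_smul volume
    (isOpen_openCube k).measurableSet
    (fun w hw => (hT.differentiableAt ((isOpen_openCube k).mem_nhds hw)).hasFDerivAt.hasFDerivWithinAt)
    hinj] at hg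
  exact (integrableOn_congr_fun (areaDensity_reparam hT himg hP' h g)
    (isOpen_openCube k).measurableSet).1 hg

end Reparam

/-- Gram determinants of a family of vectors from which one is removed, in terms of the dual
family `K`. -/
lemma det_gram_succAbove (A K : Matrix (Fin (k + 1)) (Fin d) ℝ)
    (h : (A * A.transpose) * (K * K.transpose) = 1) (a : Fin (k + 1)) :
    (A.submatrix a.succAbove id * (A.submatrix a.succAbove id).transpose).det
      = (A * A.transpose).det * ∑ l, K a l ^ 2 := by
  -- The reduced Gram determinant is a diagonal cofactor of the full Gram matrix. The adjugate is
  -- the determinant times the inverse, and the inverse is the Gram matrix of the dual family.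
  have h1 : (A * A.transpose).adjugate a a
      = (A.submatrix a.succAbove id * (A.submatrix a.succAbove id).transpose).det := by
    rw [Matrix.adjugate_fin_succ_eq_det_submatrix, Even.neg_one_pow ⟨_, rfl⟩, one_mul]
    rfl
  have h2 : (A * A.transpose).adjugate = (A * A.transpose).det • (K * K.transpose) := by
    calc (A * A.transpose).adjugate
        = (A * A.transpose).adjugate * ((A * A.transpose) * (K * K.transpose)) := by rw [h, mul_one]
      _ = _ := by rw [← Matrix.mul_assoc, Matrix.adjugate_mul, Matrix.smul_mul, Matrix.one_mul]
  rw [← h1, h2]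
  simp [Matrix.mul_apply, sq]

/-- Jacobi's formula. The determinant is multilinear in the rows, so its derivative is a sum over
replaced rows, and Cramer's rule evaluates each replaced determinant through the adjugate. -/
lemma hasFDerivAt_det {M : Vec d → Matrix (Fin k) (Fin k) ℝ} {y : Vec d}
    (hM : ∀ b j, DifferentiableAt ℝ (fun y => M y b j) y) (a : Fin d) :
    pd a (fun y => (M y).det) y = ∑ b, ∑ j, (M y).adjugate j b * pd a (fun y => M y b j) y := by
  let D : ContinuousMultilinearMap ℝ (fun _ : Fin k => Fin k → ℝ) ℝ :=
    ⟨(Matrix.detRowAlternating (R := ℝ) (n := Fin k)).toMultilinearMap, by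
      change Continuous fun N : Matrix (Fin k) (Fin k) ℝ => N.det
      fun_prop⟩
  let M' : Vec d → Fin k → Fin k → ℝ := fun y b j => M y b j
  have hM' : DifferentiableAt ℝ M' y :=
    differentiableAt_pi.2 fun b => differentiableAt_pi.2 fun j => hM b j
  have h1 : HasFDerivAt (fun y => (M y).det) ((D.linearDeriv (M' y)).comp (fderiv ℝ M' y)) y :=
    (D.hasFDerivAt (M' y)).comp y hM'.hasFDerivAt
  unfold pd
  rw [h1.fderiv, ContinuousLinearMap.comp_apply, ContinuousMultilinearMap.linearDeriv_apply]
  refine Finset.sum_congr rfl fun b _ => ?_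
  have h2 : D (Function.update (M' y) b (fderiv ℝ M' y (Pi.single a 1) b))
      = (Matrix.updateRow (M y) b (fderiv ℝ M' y (Pi.single a 1) b)).det := rfl
  rw [h2, ← Matrix.det_transpose, ← Matrix.updateCol_transpose, ← Matrix.cramer_apply,
    Matrix.cramer_eq_adjugate_mulVec, ← Matrix.adjugate_transpose]
  change ∑ j, (M y).adjugate.transpose b j * fderiv ℝ M' y (Pi.single a 1) b j = _
  refine Finset.sum_congr rfl fun j _ => ?_
  have h3 : fderiv ℝ M' y (Pi.single a 1) b j = fderiv ℝ (fun y => M y b j) y (Pi.single a 1) := by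
    have h4 : HasFDerivAt (fun y => M' y b j) ((ContinuousLinearMap.proj (R := ℝ) j).comp
        ((ContinuousLinearMap.proj (R := ℝ) (φ := fun _ : Fin k => Fin k → ℝ) b).comp
          (fderiv ℝ M' y))) y :=
      hasFDerivAt_pi'.1 (hasFDerivAt_pi'.1 hM'.hasFDerivAt b) j
    rw [show (fun y => M y b j) = fun y => M' y b j from rfl, h4.fderiv]; rfl
  rw [h3]; rfl

end Flexo
end

noncomputable section
namespace Flexo

variable {d k : ℕ}

/-! ### Curvilinear coordinates -/

/-- The gradients of the coordinates of a chart, as rows of a matrix. -/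
def gradMat (e : Vec d → Vec d) (x : Vec d) : Matrix (Fin d) (Fin d) ℝ :=
  Matrix.of fun a j => pd j (fun y => e y a) x

/-- A chart of class `C²` in both directions. -/
structure IsC2Chart (e : OpenPartialHomeomorph (Vec d) (Vec d)) : Prop where
  contDiffOn : ContDiffOn ℝ 2 e e.source
  symm_contDiffOn : ContDiffOn ℝ 2 e.symm e.target

namespace IsC2Chart

variable {e : OpenPartialHomeomorph (Vec d) (Vec d)} (he : IsC2Chart e)

include he

lemma contDiffOn_coord (a : Fin d) : ContDiffOn ℝ 2 (fun x => e x a) e.source :=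
  contDiffOn_pi.1 he.contDiffOn a

lemma symm_contDiffOn_coord (j : Fin d) : ContDiffOn ℝ 2 (fun y => e.symm y j) e.target :=
  contDiffOn_pi.1 he.symm_contDiffOn j

lemma differentiableAt {x : Vec d} (hx : x ∈ e.source) : DifferentiableAt ℝ e x :=
  (he.contDiffOn.differentiableOn (by norm_num)).differentiableAt (e.open_source.mem_nhds hx)

lemma symm_differentiableAt {y : Vec d} (hy : y ∈ e.target) : DifferentiableAt ℝ e.symm y :=
  (he.symm_contDiffOn.differentiableOn (by norm_num)).differentiableAt (e.open_target.mem_nhds hy)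

lemma contDiffOn_gradMat (a j : Fin d) : ContDiffOn ℝ 1 (fun x => gradMat e x a j) e.source :=
  contDiffOn_pd (n := 2) (m := 1) e.open_source le_rfl (he.contDiffOn_coord a) j

lemma contDiffOn_tanMat (a j : Fin d) :
    ContDiffOn ℝ 1 (fun y => tanMat e.symm y a j) e.target :=
  contDiffOn_pd (n := 2) (m := 1) e.open_target le_rfl (he.symm_contDiffOn_coord j) a

lemma gradMat_symm (a j l : Fin d) {x : Vec d} (hx : x ∈ e.source) :
    pd l (fun x => gradMat e x a j) x = pd j (fun x => gradMat e x a l) x :=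
  pd_comm ((he.contDiffOn_coord a).contDiffAt (e.open_source.mem_nhds hx)) l j

/-- Differentiating `e ∘ e.symm = id` shows that the coordinate tangents and the coordinate
gradients are dual bases. All later frame identities on sides and edges rest on this duality. -/
lemma tanMat_mul_gradMat {y : Vec d} (hy : y ∈ e.target) :
    tanMat e.symm y * (gradMat e (e.symm y)).transpose = 1 := by
  ext b a
  have hev : (fun y => e (e.symm y) a) =ᶠ[𝓝 y] fun y => y a := by
    filter_upwards [e.open_target.mem_nhds hy] with z hz
    rw [e.right_inv hz]
  have h := pd_congr hev b
  rw [pd_coord, pd_comp (f := fun x => e x a)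
    (differentiableAt_pi.1 (he.differentiableAt (e.map_target hy)) a)
    (he.symm_differentiableAt hy)] at h
  rw [Matrix.mul_apply, Matrix.one_apply]
  simp only [tanMat, gradMat, Matrix.of_apply, Matrix.transpose_apply]
  simp only [eq_comm (a := b), ← h]
  exact Finset.sum_congr rfl fun _ _ => mul_comm _ _

lemma sum_tanMat_mul_gradMat {y : Vec d} (hy : y ∈ e.target) (b a : Fin d) :
    ∑ j, tanMat e.symm y b j * gradMat e (e.symm y) a j = if b = a then 1 else 0 := by
  have := congrFun (congrFun (he.tanMat_mul_gradMat hy) b) a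
  rwa [Matrix.mul_apply, Matrix.one_apply] at this

lemma sum_gradMat_mul_tanMat {y : Vec d} (hy : y ∈ e.target) (j l : Fin d) :
    ∑ a, gradMat e (e.symm y) a j * tanMat e.symm y a l = if j = l then 1 else 0 := by
  have h := mul_eq_one_comm.1 (he.tanMat_mul_gradMat hy)
  have := congrFun (congrFun h j) l
  rwa [Matrix.mul_apply, Matrix.one_apply] at this

lemma contDiffOn_det_tanMat : ContDiffOn ℝ 1 (fun y => (tanMat e.symm y).det) e.target := by
  simp only [Matrix.det_apply']
  exact ContDiffOn.sum fun σ _ => contDiffOn_const.mul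
    (contDiffOn_prod fun i _ => he.contDiffOn_tanMat (σ i) i)

lemma det_tanMat_ne_zero {y : Vec d} (hy : y ∈ e.target) : (tanMat e.symm y).det ≠ 0 := by
  intro h
  have := congrArg Matrix.det (he.tanMat_mul_gradMat hy)
  rw [Matrix.det_mul, h] at this
  simp at this

lemma adjugate_tanMat {y : Vec d} (hy : y ∈ e.target) (j b : Fin d) :
    (tanMat e.symm y).adjugate j b = (tanMat e.symm y).det * gradMat e (e.symm y) b j := by
  have h : (tanMat e.symm y).adjugate
      = (tanMat e.symm y).det • (gradMat e (e.symm y)).transpose := by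
    calc (tanMat e.symm y).adjugate
        = (tanMat e.symm y).adjugate * (tanMat e.symm y * (gradMat e (e.symm y)).transpose) := by
          rw [he.tanMat_mul_gradMat hy, mul_one]
      _ = _ := by rw [← Matrix.mul_assoc, Matrix.adjugate_mul, Matrix.smul_mul, Matrix.one_mul]
  rw [h]; rfl

lemma differentiableAt_tanMat {y : Vec d} (hy : y ∈ e.target) (a j : Fin d) :
    DifferentiableAt ℝ (fun y => tanMat e.symm y a j) y :=
  ((he.contDiffOn_tanMat a j).differentiableOn one_ne_zero).differentiableAt
    (e.open_target.mem_nhds hy)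

lemma differentiableAt_gradMat {x : Vec d} (hx : x ∈ e.source) (a j : Fin d) :
    DifferentiableAt ℝ (fun x => gradMat e x a j) x :=
  ((he.contDiffOn_gradMat a j).differentiableOn one_ne_zero).differentiableAt
    (e.open_source.mem_nhds hx)

lemma differentiableAt_gradMat_symm {y : Vec d} (hy : y ∈ e.target) (a j : Fin d) :
    DifferentiableAt ℝ (fun y => gradMat e (e.symm y) a j) y :=
  (he.differentiableAt_gradMat (e.map_target hy) a j).comp y (he.symm_differentiableAt hy)

/-- The derivative of the Jacobian determinant. -/
lemma pd_det_tanMat {y : Vec d} (hy : y ∈ e.target) (a : Fin d) :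
    pd a (fun y => (tanMat e.symm y).det) y = -(tanMat e.symm y).det *
      ∑ b, ∑ j, tanMat e.symm y a j * pd b (fun y => gradMat e (e.symm y) b j) y := by
  rw [hasFDerivAt_det (M := tanMat e.symm) (fun b j => he.differentiableAt_tanMat hy b j),
    neg_mul, ← mul_neg, ← Finset.sum_neg_distrib, Finset.mul_sum]
  refine Finset.sum_congr rfl fun b _ => ?_
  -- Differentiating the constant duality pairing trades derivatives of the tangents, as produced by
  -- Jacobi's formula, for derivatives of the gradients.
  have h0 : ∑ j, (pd b (fun y => tanMat e.symm y a j) y * gradMat e (e.symm y) b j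
      + tanMat e.symm y a j * pd b (fun y => gradMat e (e.symm y) b j) y) = 0 := by
    have hev : (fun y => ∑ j, tanMat e.symm y a j * gradMat e (e.symm y) b j)
        =ᶠ[𝓝 y] fun _ => if a = b then 1 else 0 := by
      filter_upwards [e.open_target.mem_nhds hy] with z hz
      exact he.sum_tanMat_mul_gradMat hz a b
    have h := pd_congr hev b
    rw [pd_const, pd_sum fun j _ => (he.differentiableAt_tanMat hy a j).fun_mul
      (he.differentiableAt_gradMat_symm hy b j)] at h
    rw [← h]
    refine Finset.sum_congr rfl fun j _ => ?_
    rw [pd_mul (he.differentiableAt_tanMat hy a j) (he.differentiableAt_gradMat_symm hy b j)]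
  rw [Finset.sum_add_distrib, add_comm, ← eq_neg_iff_add_eq_zero] at h0
  rw [h0, neg_neg, Finset.mul_sum]
  refine Finset.sum_congr rfl fun j _ => ?_
  have h1 : pd a (fun y => tanMat e.symm y b j) y = pd b (fun y => tanMat e.symm y a j) y :=
    pd_comm ((he.symm_contDiffOn_coord j).contDiffAt (e.open_target.mem_nhds hy)) a b
  rw [h1, he.adjugate_tanMat hy]; ring

/-- The Piola identity: the contravariant components of a vector field, multiplied by the Jacobian
determinant, have as divergence the divergence of the field times the Jacobian determinant. -/
lemma piola {V : Fin d → Vec d → ℝ} {y : Vec d} (hy : y ∈ e.target)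
    (hV : ∀ j, DifferentiableAt ℝ (V j) (e.symm y)) :
    ∑ a, pd a (fun y => (tanMat e.symm y).det *
        ∑ j, gradMat e (e.symm y) a j * V j (e.symm y)) y
      = (tanMat e.symm y).det * ∑ j, pd j (V j) (e.symm y) := by
  have hdet : DifferentiableAt ℝ (fun y => (tanMat e.symm y).det) y :=
    (he.contDiffOn_det_tanMat.differentiableOn one_ne_zero).differentiableAt
      (e.open_target.mem_nhds hy)
  have hG := fun a j => he.differentiableAt_gradMat_symm hy a j
  have hVs : ∀ j, DifferentiableAt ℝ (fun y => V j (e.symm y)) y := fun j =>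
    (hV j).comp y (he.symm_differentiableAt hy)
  have h1 : ∀ a, pd a (fun y => (tanMat e.symm y).det *
        ∑ j, gradMat e (e.symm y) a j * V j (e.symm y)) y
      = (tanMat e.symm y).det * (-(∑ l, (∑ b, ∑ j, tanMat e.symm y a j *
          pd b (fun y => gradMat e (e.symm y) b j) y) * (gradMat e (e.symm y) a l * V l (e.symm y)))
        + ∑ j, (pd a (fun y => gradMat e (e.symm y) a j) y * V j (e.symm y)
          + gradMat e (e.symm y) a j * ∑ l, pd l (V j) (e.symm y) * tanMat e.symm y a l)) := by
    intro a
    rw [pd_mul hdet (DifferentiableAt.fun_sum fun j _ => (hG a j).fun_mul (hVs j)),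
      pd_sum (fun j _ => (hG a j).fun_mul (hVs j)), he.pd_det_tanMat hy, ← Finset.mul_sum]
    have : ∀ j, pd a (fun y => gradMat e (e.symm y) a j * V j (e.symm y)) y
        = pd a (fun y => gradMat e (e.symm y) a j) y * V j (e.symm y)
          + gradMat e (e.symm y) a j * ∑ l, pd l (V j) (e.symm y) * tanMat e.symm y a l := by
      intro j
      rw [pd_mul (hG a j) (hVs j), pd_comp (hV j) (he.symm_differentiableAt hy)]; rfl
    simp only [this]; ring
  simp only [h1]
  rw [← Finset.mul_sum]
  congr 1
  rw [Finset.sum_add_distrib, Finset.sum_neg_distrib]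
  -- Duality contracts the term coming from the derivative of the determinant. The result is exactly
  -- the term in which the coordinate gradients are differentiated, with opposite sign, so only the
  -- derivatives of `V` survive.
  have hA : ∑ a, ∑ l, (∑ b, ∑ j, tanMat e.symm y a j *
          pd b (fun y => gradMat e (e.symm y) b j) y) * (gradMat e (e.symm y) a l * V l (e.symm y))
      = ∑ b, ∑ j, pd b (fun y => gradMat e (e.symm y) b j) y * V j (e.symm y) := by
    have : ∀ a l, (∑ b, ∑ j, tanMat e.symm y a j *
          pd b (fun y => gradMat e (e.symm y) b j) y) * (gradMat e (e.symm y) a l * V l (e.symm y))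
        = ∑ b, ∑ j, (pd b (fun y => gradMat e (e.symm y) b j) y * V l (e.symm y)) *
          (gradMat e (e.symm y) a l * tanMat e.symm y a j) := by
      intro a l
      simp only [Finset.sum_mul]
      exact Finset.sum_congr rfl fun b _ => Finset.sum_congr rfl fun j _ => by ring
    simp only [this]
    rw [Finset.sum_comm]
    simp only [Finset.sum_comm (s := (Finset.univ : Finset (Fin d))) (t := Finset.univ)
      (f := fun a b => ∑ j, (pd b (fun y => gradMat e (e.symm y) b j) y * V _ (e.symm y)) *
          (gradMat e (e.symm y) a _ * tanMat e.symm y a j))]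
    rw [Finset.sum_comm]
    refine Finset.sum_congr rfl fun b _ => ?_
    have : ∀ l, ∑ a, ∑ j, (pd b (fun y => gradMat e (e.symm y) b j) y * V l (e.symm y)) *
          (gradMat e (e.symm y) a l * tanMat e.symm y a j)
        = pd b (fun y => gradMat e (e.symm y) b l) y * V l (e.symm y) := by
      intro l
      rw [Finset.sum_comm]
      simp only [← Finset.mul_sum, he.sum_gradMat_mul_tanMat hy]
      simp
    simp only [this]
  have hB : ∑ a, ∑ j, gradMat e (e.symm y) a j * ∑ l, pd l (V j) (e.symm y) * tanMat e.symm y a l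
      = ∑ j, pd j (V j) (e.symm y) := by
    rw [Finset.sum_comm]
    refine Finset.sum_congr rfl fun j _ => ?_
    simp only [Finset.mul_sum]
    rw [Finset.sum_comm]
    have : ∀ l a, gradMat e (e.symm y) a j * (pd l (V j) (e.symm y) * tanMat e.symm y a l)
        = pd l (V j) (e.symm y) * (gradMat e (e.symm y) a j * tanMat e.symm y a l) := by
      intros; ring
    simp only [this, ← Finset.mul_sum, he.sum_gradMat_mul_tanMat hy]
    simp
  simp only [Finset.sum_add_distrib]
  rw [hA, hB]; ring

end IsC2Chart

end Flexo
end

noncomputable section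
namespace Flexo

variable {d k n : ℕ}

/-! ### The divergence theorem in the unit cube -/

/-- Insertion of a coordinate. -/
def ins (a : Fin (n + 1)) (c : ℝ) (z : Vec n) : Vec (n + 1) := a.insertNth c z

@[simp] lemma ins_same (a : Fin (n + 1)) (c : ℝ) (z : Vec n) : ins a c z a = c := by
  simp [ins]

@[simp] lemma ins_succAbove (a : Fin (n + 1)) (c : ℝ) (z : Vec n) (i : Fin n) :
    ins a c z (a.succAbove i) = z i := by
  simp [ins]

lemma contDiff_ins (a : Fin (n + 1)) (c : ℝ) : ContDiff ℝ 2 (ins a c) := by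
  rw [contDiff_pi, Fin.forall_iff_succAbove a]
  refine ⟨by simpa using contDiff_const, fun i => ?_⟩
  simp only [ins_succAbove]
  exact contDiff_apply ℝ ℝ i

lemma ins_mem_Icc (a : Fin (n + 1)) {c : ℝ} (hc : c ∈ Icc (0 : ℝ) 1) {z : Vec n}
    (hz : z ∈ Icc (0 : Vec n) 1) : ins a c z ∈ Icc (0 : Vec (n + 1)) 1 := by
  refine ⟨fun i => ?_, fun i => ?_⟩
  · rcases Fin.eq_self_or_eq_succAbove a i with rfl | ⟨j, rfl⟩
    · simpa using hc.1
    · simpa using hz.1 j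
  · rcases Fin.eq_self_or_eq_succAbove a i with rfl | ⟨j, rfl⟩
    · simpa using hc.2
    · simpa using hz.2 j

lemma sideVal_mem (b : Bool) : sideVal b ∈ Icc (0 : ℝ) 1 := by cases b <;> simp [sideVal]

lemma sideSign_mul_self (b : Bool) : sideSign b * sideSign b = 1 := by cases b <;> simp [sideSign]

lemma abs_sideSign (b : Bool) : |sideSign b| = 1 := by cases b <;> simp [sideSign]

lemma pd_ins {f : Vec (n + 1) → ℝ} {a : Fin (n + 1)} {c : ℝ} {z : Vec n}
    (hf : DifferentiableAt ℝ f (ins a c z)) (α : Fin n) :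
    pd α (fun z => f (ins a c z)) z = pd (a.succAbove α) f (ins a c z) := by
  rw [pd_comp hf ((contDiff_ins a c).differentiable (by norm_num) z), Fin.sum_univ_succAbove _ a]
  simp only [ins_same, ins_succAbove, pd_const, pd_coord]
  simp

/-- The divergence theorem in the unit cube. -/
lemma integral_divergence_cube {U : Set (Vec (n + 1))} (hU : IsOpen U)
    (hcube : Icc 0 1 ⊆ U) {f : Fin (n + 1) → Vec (n + 1) → ℝ} (hf : ∀ i, ContDiffOn ℝ 1 (f i) U) :
    ∫ x in openCube (n + 1), ∑ i, pd i (f i) x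
      = ∑ i, ∑ b : Bool, sideSign b * ∫ z in openCube n, f i (ins i (sideVal b) z) := by
  have hc : ∀ i, ContinuousOn (pd i (f i)) U := fun i =>
    (contDiffOn_pd (n := 1) (m := 0) hU le_rfl (hf i) i).continuousOn
  have h := integral_divergence_of_hasFDerivAt_off_countable' (E := ℝ) (a := (0 : Vec (n + 1)))
    (b := 1) zero_le_one f (fun i => fderiv ℝ (f i)) ∅ countable_empty
    (fun i => (hf i).continuousOn.mono hcube)
    (fun x hx i => ((hf i).differentiableOn one_ne_zero |>.differentiableAt
      (hU.mem_nhds (hcube (openCube_subset_Icc _ hx.1)))).hasFDerivAt)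
    ((continuousOn_finsetSum _ fun i _ => (hc i).mono hcube).integrableOn_compact isCompact_Icc)
  rw [setIntegral_congr_set (openCube_ae_eq_Icc _)]
  refine h.trans (Finset.sum_congr rfl fun i _ => ?_)
  rw [Fintype.sum_bool, setIntegral_congr_set (openCube_ae_eq_Icc _),
    setIntegral_congr_set (openCube_ae_eq_Icc _)]
  simp only [sideSign, sideVal, ins]
  rw [one_mul, neg_one_mul, sub_eq_add_neg]
  rfl

/-! ### Normals, conormals and surface gradients of coordinate surfaces -/

/-- The unit normal to the level sets of the coordinate `a` of `e`. -/
def unitNormal (e : Vec d → Vec d) (a : Fin d) (b : Bool) (j : Fin d) (x : Vec d) : ℝ :=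
  sideSign b * gradMat e x a j / √(∑ l, gradMat e x a l ^ 2)

/-- The surface gradient for the normal field `ν`. -/
def surfaceGrad (ν : Fin d → Vec d → ℝ) (j : Fin d) (f : Vec d → ℝ) (x : Vec d) : ℝ :=
  ∑ k, pd k f x * ((if k = j then 1 else 0) - ν k x * ν j x)

/-- The surface gradient of the coordinate `a'` on a level set of the coordinate `a`. -/
def surfaceCoordGrad (e : Vec d → Vec d) (a : Fin d) (b : Bool) (a' j : Fin d) (x : Vec d) : ℝ :=
  surfaceGrad (unitNormal e a b) j (fun y => e y a') x

/-- The unit conormal. -/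
def unitConormal (e : Vec d → Vec d) (a : Fin d) (b : Bool) (a' : Fin d) (b' : Bool) (j : Fin d)
    (x : Vec d) : ℝ :=
  sideSign b' * surfaceCoordGrad e a b a' j x / √(∑ l, surfaceCoordGrad e a b a' l x ^ 2)

lemma surfaceGrad_eq (ν : Fin d → Vec d → ℝ) (j : Fin d) (f : Vec d → ℝ) (x : Vec d) :
    surfaceGrad ν j f x = pd j f x - (∑ k, pd k f x * ν k x) * ν j x := by
  simp only [surfaceGrad, mul_sub, Finset.sum_sub_distrib, Finset.sum_mul, mul_assoc]
  simp

lemma surfaceCoordGrad_eq (e : Vec d → Vec d) (a : Fin d) (b : Bool) (a' j : Fin d) (x : Vec d) :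
    surfaceCoordGrad e a b a' j x = gradMat e x a' j
      - (∑ k, gradMat e x a' k * unitNormal e a b k x) * unitNormal e a b j x :=
  surfaceGrad_eq _ _ _ _

/-- The parametrization of a face of a curvilinear cell. -/
def faceMap (e : OpenPartialHomeomorph (Vec (n + 1)) (Vec (n + 1))) (a : Fin (n + 1)) (b : Bool)
    (z : Vec n) : Vec (n + 1) := e.symm (ins a (sideVal b) z)

/-- The parametrization of an edge of a curvilinear cell. -/
def edgeMap (e : OpenPartialHomeomorph (Vec (n + 2)) (Vec (n + 2))) (a : Fin (n + 2)) (b : Bool)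
    (a₁ : Fin (n + 1)) (b₁ : Bool) (w : Vec n) : Vec (n + 2) :=
  faceMap e a b (ins a₁ (sideVal b₁) w)

namespace IsC2Chart

section Pointwise

variable {e : OpenPartialHomeomorph (Vec d) (Vec d)} (he : IsC2Chart e)

include he

lemma sum_tanMat_mul_gradMat' {x : Vec d} (hx : x ∈ e.source) (b a : Fin d) :
    ∑ j, tanMat e.symm (e x) b j * gradMat e x a j = if b = a then 1 else 0 := by
  have := he.sum_tanMat_mul_gradMat (e.map_source hx) b a
  rwa [e.left_inv hx] at this

lemma sum_gradMat_mul_tanMat' {x : Vec d} (hx : x ∈ e.source) (j l : Fin d) :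
    ∑ a, gradMat e x a j * tanMat e.symm (e x) a l = if j = l then 1 else 0 := by
  have := he.sum_gradMat_mul_tanMat (e.map_source hx) j l
  rwa [e.left_inv hx] at this

lemma sum_gradMat_sq_pos {x : Vec d} (hx : x ∈ e.source) (a : Fin d) :
    0 < ∑ l, gradMat e x a l ^ 2 := by
  refine lt_of_le_of_ne (Finset.sum_nonneg fun _ _ => sq_nonneg _) fun h => ?_
  have h0 := (Finset.sum_eq_zero_iff_of_nonneg fun _ _ => sq_nonneg _).1 h.symm
  have h1 := he.sum_tanMat_mul_gradMat' hx a a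
  rw [Finset.sum_eq_zero] at h1
  · simp at h1
  · intro j hj
    rw [pow_eq_zero_iff two_ne_zero |>.1 (h0 j hj), mul_zero]

lemma sqrt_sum_gradMat_pos {x : Vec d} (hx : x ∈ e.source) (a : Fin d) :
    0 < √(∑ l, gradMat e x a l ^ 2) := Real.sqrt_pos.2 (he.sum_gradMat_sq_pos hx a)

lemma gradMat_eq {x : Vec d} (hx : x ∈ e.source) (a : Fin d) (b : Bool) (j : Fin d) :
    gradMat e x a j
      = sideSign b * √(∑ l, gradMat e x a l ^ 2) * unitNormal e a b j x := by
  have h := (he.sqrt_sum_gradMat_pos hx a).ne'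
  unfold unitNormal
  rw [mul_comm (sideSign b) (√_), mul_assoc, ← mul_div_assoc, ← mul_assoc (sideSign b),
    sideSign_mul_self, one_mul, mul_div_cancel₀ _ h]

lemma sum_unitNormal_sq {x : Vec d} (hx : x ∈ e.source) (a : Fin d) (b : Bool) :
    ∑ j, unitNormal e a b j x * unitNormal e a b j x = 1 := by
  have h := he.sum_gradMat_sq_pos hx a
  have h1 : ∀ j, unitNormal e a b j x * unitNormal e a b j x
      = gradMat e x a j ^ 2 / ∑ l, gradMat e x a l ^ 2 := by
    intro j
    unfold unitNormal
    rw [div_mul_div_comm, Real.mul_self_sqrt h.le, mul_mul_mul_comm, sideSign_mul_self, one_mul, sq]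
  simp only [h1]
  rw [← Finset.sum_div, div_self h.ne']

lemma sum_tanMat_mul_unitNormal {x : Vec d} (hx : x ∈ e.source) {a β : Fin d} (b : Bool)
    (hβ : β ≠ a) : ∑ j, tanMat e.symm (e x) β j * unitNormal e a b j x = 0 := by
  have h := he.sum_tanMat_mul_gradMat' hx β a
  rw [if_neg hβ] at h
  simp only [unitNormal, ← mul_div_assoc, ← Finset.sum_div]
  rw [div_eq_zero_iff]; left
  rw [← mul_zero (sideSign b), ← h, Finset.mul_sum]
  exact Finset.sum_congr rfl fun _ _ => by ring

lemma contDiffOn_sqrt_gradMat (a : Fin d) :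
    ContDiffOn ℝ 1 (fun x => √(∑ l, gradMat e x a l ^ 2)) e.source :=
  ContDiffOn.sqrt (ContDiffOn.sum fun l _ => (he.contDiffOn_gradMat a l).pow 2)
    fun _ hx => (he.sum_gradMat_sq_pos hx a).ne'

lemma contDiffOn_unitNormal (a : Fin d) (b : Bool) (j : Fin d) :
    ContDiffOn ℝ 1 (unitNormal e a b j) e.source :=
  (contDiffOn_const.mul (he.contDiffOn_gradMat a j)).div (he.contDiffOn_sqrt_gradMat a)
    fun _ hx => (he.sqrt_sum_gradMat_pos hx a).ne'

/-- Projecting a gradient onto the side only removes a multiple of the normal, which the tangents of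
the side do not see. Hence the duality of tangents and gradients persists within the side. -/
lemma sum_tanMat_mul_surfaceCoordGrad {x : Vec d} (hx : x ∈ e.source) {a β : Fin d} (b : Bool)
    (hβ : β ≠ a) (a' : Fin d) :
    ∑ j, tanMat e.symm (e x) β j * surfaceCoordGrad e a b a' j x = if β = a' then 1 else 0 := by
  have : ∀ j, tanMat e.symm (e x) β j * surfaceCoordGrad e a b a' j x
      = tanMat e.symm (e x) β j * gradMat e x a' j
      - (∑ k, gradMat e x a' k * unitNormal e a b k x) *
        (tanMat e.symm (e x) β j * unitNormal e a b j x) := by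
    intro j; rw [surfaceCoordGrad_eq]; ring
  simp only [this, Finset.sum_sub_distrib, ← Finset.mul_sum]
  rw [he.sum_tanMat_mul_unitNormal hx b hβ, he.sum_tanMat_mul_gradMat' hx, mul_zero, sub_zero]

lemma sum_surfaceCoordGrad_sq_pos {x : Vec d} (hx : x ∈ e.source) {a a' : Fin d} (b : Bool)
    (ha : a' ≠ a) : 0 < ∑ l, surfaceCoordGrad e a b a' l x ^ 2 := by
  refine lt_of_le_of_ne (Finset.sum_nonneg fun _ _ => sq_nonneg _) fun h => ?_
  have h0 := (Finset.sum_eq_zero_iff_of_nonneg fun _ _ => sq_nonneg _).1 h.symm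
  have h1 := he.sum_tanMat_mul_surfaceCoordGrad hx b ha a'
  rw [Finset.sum_eq_zero] at h1
  · simp at h1
  · intro j hj
    rw [pow_eq_zero_iff two_ne_zero |>.1 (h0 j hj), mul_zero]

lemma surfaceCoordGrad_eq_conormal {x : Vec d} (hx : x ∈ e.source) {a a' : Fin d} (b b' : Bool)
    (ha : a' ≠ a) (j : Fin d) : surfaceCoordGrad e a b a' j x
      = sideSign b' * √(∑ l, surfaceCoordGrad e a b a' l x ^ 2) * unitConormal e a b a' b' j x := by
  have h := (Real.sqrt_pos.2 (he.sum_surfaceCoordGrad_sq_pos hx b ha)).ne'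
  unfold unitConormal
  rw [mul_comm (sideSign b') (√_), mul_assoc, ← mul_div_assoc, ← mul_assoc (sideSign b'),
    sideSign_mul_self, one_mul, mul_div_cancel₀ _ h]

end Pointwise

/-! ### Area density of sides and the divergence theorem in a curvilinear cell. -/

section Density

variable {e : OpenPartialHomeomorph (Vec (n + 1)) (Vec (n + 1))} (he : IsC2Chart e)

include he

lemma tanMat_faceMap {a : Fin (n + 1)} {b : Bool} {z : Vec n}
    (hz : ins a (sideVal b) z ∈ e.target) :
    tanMat (faceMap e a b) z = (tanMat e.symm (ins a (sideVal b) z)).submatrix a.succAbove id := by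
  ext α j
  exact pd_ins (f := fun y => e.symm y j) (differentiableAt_pi.1 (he.symm_differentiableAt hz) j) α

/-- Nanson's formula. The coordinate gradients are dual to the coordinate tangents, so
`det_gram_succAbove` applies when the tangent of the fixed coordinate is removed. -/
lemma areaDensity_faceMap {a : Fin (n + 1)} {b : Bool} {z : Vec n}
    (hz : ins a (sideVal b) z ∈ e.target) :
    areaDensity (faceMap e a b) z = |(tanMat e.symm (ins a (sideVal b) z)).det| *
      √(∑ l, gradMat e (faceMap e a b z) a l ^ 2) := by
  set A := tanMat e.symm (ins a (sideVal b) z) with hA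
  set K := gradMat e (e.symm (ins a (sideVal b) z)) with hK
  have h1 : A * K.transpose = 1 := he.tanMat_mul_gradMat hz
  have h2 : A.transpose * K = 1 := by
    rw [← Matrix.transpose_inj, Matrix.transpose_mul, Matrix.transpose_transpose,
      Matrix.transpose_one]
    exact mul_eq_one_comm.1 h1
  have h3 : (A * A.transpose) * (K * K.transpose) = 1 := by
    rw [Matrix.mul_assoc, ← Matrix.mul_assoc _ K, h2, Matrix.one_mul, h1]
  unfold areaDensity
  rw [he.tanMat_faceMap hz, det_gram_succAbove A K h3 a, Matrix.det_mul, Matrix.det_transpose,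
    Real.sqrt_mul (mul_self_nonneg _), Real.sqrt_mul_self_eq_abs]
  rfl

/-- The Jacobian determinant is continuous and has no zeros on the connected cube, so its sign is
constant. The absolute value in the change of variables can thus be replaced by a constant factor,
after which the Piola identity applies. -/
lemma exists_sign (hcube : Icc 0 1 ⊆ e.target) :
    ∃ s : ℝ, ∀ y ∈ Icc (0 : Vec (n + 1)) 1, |(tanMat e.symm y).det| = s * (tanMat e.symm y).det := by
  have hc : ContinuousOn (fun y => (tanMat e.symm y).det) (Icc (0 : Vec (n + 1)) 1) :=
    he.contDiffOn_det_tanMat.continuousOn.mono hcube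
  have hconn : IsPreconnected (Icc (0 : Vec (n + 1)) 1) := (convex_Icc _ _).isPreconnected
  have h0 : (0 : Vec (n + 1)) ∈ Icc (0 : Vec (n + 1)) 1 := ⟨le_rfl, zero_le_one⟩
  have key : ∀ x ∈ Icc (0 : Vec (n + 1)) 1, ∀ y ∈ Icc (0 : Vec (n + 1)) 1,
      (tanMat e.symm x).det < 0 → 0 < (tanMat e.symm y).det → False := by
    intro x hx y hy h1 h2
    obtain ⟨w, hw, hw0⟩ := hconn.intermediate_value hx hy hc ⟨h1.le, h2.le⟩
    exact he.det_tanMat_ne_zero (hcube hw) hw0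
  rcases lt_or_gt_of_ne (he.det_tanMat_ne_zero (hcube h0)) with h | h
  · refine ⟨-1, fun y hy => ?_⟩
    rw [abs_of_nonpos (not_lt.1 fun h' => key 0 h0 y hy h h')]; ring
  · refine ⟨1, fun y hy => ?_⟩
    rw [abs_of_nonneg (not_lt.1 fun h' => key y hy 0 h0 h' h)]; ring

lemma integral_cell (hcube : Icc 0 1 ⊆ e.target) (f : Vec (n + 1) → ℝ) :
    ∫ x in e.symm '' openCube (n + 1), f x
      = ∫ y in openCube (n + 1), |(tanMat e.symm y).det| * f (e.symm y) := by
  have ht : openCube (n + 1) ⊆ e.target := (openCube_subset_Icc _).trans hcube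
  rw [integral_image_eq_integral_abs_det_fderiv_smul volume (isOpen_openCube _).measurableSet
    (fun w hw => (he.symm_differentiableAt (ht hw)).hasFDerivAt.hasFDerivWithinAt)
    (e.symm.injOn.mono ht)]
  refine setIntegral_congr_fun (isOpen_openCube _).measurableSet fun y hy => ?_
  simp only [det_fderiv (he.symm_differentiableAt (ht hy)), smul_eq_mul]

/-- The divergence theorem in a curvilinear cell. -/
lemma integral_divergence (hcube : Icc 0 1 ⊆ e.target) {U : Set (Vec (n + 1))} (hU : IsOpen U)
    (hcell : e.symm '' Icc 0 1 ⊆ U)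
    {V : Fin (n + 1) → Vec (n + 1) → ℝ} (hV : ∀ j, ContDiffOn ℝ 1 (V j) U) :
    ∫ x in e.symm '' openCube (n + 1), ∑ j, pd j (V j) x
      = ∑ a, ∑ b, ∫ z in openCube n, (∑ j, V j (faceMap e a b z) *
          unitNormal e a b j (faceMap e a b z)) * areaDensity (faceMap e a b) z := by
  obtain ⟨s, hs⟩ := he.exists_sign hcube
  set O : Set (Vec (n + 1)) := e.target ∩ e.symm ⁻¹' U with hO
  have hOo : IsOpen O := e.symm.isOpen_inter_preimage hU
  have hOc : Icc 0 1 ⊆ O := fun y hy => ⟨hcube hy, hcell (mem_image_of_mem _ hy)⟩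
  have hsymm : ContDiffOn ℝ 1 e.symm O :=
    (he.symm_contDiffOn.of_le (by norm_num)).mono inter_subset_left
  have hW : ∀ a, ContDiffOn ℝ 1 (fun y => (tanMat e.symm y).det *
        ∑ j, gradMat e (e.symm y) a j * V j (e.symm y)) O := by
    intro a
    refine (he.contDiffOn_det_tanMat.mono inter_subset_left).mul (ContDiffOn.sum fun j _ => ?_)
    exact ((he.contDiffOn_gradMat a j).comp hsymm fun y hy => e.map_target hy.1).mul
      ((hV j).comp hsymm fun y hy => hy.2)
  rw [he.integral_cell hcube]
  have h1 : ∀ y ∈ openCube (n + 1), |(tanMat e.symm y).det| * ∑ j, pd j (V j) (e.symm y)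
      = s * ∑ a, pd a (fun y => (tanMat e.symm y).det *
        ∑ j, gradMat e (e.symm y) a j * V j (e.symm y)) y := by
    intro y hy
    have hy' := openCube_subset_Icc _ hy
    rw [he.piola (hcube hy') fun j => ((hV j).differentiableOn one_ne_zero).differentiableAt
      (hU.mem_nhds (hOc hy').2), hs y hy', mul_assoc]
  rw [setIntegral_congr_fun (isOpen_openCube _).measurableSet h1, integral_const_mul,
    integral_divergence_cube hOo hOc hW, Finset.mul_sum]
  refine Finset.sum_congr rfl fun a _ => ?_
  rw [Finset.mul_sum]
  refine Finset.sum_congr rfl fun b _ => ?_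
  rw [← mul_assoc, ← integral_const_mul]
  refine setIntegral_congr_fun (isOpen_openCube _).measurableSet fun z hz => ?_
  have hz' := ins_mem_Icc a (sideVal_mem b) (openCube_subset_Icc _ hz)
  have hx : faceMap e a b z ∈ e.source := e.map_target (hcube hz')
  simp only [he.areaDensity_faceMap (hcube hz'), hs _ hz', Finset.mul_sum, Finset.sum_mul]
  refine Finset.sum_congr rfl fun j _ => ?_
  have := he.gradMat_eq hx a b j
  unfold faceMap at this ⊢
  rw [this]
  generalize √(∑ l, gradMat (↑e) (e.symm (ins a (sideVal b) z)) a l ^ 2) = g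
  -- The outward sign on the flat side of the cube and the sign relating the gradient to the
  -- exterior normal multiply to 1.
  have := sideSign_mul_self b
  linear_combination (s * (tanMat e.symm (ins a (sideVal b) z)).det * g *
    unitNormal e a b j (e.symm (ins a (sideVal b) z)) * V j (e.symm (ins a (sideVal b) z))) * this

end Density

end IsC2Chart

end Flexo
end

/-! ### The surface divergence theorem on a side of a curvilinear cell. -/

noncomputable section
namespace Flexo

variable {d n : ℕ}

namespace IsC2Chart

section Pointwise

variable {e : OpenPartialHomeomorph (Vec d) (Vec d)} (he : IsC2Chart e)

include he

lemma differentiableAt_unitNormal {x : Vec d} (hx : x ∈ e.source) (a : Fin d) (b : Bool)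
    (j : Fin d) : DifferentiableAt ℝ (unitNormal e a b j) x :=
  ((he.contDiffOn_unitNormal a b j).differentiableOn one_ne_zero).differentiableAt
    (e.open_source.mem_nhds hx)

lemma sum_pd_unitNormal_mul {x : Vec d} (hx : x ∈ e.source) (a : Fin d) (b : Bool) (k : Fin d) :
    ∑ l, pd k (unitNormal e a b l) x * unitNormal e a b l x = 0 := by
  have hν := fun l => he.differentiableAt_unitNormal hx a b l
  have hev : (fun x => ∑ l, unitNormal e a b l x * unitNormal e a b l x) =ᶠ[𝓝 x] fun _ => 1 := by
    filter_upwards [e.open_source.mem_nhds hx] with z hz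
    exact he.sum_unitNormal_sq hz a b
  have h := pd_congr hev k
  rw [pd_const, pd_sum fun l _ => (hν l).fun_mul (hν l)] at h
  have h2 : ∀ l, pd k (fun x => unitNormal e a b l x * unitNormal e a b l x) x
      = 2 * (pd k (unitNormal e a b l) x * unitNormal e a b l x) := by
    intro l; rw [pd_mul (hν l) (hν l)]; ring
  simp only [h2, ← Finset.mul_sum] at h
  linarith

/-- The derivative of the length of the gradient of a coordinate. -/
lemma pd_sqrt_gradMat {x : Vec d} (hx : x ∈ e.source) (a : Fin d) (b : Bool) (k : Fin d) :
    pd k (fun x => √(∑ l, gradMat e x a l ^ 2)) x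
      = (∑ j, unitNormal e a b j x * pd j (fun x => √(∑ l, gradMat e x a l ^ 2)) x)
          * unitNormal e a b k x
        + √(∑ l, gradMat e x a l ^ 2) * ∑ j, unitNormal e a b j x * pd j (unitNormal e a b k) x := by
  set g : Vec d → ℝ := fun x => √(∑ l, gradMat e x a l ^ 2) with hg
  have hgd : DifferentiableAt ℝ g x :=
    ((he.contDiffOn_sqrt_gradMat a).differentiableOn one_ne_zero).differentiableAt
      (e.open_source.mem_nhds hx)
  have hgx : 0 < g x := he.sqrt_sum_gradMat_pos hx a
  have hν := fun l => he.differentiableAt_unitNormal hx a b l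
  have hG := fun l => he.differentiableAt_gradMat hx a l
  have h1 : ∀ k, 2 * (g x * pd k g x) = ∑ l, 2 * (gradMat e x a l * pd k (fun x => gradMat e x a l) x) := by
    intro k
    have hev : (fun x => g x * g x) =ᶠ[𝓝 x] fun x => ∑ l, gradMat e x a l * gradMat e x a l := by
      filter_upwards [e.open_source.mem_nhds hx] with z hz
      rw [hg, Real.mul_self_sqrt (he.sum_gradMat_sq_pos hz a).le]
      exact Finset.sum_congr rfl fun _ _ => sq _
    have h := pd_congr hev k
    rw [pd_mul hgd hgd, pd_sum fun l _ => (hG l).fun_mul (hG l)] at h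
    rw [show 2 * (g x * pd k g x) = pd k g x * g x + g x * pd k g x by ring, h]
    refine Finset.sum_congr rfl fun l _ => ?_
    rw [pd_mul (hG l) (hG l)]; ring
  have h2 : ∀ l k, pd k (fun x => gradMat e x a l) x
      = sideSign b * (pd k g x * unitNormal e a b l x + g x * pd k (unitNormal e a b l) x) := by
    intro l k
    have hev : (fun x => gradMat e x a l) =ᶠ[𝓝 x]
        fun x => sideSign b * (g x * unitNormal e a b l x) := by
      filter_upwards [e.open_source.mem_nhds hx] with z hz
      rw [he.gradMat_eq hz a b l, mul_assoc]
    rw [pd_congr hev k, pd_const_mul _ (hgd.fun_mul (hν l)), pd_mul hgd (hν l)]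
  have h3 := h1 k
  rw [← Finset.mul_sum] at h3
  have h4 : g x * pd k g x = g x * ((∑ j, unitNormal e a b j x * pd j g x) * unitNormal e a b k x
        + g x * ∑ j, unitNormal e a b j x * pd j (unitNormal e a b k) x) := by
    rw [mul_left_cancel₀ two_ne_zero h3, Finset.sum_mul, Finset.mul_sum, ← Finset.sum_add_distrib,
      Finset.mul_sum]
    refine Finset.sum_congr rfl fun l _ => ?_
    -- The normal is proportional to a gradient: commuting second derivatives turn `∂_k` of the
    -- `l`-th component into `∂_l` of the `k`-th, which yields derivatives in the direction of the
    -- normal.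
    rw [he.gradMat_symm a l k hx, h2 k l, he.gradMat_eq hx a b l]
    have := sideSign_mul_self b
    simp only [hg]
    linear_combination (√(∑ l, gradMat e x a l ^ 2) * unitNormal e a b l x *
      (pd l (fun x => √(∑ l, gradMat e x a l ^ 2)) x * unitNormal e a b k x +
        √(∑ l, gradMat e x a l ^ 2) * pd l (unitNormal e a b k) x)) * this
  exact mul_left_cancel₀ hgx.ne' h4

/-- The level sets of the coordinate `a` foliate the chart domain, and the factor `|∇a|` relates the
area density on the leaves to the volume density. A field tangent to the leaves, weighted by this
factor, therefore has a spatial divergence equal to the weighted surface divergence. The mean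
curvature term appears because only the tangential part of `B` is kept. -/
lemma sum_pd_tangential {x : Vec d} (hx : x ∈ e.source) (a : Fin d) (b : Bool)
    {B : Fin d → Vec d → ℝ} (hB : ∀ j, DifferentiableAt ℝ (B j) x) :
    ∑ k, pd k (fun x => √(∑ l, gradMat e x a l ^ 2) *
        (B k x - (∑ j, B j x * unitNormal e a b j x) * unitNormal e a b k x)) x
      = √(∑ l, gradMat e x a l ^ 2) * (∑ j, surfaceGrad (unitNormal e a b) j (B j) x
        - (∑ l, surfaceGrad (unitNormal e a b) l (unitNormal e a b l) x) *
          ∑ j, B j x * unitNormal e a b j x) := by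
  have hpg := he.pd_sqrt_gradMat hx a b
  have hone := he.sum_unitNormal_sq hx a b
  have hperp := he.sum_pd_unitNormal_mul hx a b
  have hgd : DifferentiableAt ℝ (fun x => √(∑ l, gradMat e x a l ^ 2)) x :=
    ((he.contDiffOn_sqrt_gradMat a).differentiableOn one_ne_zero).differentiableAt
      (e.open_source.mem_nhds hx)
  have hν := fun l => he.differentiableAt_unitNormal hx a b l
  set g : Vec d → ℝ := fun x => √(∑ l, gradMat e x a l ^ 2) with hg
  change ∑ k, pd k (fun x => g x * (B k x - (∑ j, B j x * unitNormal e a b j x) *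
    unitNormal e a b k x)) x = g x * _
  set ν := unitNormal e a b with hνdef
  set β : Vec d → ℝ := fun x => ∑ j, B j x * ν j x with hβ
  have hβd : DifferentiableAt ℝ β x := DifferentiableAt.fun_sum fun j _ => (hB j).fun_mul (hν j)
  have hpβ : ∀ k, pd k β x = ∑ j, (pd k (B j) x * ν j x + B j x * pd k (ν j) x) := by
    intro k
    rw [hβ, pd_sum fun j _ => (hB j).fun_mul (hν j)]
    exact Finset.sum_congr rfl fun j _ => pd_mul (hB j) (hν j) k
  have h1 : ∀ k, pd k (fun x => g x * (B k x - β x * ν k x)) x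
      = pd k g x * (B k x - β x * ν k x)
        + g x * (pd k (B k) x - (pd k β x * ν k x + β x * pd k (ν k) x)) := by
    intro k
    rw [pd_mul hgd ((hB k).fun_sub (hβd.fun_mul (hν k))), pd_sub (hB k) (hβd.fun_mul (hν k)),
      pd_mul hβd (hν k)]
  -- By `pd_sqrt_gradMat` the derivative of the weight has a normal part, which is orthogonal to the
  -- tangential field (`h3`), and a part given by the derivative of the normal along itself.
  have h2 : ∀ k, pd k g x * (B k x - β x * ν k x)
      = (∑ j, ν j x * pd j g x) * (B k x * ν k x - β x * (ν k x * ν k x))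
        + g x * ∑ j, (B k x * (ν j x * pd j (ν k) x) - β x * (ν j x * (pd j (ν k) x * ν k x))) := by
    intro k
    rw [hpg k, Finset.sum_sub_distrib, ← Finset.mul_sum, ← Finset.mul_sum]
    simp only [← mul_assoc (ν _ x)]
    rw [← Finset.sum_mul]; ring
  have h3 : ∑ k, (∑ j, ν j x * pd j g x) * (B k x * ν k x - β x * (ν k x * ν k x)) = 0 := by
    rw [← Finset.mul_sum, Finset.sum_sub_distrib, ← Finset.mul_sum, hone, mul_one, sub_self,
      mul_zero]
  have h4 : ∑ k, ∑ j, ν j x * (pd j (ν k) x * ν k x) = 0 := by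
    rw [Finset.sum_comm]
    simp only [← Finset.mul_sum, hperp, mul_zero, Finset.sum_const_zero]
  -- A unit field is orthogonal to each of its derivatives, so its surface divergence equals its
  -- full divergence.
  have h5 : ∑ l, surfaceGrad ν l (ν l) x = ∑ l, pd l (ν l) x := by
    simp only [surfaceGrad_eq, Finset.sum_sub_distrib, Finset.sum_mul]
    rw [Finset.sum_comm (f := fun l k => pd k (ν l) x * ν k x * ν l x)]
    have : ∀ k, ∑ l, pd k (ν l) x * ν k x * ν l x = 0 := by
      intro k
      rw [← mul_zero (ν k x), ← hperp k, Finset.mul_sum]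
      exact Finset.sum_congr rfl fun _ _ => by ring
    simp only [this, Finset.sum_const_zero, sub_zero]
  rw [h5]
  change ∑ k, pd k (fun x => g x * (B k x - β x * ν k x)) x
    = g x * (∑ j, surfaceGrad ν j (B j) x - (∑ l, pd l (ν l) x) * β x)
  simp only [h1, h2, Finset.sum_add_distrib, h3, zero_add, ← Finset.mul_sum,
    Finset.sum_sub_distrib, h4, mul_zero, sub_zero]
  rw [← mul_add]
  refine congrArg (g x * ·) ?_
  simp only [surfaceGrad_eq, Finset.sum_sub_distrib]
  -- The second summand here cancels the contribution of the weight that is left over from `h2`.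
  have h6 : ∑ k, pd k β x * ν k x = ∑ j, (∑ k, pd k (B j) x * ν k x) * ν j x
      + ∑ k, B k x * ∑ j, ν j x * pd j (ν k) x := by
    simp only [hpβ, Finset.sum_mul, Finset.mul_sum, add_mul, Finset.sum_add_distrib]
    rw [Finset.sum_comm, Finset.sum_comm (f := fun k j => B j x * pd k (ν j) x * ν k x)]
    congr 1
    · exact Finset.sum_congr rfl fun _ _ => Finset.sum_congr rfl fun _ _ => by ring
    · exact Finset.sum_congr rfl fun _ _ => Finset.sum_congr rfl fun _ _ => by ring
  rw [h6]
  ring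

end Pointwise

section Surface

variable {e : OpenPartialHomeomorph (Vec (n + 2)) (Vec (n + 2))} (he : IsC2Chart e)

include he

/-- The cofactor argument for sides, repeated one dimension lower: the surface gradients of the free
coordinates are dual to the tangents of the side, and fixing one more coordinate removes one
tangent. -/
lemma areaDensity_edgeMap {a : Fin (n + 2)} {b : Bool} {a₁ : Fin (n + 1)} {b₁ : Bool} {w : Vec n}
    (hz : ins a (sideVal b) (ins a₁ (sideVal b₁) w) ∈ e.target) :
    areaDensity (edgeMap e a b a₁ b₁) w = areaDensity (faceMap e a b) (ins a₁ (sideVal b₁) w) *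
      √(∑ l, surfaceCoordGrad e a b (a.succAbove a₁) l (edgeMap e a b a₁ b₁ w) ^ 2) := by
  set z := ins a₁ (sideVal b₁) w with hzdef
  set x := faceMap e a b z with hxdef
  have hx : x ∈ e.source := e.map_target hz
  have hex : e x = ins a (sideVal b) z := e.right_inv hz
  set A : Matrix (Fin (n + 1)) (Fin (n + 2)) ℝ := tanMat (faceMap e a b) z with hA
  have hA' : ∀ α j, A α j = tanMat e.symm (e x) (a.succAbove α) j := by
    intro α j; rw [hA, he.tanMat_faceMap hz, hex]; rfl
  let K : Matrix (Fin (n + 1)) (Fin (n + 2)) ℝ :=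
    Matrix.of fun β l => surfaceCoordGrad e a b (a.succAbove β) l x
  have h1 : A * K.transpose = 1 := by
    ext α β
    rw [Matrix.mul_apply, Matrix.one_apply]
    simp only [hA', K, Matrix.transpose_apply, Matrix.of_apply]
    rw [he.sum_tanMat_mul_surfaceCoordGrad hx b (Fin.succAbove_ne a α)]
    simp
  -- The families are not square, so `Aᵀ K` is only the projection onto the tangent space. It still
  -- fixes the rows of `A`, which is all that the inversion of the Gram matrix requires.
  have h2 : ∀ j l, (A.transpose * K) j l
      = (if l = j then 1 else 0) - unitNormal e a b j x * unitNormal e a b l x := by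
    intro j l
    rw [Matrix.mul_apply]
    simp only [hA', K, Matrix.transpose_apply, Matrix.of_apply]
    -- The surface gradient of the fixed coordinate vanishes, so the sum over the side's coordinates
    -- can be completed to a sum over all of them.
    have h3 : tanMat e.symm (e x) a j * surfaceCoordGrad e a b a l x = 0 := by
      rw [surfaceCoordGrad_eq]
      have : ∑ k, gradMat e x a k * unitNormal e a b k x
          = sideSign b * √(∑ l, gradMat e x a l ^ 2) := by
        conv_lhs => enter [2, k]; rw [he.gradMat_eq hx a b k, mul_assoc]
        rw [← Finset.mul_sum, he.sum_unitNormal_sq hx, mul_one]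
      rw [this, he.gradMat_eq hx a b l]; ring
    have h4 : ∑ β, tanMat e.symm (e x) (a.succAbove β) j * surfaceCoordGrad e a b (a.succAbove β) l x
        = ∑ c, tanMat e.symm (e x) c j * surfaceCoordGrad e a b c l x := by
      rw [Fin.sum_univ_succAbove _ a, h3, zero_add]
    have h5 : ∀ c, tanMat e.symm (e x) c j * surfaceCoordGrad e a b c l x
        = gradMat e x c l * tanMat e.symm (e x) c j
          - ∑ k, unitNormal e a b k x * unitNormal e a b l x *
            (gradMat e x c k * tanMat e.symm (e x) c j) := by
      intro c
      rw [surfaceCoordGrad_eq, mul_sub, Finset.sum_mul, Finset.mul_sum]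
      congr 1
      · ring
      · exact Finset.sum_congr rfl fun _ _ => by ring
    rw [h4]
    simp only [h5, Finset.sum_sub_distrib]
    rw [Finset.sum_comm (f := fun c k => unitNormal e a b k x * unitNormal e a b l x *
            (gradMat e x c k * tanMat e.symm (e x) c j))]
    simp only [← Finset.mul_sum, he.sum_gradMat_mul_tanMat' hx]
    simp
  have h3 : (A * A.transpose) * (K * K.transpose) = 1 := by
    have h4 : A * (A.transpose * K) = A := by
      ext α l
      rw [Matrix.mul_apply]
      simp only [h2, hA', mul_sub, Finset.sum_sub_distrib, ← mul_assoc]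
      rw [← Finset.sum_mul, he.sum_tanMat_mul_unitNormal hx b (Fin.succAbove_ne a α)]
      simp
    rw [Matrix.mul_assoc, ← Matrix.mul_assoc _ K, ← Matrix.mul_assoc, h4, h1]
  have hfd : DifferentiableAt ℝ (faceMap e a b) z :=
    (he.symm_differentiableAt hz).comp z ((contDiff_ins a _).differentiable (by norm_num) z)
  have h6 : tanMat (edgeMap e a b a₁ b₁) w = A.submatrix a₁.succAbove id := by
    ext α j
    exact pd_ins (f := fun z => faceMap e a b z j) (differentiableAt_pi.1 hfd j) α
  change √_ = √_ * √(∑ l, surfaceCoordGrad e a b (a.succAbove a₁) l x ^ 2)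
  rw [h6, det_gram_succAbove A K h3 a₁, Real.sqrt_mul]
  · rfl
  -- Splitting the square root needs the Gram determinant of the side to be nonnegative, which the
  -- cofactor formula for the side itself provides.
  · rw [hA, he.tanMat_faceMap hz]
    have h7 := he.areaDensity_faceMap hz
    have := det_gram_succAbove (tanMat e.symm (ins a (sideVal b) z)) (gradMat e x) ?_ a
    · rw [this, Matrix.det_mul, Matrix.det_transpose]
      exact mul_nonneg (mul_self_nonneg _) (Finset.sum_nonneg fun _ _ => sq_nonneg _)
    · have h1 := he.tanMat_mul_gradMat hz
      have h2 : (tanMat e.symm (ins a (sideVal b) z)).transpose * gradMat e x = 1 := by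
        rw [← Matrix.transpose_inj, Matrix.transpose_mul, Matrix.transpose_transpose,
          Matrix.transpose_one]
        exact mul_eq_one_comm.1 h1
      rw [Matrix.mul_assoc, ← Matrix.mul_assoc _ (gradMat e x), h2, Matrix.one_mul]
      exact h1

/-- The surface divergence theorem on a face of a curvilinear cell. -/
lemma integral_surface_divergence (hcube : Icc 0 1 ⊆ e.target) {U : Set (Vec (n + 2))}
    (hU : IsOpen U) (hcell : e.symm '' Icc 0 1 ⊆ U) {B : Fin (n + 2) → Vec (n + 2) → ℝ}
    (hB : ∀ j, ContDiffOn ℝ 1 (B j) U) (a : Fin (n + 2)) (b : Bool) :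
    ∫ z in openCube (n + 1),
        (∑ j, surfaceGrad (unitNormal e a b) j (B j) (faceMap e a b z)
          - (∑ l, surfaceGrad (unitNormal e a b) l (unitNormal e a b l) (faceMap e a b z)) *
          ∑ j, B j (faceMap e a b z) * unitNormal e a b j (faceMap e a b z))
        * areaDensity (faceMap e a b) z
      = ∑ a₁, ∑ b₁, ∫ w in openCube n, (∑ j, B j (edgeMap e a b a₁ b₁ w) *
          unitConormal e a b (a.succAbove a₁) b₁ j (edgeMap e a b a₁ b₁ w))
          * areaDensity (edgeMap e a b a₁ b₁) w := by
  obtain ⟨s, hs⟩ := he.exists_sign hcube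
  set O : Set (Vec (n + 2)) := e.target ∩ e.symm ⁻¹' U with hO
  have hOo : IsOpen O := e.symm.isOpen_inter_preimage hU
  have hOc : Icc 0 1 ⊆ O := fun y hy => ⟨hcube hy, hcell (mem_image_of_mem _ hy)⟩
  have hsymm : ContDiffOn ℝ 1 e.symm O :=
    (he.symm_contDiffOn.of_le (by norm_num)).mono inter_subset_left
  -- The weighted tangential field of `sum_pd_tangential`; `W` below collects its contravariant
  -- components times the Jacobian determinant, as in the Piola identity.
  let V : Fin (n + 2) → Vec (n + 2) → ℝ := fun k x => √(∑ l, gradMat e x a l ^ 2) *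
        (B k x - (∑ j, B j x * unitNormal e a b j x) * unitNormal e a b k x)
  have hV : ∀ k, ContDiffOn ℝ 1 (V k) (U ∩ e.source) := by
    intro k
    refine ((he.contDiffOn_sqrt_gradMat a).mono inter_subset_right).mul
      (((hB k).mono inter_subset_left).sub ((ContDiffOn.sum fun j _ => ?_).mul
        ((he.contDiffOn_unitNormal a b k).mono inter_subset_right)))
    exact ((hB j).mono inter_subset_left).mul
        ((he.contDiffOn_unitNormal a b j).mono inter_subset_right)
  let W : Fin (n + 2) → Vec (n + 2) → ℝ := fun c y => (tanMat e.symm y).det *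
        ∑ j, gradMat e (e.symm y) c j * V j (e.symm y)
  have hW : ∀ c, ContDiffOn ℝ 1 (W c) O := by
    intro c
    refine (he.contDiffOn_det_tanMat.mono inter_subset_left).mul (ContDiffOn.sum fun j _ => ?_)
    exact ((he.contDiffOn_gradMat c j).comp hsymm fun y hy => e.map_target hy.1).mul
      ((hV j).comp hsymm fun y hy => ⟨hy.2, e.map_target hy.1⟩)
  have hsumV : ∀ x ∈ e.source, ∀ c, ∑ j, gradMat e x c j * V j x
      = √(∑ l, gradMat e x a l ^ 2) * ∑ j, surfaceCoordGrad e a b c j x * B j x := by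
    intro x hx c
    simp only [surfaceCoordGrad_eq, V, sub_mul, mul_sub, Finset.sum_sub_distrib, Finset.mul_sum,
      Finset.sum_mul]
    congr 1
    · exact Finset.sum_congr rfl fun _ _ => by ring
    · rw [Finset.sum_comm]
      exact Finset.sum_congr rfl fun _ _ => Finset.sum_congr rfl fun _ _ => by ring
  -- The field is tangent to every level set near the side, not only to the side. Hence its
  -- component `a` vanishes on an open set, its derivative drops out, and the divergence in the cube
  -- reduces to one in the parameters of the side.
  have hWa : ∀ y ∈ O, W a y = 0 := by
    intro y hy
    have hx : e.symm y ∈ e.source := e.map_target hy.1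
    simp only [W]
    rw [hsumV _ hx]
    have : ∀ j, surfaceCoordGrad e a b a j (e.symm y) = 0 := by
      intro j
      rw [surfaceCoordGrad_eq]
      have : ∑ k, gradMat e (e.symm y) a k * unitNormal e a b k (e.symm y)
          = sideSign b * √(∑ l, gradMat e (e.symm y) a l ^ 2) := by
        conv_lhs => enter [2, k]; rw [he.gradMat_eq hx a b k, mul_assoc]
        rw [← Finset.mul_sum, he.sum_unitNormal_sq hx, mul_one]
      rw [this, he.gradMat_eq hx a b j]; ring
    simp [this]
  have hins : ContDiff ℝ 1 (ins a (sideVal b)) := (contDiff_ins a _).of_le (by norm_num)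
  have hmem : ∀ z ∈ Icc (0 : Vec (n + 1)) 1, ins a (sideVal b) z ∈ Icc (0 : Vec (n + 2)) 1 :=
    fun z hz => ins_mem_Icc a (sideVal_mem b) hz
  have h1 : ∀ z ∈ openCube (n + 1),
      (∑ j, surfaceGrad (unitNormal e a b) j (B j) (faceMap e a b z)
          - (∑ l, surfaceGrad (unitNormal e a b) l (unitNormal e a b l) (faceMap e a b z)) *
          ∑ j, B j (faceMap e a b z) * unitNormal e a b j (faceMap e a b z))
        * areaDensity (faceMap e a b) z
      = s * ∑ α, pd α (fun z => W (a.succAbove α) (ins a (sideVal b) z)) z := by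
    intro z hz
    have hy := hmem z (openCube_subset_Icc _ hz)
    have hx : faceMap e a b z ∈ e.source := e.map_target (hcube hy)
    have hxU : faceMap e a b z ∈ U := (hOc hy).2
    have hWd : ∀ c, DifferentiableAt ℝ (W c) (ins a (sideVal b) z) := fun c =>
      ((hW c).differentiableOn one_ne_zero).differentiableAt (hOo.mem_nhds (hOc hy))
    have h2 : ∑ α, pd α (fun z => W (a.succAbove α) (ins a (sideVal b) z)) z
        = ∑ c, pd c (W c) (ins a (sideVal b) z) := by
      rw [Fin.sum_univ_succAbove _ a, pd_congr (g := fun _ => 0)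
        (Filter.eventually_of_mem (hOo.mem_nhds (hOc hy)) hWa), pd_const, zero_add]
      exact Finset.sum_congr rfl fun α _ => pd_ins (hWd _) α
    rw [h2, he.piola (hcube hy) fun j => ((hV j).differentiableOn one_ne_zero).differentiableAt
      ((hU.inter e.open_source).mem_nhds ⟨hxU, hx⟩)]
    have h3 := he.sum_pd_tangential hx a b (B := B) fun j =>
      ((hB j).differentiableOn one_ne_zero).differentiableAt (hU.mem_nhds hxU)
    rw [he.areaDensity_faceMap (hcube hy), hs _ hy]
    change _ = s * (_ * ∑ j, pd j (V j) (faceMap e a b z))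
    simp only [V]
    rw [h3]; ring
  rw [setIntegral_congr_fun (isOpen_openCube _).measurableSet h1, integral_const_mul,
    integral_divergence_cube (U := ins a (sideVal b) ⁻¹' O)
      (f := fun α z => W (a.succAbove α) (ins a (sideVal b) z))
      (hOo.preimage hins.continuous) (fun z hz => hOc (hmem z hz))
      (fun α => (hW _).comp hins.contDiffOn fun z hz => hz), Finset.mul_sum]
  refine Finset.sum_congr rfl fun a₁ _ => ?_
  rw [Finset.mul_sum]
  refine Finset.sum_congr rfl fun b₁ _ => ?_
  rw [← mul_assoc, ← integral_const_mul]
  refine setIntegral_congr_fun (isOpen_openCube _).measurableSet fun w hw => ?_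
  have hz := ins_mem_Icc a₁ (sideVal_mem b₁) (openCube_subset_Icc _ hw)
  have hy := hmem _ hz
  have hx : edgeMap e a b a₁ b₁ w ∈ e.source := e.map_target (hcube hy)
  rw [he.areaDensity_edgeMap (hcube hy), he.areaDensity_faceMap (hcube hy), hs _ hy]
  change s * sideSign b₁ * (_ * ∑ j, gradMat e (edgeMap e a b a₁ b₁ w) (a.succAbove a₁) j *
    V j (edgeMap e a b a₁ b₁ w)) = _ * (s * _ * √(∑ l, gradMat e (edgeMap e a b a₁ b₁ w) a l ^ 2) * _)
  rw [hsumV _ hx, Finset.sum_mul, Finset.mul_sum, Finset.mul_sum, Finset.mul_sum]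
  refine Finset.sum_congr rfl fun j _ => ?_
  rw [he.surfaceCoordGrad_eq_conormal hx b b₁ (Fin.succAbove_ne a a₁) j]
  have := sideSign_mul_self b₁
  generalize √(∑ l, gradMat e (edgeMap e a b a₁ b₁ w) a l ^ 2) = g
  generalize √(∑ l, surfaceCoordGrad e a b (a.succAbove a₁) l (edgeMap e a b a₁ b₁ w) ^ 2) = t
  generalize (tanMat e.symm (ins a (sideVal b) (ins a₁ (sideVal b₁) w))).det = D
  linear_combination (s * D * g * t * unitConormal e a b (a.succAbove a₁) b₁ j (edgeMap e a b a₁ b₁ w)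
    * B j (edgeMap e a b a₁ b₁ w)) * this

end Surface

end IsC2Chart

end Flexo
end

noncomputable section
namespace Flexo

variable {d n : ℕ}

/-! ### Green's formula of a second gradient field -/

/-- The surface traction of the stress `P` and the double stress `Q` for the normal field `ν`. -/
def tractionOf (ν P : Fin d → Vec d → ℝ) (Q : Fin d → Fin d → Vec d → ℝ) (x : Vec d) : ℝ :=
  (∑ j, (P j x + (∑ l, surfaceGrad ν l (ν l) x) * ∑ k, Q j k x * ν k x) * ν j x)
    - ∑ j, surfaceGrad ν j (fun y => ∑ k, Q j k y * ν k y) x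

/-- The double traction of the double stress `Q` for the normal field `ν`. -/
def doubleTractionOf (ν : Fin d → Vec d → ℝ) (Q : Fin d → Fin d → Vec d → ℝ) (x : Vec d) : ℝ :=
  ∑ j, ∑ k, Q j k x * ν j x * ν k x

/-- The derivative in the direction of `ν`. -/
def normalDeriv (ν : Fin d → Vec d → ℝ) (v : Vec d → ℝ) (x : Vec d) : ℝ := ∑ k, pd k v x * ν k x

/-- The gradient of `v` is split into its normal and surface parts. The product rule moves the
surface derivative off `v`; adding and subtracting the curvature term produces precisely the
traction, and the remainder in the last parentheses is the expression that the surface divergence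
theorem sends to the edges. -/
lemma sum_mul_normal_eq_traction {ν P : Fin d → Vec d → ℝ} {Q : Fin d → Fin d → Vec d → ℝ}
    {v : Vec d → ℝ} {x : Vec d} (hν : ∀ j, DifferentiableAt ℝ (ν j) x)
    (hQ : ∀ j k, DifferentiableAt ℝ (Q j k) x) (hv : DifferentiableAt ℝ v x) :
    ∑ j, (P j x * v x + ∑ k, Q k j x * pd k v x) * ν j x
      = (tractionOf ν P Q x * v x + doubleTractionOf ν Q x * normalDeriv ν v x)
        + (∑ j, surfaceGrad ν j (fun y => (∑ k, Q j k y * ν k y) * v y) x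
          - (∑ l, surfaceGrad ν l (ν l) x) * ∑ j, (∑ k, Q j k x * ν k x) * v x * ν j x) := by
  set A : Fin d → Vec d → ℝ := fun j y => ∑ k, Q j k y * ν k y with hA
  have hAd : ∀ j, DifferentiableAt ℝ (A j) x := fun j =>
    DifferentiableAt.fun_sum fun k _ => (hQ j k).fun_mul (hν k)
  have h1 : ∀ j, surfaceGrad ν j (fun y => A j y * v y) x
      = surfaceGrad ν j (A j) x * v x + A j x * pd j v x - A j x * normalDeriv ν v x * ν j x := by
    intro j
    have : ∀ k, pd k (fun y => A j y * v y) x = pd k (A j) x * v x + A j x * pd k v x :=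
      fun k => pd_mul (hAd j) hv k
    simp only [surfaceGrad_eq, normalDeriv, this, add_mul, Finset.sum_add_distrib, Finset.mul_sum,
      Finset.sum_mul, sub_mul]
    rw [show ∑ k, pd k (A j) x * v x * ν k x * ν j x = ∑ k, pd k (A j) x * ν k x * ν j x * v x from
        Finset.sum_congr rfl fun _ _ => by ring,
      show ∑ k, A j x * pd k v x * ν k x * ν j x = ∑ k, A j x * (pd k v x * ν k x) * ν j x from
        Finset.sum_congr rfl fun _ _ => by ring]
    ring
  have h2 : doubleTractionOf ν Q x = ∑ j, A j x * ν j x := by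
    simp only [doubleTractionOf, hA, Finset.sum_mul]
    exact Finset.sum_congr rfl fun _ _ => Finset.sum_congr rfl fun _ _ => by ring
  have h3 : ∑ j, (P j x * v x + ∑ k, Q k j x * pd k v x) * ν j x
      = (∑ j, P j x * ν j x) * v x + ∑ j, A j x * pd j v x := by
    simp only [add_mul, Finset.sum_add_distrib, Finset.sum_mul, hA]
    rw [Finset.sum_comm (f := fun j k => Q k j x * pd k v x * ν j x)]
    congr 1
    · exact Finset.sum_congr rfl fun _ _ => by ring
    · exact Finset.sum_congr rfl fun _ _ => Finset.sum_congr rfl fun _ _ => by ring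
  have h4 : tractionOf ν P Q x = ∑ j, P j x * ν j x
      + (∑ l, surfaceGrad ν l (ν l) x) * (∑ j, A j x * ν j x) - ∑ j, surfaceGrad ν j (A j) x := by
    simp only [tractionOf, hA, add_mul, Finset.sum_add_distrib, Finset.mul_sum]
    congr 2
    exact Finset.sum_congr rfl fun _ _ => by
      simp only [Finset.sum_mul, Finset.mul_sum]
      exact Finset.sum_congr rfl fun _ _ => Finset.sum_congr rfl fun _ _ => by ring
  have h5 : ∑ j, A j x * v x * ν j x = (∑ j, A j x * ν j x) * v x := by
    rw [Finset.sum_mul]; exact Finset.sum_congr rfl fun _ _ => by ring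
  have h6 : ∑ j, A j x * normalDeriv ν v x * ν j x = (∑ j, A j x * ν j x) * normalDeriv ν v x := by
    rw [Finset.sum_mul]; exact Finset.sum_congr rfl fun _ _ => by ring
  change _ = _ + (∑ j, surfaceGrad ν j (fun y => A j y * v y) x
          - (∑ l, surfaceGrad ν l (ν l) x) * ∑ j, A j x * v x * ν j x)
  rw [h3, h2, h4, h5]
  simp only [h1, Finset.sum_add_distrib, Finset.sum_sub_distrib, h6, ← Finset.sum_mul]
  ring

lemma continuousOn_pd {U : Set (Vec d)} (hU : IsOpen U) {f : Vec d → ℝ}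
    (hf : ContDiffOn ℝ 1 f U) (j : Fin d) : ContinuousOn (pd j f) U :=
  (contDiffOn_pd (n := 1) (m := 0) hU le_rfl hf j).continuousOn

lemma continuousOn_surfaceGrad {U : Set (Vec d)} (hU : IsOpen U) {ν : Fin d → Vec d → ℝ}
    (hν : ∀ j, ContDiffOn ℝ 1 (ν j) U) {f : Vec d → ℝ} (hf : ContDiffOn ℝ 1 f U) (j : Fin d) :
    ContinuousOn (surfaceGrad ν j f) U :=
  continuousOn_finsetSum _ fun k _ => (continuousOn_pd hU hf k).mul
    (continuousOn_const.sub ((hν k).continuousOn.mul (hν j).continuousOn))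

lemma continuousOn_tractionOf {U : Set (Vec d)} (hU : IsOpen U) {ν P : Fin d → Vec d → ℝ}
    {Q : Fin d → Fin d → Vec d → ℝ} (hν : ∀ j, ContDiffOn ℝ 1 (ν j) U)
    (hP : ∀ j, ContinuousOn (P j) U) (hQ : ∀ j k, ContDiffOn ℝ 1 (Q j k) U) :
    ContinuousOn (tractionOf ν P Q) U := by
  have hA : ∀ j, ContDiffOn ℝ 1 (fun y => ∑ k, Q j k y * ν k y) U := fun j =>
    ContDiffOn.sum fun k _ => (hQ j k).mul (hν k)
  refine (continuousOn_finsetSum _ fun j _ => ((hP j).add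
    ((continuousOn_finsetSum _ fun l _ => continuousOn_surfaceGrad hU hν (hν l) l).mul
      (hA j).continuousOn)).mul (hν j).continuousOn).sub ?_
  exact continuousOn_finsetSum _ fun j _ => continuousOn_surfaceGrad hU hν (hA j) j

lemma continuousOn_doubleTractionOf {U : Set (Vec d)} {ν : Fin d → Vec d → ℝ}
    {Q : Fin d → Fin d → Vec d → ℝ} (hν : ∀ j, ContDiffOn ℝ 1 (ν j) U)
    (hQ : ∀ j k, ContDiffOn ℝ 1 (Q j k) U) : ContinuousOn (doubleTractionOf ν Q) U :=
  continuousOn_finsetSum _ fun j _ => continuousOn_finsetSum _ fun k _ =>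
    ((hQ j k).continuousOn.mul (hν j).continuousOn).mul (hν k).continuousOn

lemma continuousOn_normalDeriv {U : Set (Vec d)} (hU : IsOpen U) {ν : Fin d → Vec d → ℝ}
    (hν : ∀ j, ContDiffOn ℝ 1 (ν j) U) {v : Vec d → ℝ} (hv : ContDiffOn ℝ 1 v U) :
    ContinuousOn (normalDeriv ν v) U :=
  continuousOn_finsetSum _ fun k _ => (continuousOn_pd hU hv k).mul (hν k).continuousOn

namespace IsC2Chart

section Face

variable {e : OpenPartialHomeomorph (Vec (n + 1)) (Vec (n + 1))} (he : IsC2Chart e)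

include he

lemma continuousOn_faceMap (hcube : Icc 0 1 ⊆ e.target) (a : Fin (n + 1)) (b : Bool) :
    ContinuousOn (faceMap e a b) (Icc 0 1) :=
  (he.symm_contDiffOn.continuousOn.mono hcube).comp (contDiff_ins a _).continuous.continuousOn
    fun _ hz => ins_mem_Icc a (sideVal_mem b) hz

lemma continuousOn_areaDensity_faceMap (hcube : Icc 0 1 ⊆ e.target) (a : Fin (n + 1)) (b : Bool) :
    ContinuousOn (areaDensity (faceMap e a b)) (Icc 0 1) := by
  have hm : ∀ z ∈ Icc (0 : Vec n) 1, ins a (sideVal b) z ∈ e.target := fun z hz =>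
    hcube (ins_mem_Icc a (sideVal_mem b) hz)
  refine ContinuousOn.congr ?_ fun z hz => he.areaDensity_faceMap (hm z hz)
  refine ContinuousOn.mul (ContinuousOn.abs ?_) ?_
  · exact he.contDiffOn_det_tanMat.continuousOn.comp
      (contDiff_ins a _).continuous.continuousOn hm
  · exact (he.contDiffOn_sqrt_gradMat a).continuousOn.comp (he.continuousOn_faceMap hcube a b)
      fun z hz => e.map_target (hm z hz)

lemma integrableOn_faceMap (hcube : Icc 0 1 ⊆ e.target) {U : Set (Vec (n + 1))}
    (hcell : e.symm '' Icc 0 1 ⊆ U) {f : Vec (n + 1) → ℝ} (hf : ContinuousOn f (U ∩ e.source))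
    (a : Fin (n + 1)) (b : Bool) :
    IntegrableOn (fun z => f (faceMap e a b z) * areaDensity (faceMap e a b) z) (openCube n) := by
  have hm : ∀ z ∈ Icc (0 : Vec n) 1, ins a (sideVal b) z ∈ Icc (0 : Vec (n + 1)) 1 := fun z hz =>
    ins_mem_Icc a (sideVal_mem b) hz
  have hc : ContinuousOn (fun z => f (faceMap e a b z) * areaDensity (faceMap e a b) z)
      (Icc 0 1) :=
    (hf.comp (he.continuousOn_faceMap hcube a b) fun z hz =>
      ⟨hcell (mem_image_of_mem _ (hm z hz)), e.map_target (hcube (hm z hz))⟩).mul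
      (he.continuousOn_areaDensity_faceMap hcube a b)
  exact (hc.integrableOn_compact isCompact_Icc).mono_set (openCube_subset_Icc n)

end Face

section Edge

variable {e : OpenPartialHomeomorph (Vec (n + 2)) (Vec (n + 2))} (he : IsC2Chart e)

include he

lemma contDiffOn_surfaceCoordGrad (a : Fin (n + 2)) (b : Bool) (a' j : Fin (n + 2)) :
    ContDiffOn ℝ 1 (surfaceCoordGrad e a b a' j) e.source := by
  have : surfaceCoordGrad e a b a' j = fun x => gradMat e x a' j
      - (∑ k, gradMat e x a' k * unitNormal e a b k x) * unitNormal e a b j x :=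
    funext fun x => surfaceCoordGrad_eq _ _ _ _ _ _
  rw [this]
  exact (he.contDiffOn_gradMat a' j).sub ((ContDiffOn.sum fun k _ =>
    (he.contDiffOn_gradMat a' k).mul (he.contDiffOn_unitNormal a b k)).mul
      (he.contDiffOn_unitNormal a b j))

lemma contDiffOn_unitConormal {a a' : Fin (n + 2)} (ha : a' ≠ a) (b b' : Bool) (j : Fin (n + 2)) :
    ContDiffOn ℝ 1 (unitConormal e a b a' b' j) e.source :=
  (contDiffOn_const.mul (he.contDiffOn_surfaceCoordGrad a b a' j)).div
    (ContDiffOn.sqrt (ContDiffOn.sum fun l _ => (he.contDiffOn_surfaceCoordGrad a b a' l).pow 2)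
      fun _ hx => (he.sum_surfaceCoordGrad_sq_pos hx b ha).ne')
    fun _ hx => (Real.sqrt_pos.2 (he.sum_surfaceCoordGrad_sq_pos hx b ha)).ne'

lemma integrableOn_edgeMap (hcube : Icc 0 1 ⊆ e.target) {U : Set (Vec (n + 2))}
    (hcell : e.symm '' Icc 0 1 ⊆ U) {f : Vec (n + 2) → ℝ} (hf : ContinuousOn f (U ∩ e.source))
    (a : Fin (n + 2)) (b : Bool) (a₁ : Fin (n + 1)) (b₁ : Bool) :
    IntegrableOn (fun w => f (edgeMap e a b a₁ b₁ w) * areaDensity (edgeMap e a b a₁ b₁) w)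
      (openCube n) := by
  have hm₁ : ∀ w ∈ Icc (0 : Vec n) 1, ins a₁ (sideVal b₁) w ∈ Icc (0 : Vec (n + 1)) 1 :=
    fun z hz => ins_mem_Icc a₁ (sideVal_mem b₁) hz
  have hm : ∀ w ∈ Icc (0 : Vec n) 1,
      ins a (sideVal b) (ins a₁ (sideVal b₁) w) ∈ Icc (0 : Vec (n + 2)) 1 := fun z hz =>
    ins_mem_Icc a (sideVal_mem b) (hm₁ z hz)
  have hE : ContinuousOn (edgeMap e a b a₁ b₁) (Icc 0 1) :=
    (he.continuousOn_faceMap hcube a b).comp (contDiff_ins a₁ _).continuous.continuousOn hm₁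
  have hd : ContinuousOn (areaDensity (edgeMap e a b a₁ b₁)) (Icc 0 1) := by
    refine ContinuousOn.congr ?_ fun z hz => he.areaDensity_edgeMap (hcube (hm z hz))
    refine ContinuousOn.mul ((he.continuousOn_areaDensity_faceMap hcube a b).comp
      (contDiff_ins a₁ _).continuous.continuousOn hm₁) (ContinuousOn.sqrt ?_)
    exact continuousOn_finsetSum _ fun l _ =>
      (((he.contDiffOn_surfaceCoordGrad a b (a.succAbove a₁) l).continuousOn.comp hE
        fun z hz => e.map_target (hcube (hm z hz))).pow 2)
  have hc : ContinuousOn (fun w => f (edgeMap e a b a₁ b₁ w) *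
      areaDensity (edgeMap e a b a₁ b₁) w) (Icc 0 1) :=
    (hf.comp hE fun z hz =>
      ⟨hcell (mem_image_of_mem _ (hm z hz)), e.map_target (hcube (hm z hz))⟩).mul hd
  exact (hc.integrableOn_compact isCompact_Icc).mono_set (openCube_subset_Icc n)

/-- Green's formula of a second gradient field in a curvilinear cell. -/
lemma integral_secondGradient (hcube : Icc 0 1 ⊆ e.target) {U : Set (Vec (n + 2))}
    (hU : IsOpen U) (hcell : e.symm '' Icc 0 1 ⊆ U) {S : Fin (n + 2) → Vec (n + 2) → ℝ}
    {Q : Fin (n + 2) → Fin (n + 2) → Vec (n + 2) → ℝ} {v : Vec (n + 2) → ℝ}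
    (hS : ∀ j, ContDiffOn ℝ 1 (S j) U) (hQ : ∀ j k, ContDiffOn ℝ 2 (Q j k) U)
    (hv : ContDiffOn ℝ 2 v U)
    (hdiv : ∀ x ∈ e.symm '' openCube (n + 2),
      ∑ j, pd j (fun y => S j y - ∑ k, pd k (Q j k) y) x = 0) :
    ∫ x in e.symm '' openCube (n + 2),
        (∑ j, S j x * pd j v x + ∑ j, ∑ k, Q j k x * pd k (pd j v) x)
      = (∑ a, ∑ b, ∫ z in openCube (n + 1),
          (fun x => tractionOf (unitNormal e a b) (fun j y => S j y - ∑ k, pd k (Q j k) y) Q x * v x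
            + doubleTractionOf (unitNormal e a b) Q x * normalDeriv (unitNormal e a b) v x)
            (faceMap e a b z) * areaDensity (faceMap e a b) z)
        + ∑ a, ∑ b, ∑ a₁, ∑ b₁, ∫ w in openCube n,
          (fun x => (∑ j, ∑ k, Q j k x * unitConormal e a b (a.succAbove a₁) b₁ j x *
            unitNormal e a b k x) * v x) (edgeMap e a b a₁ b₁ w)
            * areaDensity (edgeMap e a b a₁ b₁) w := by
  set P : Fin (n + 2) → Vec (n + 2) → ℝ := fun j y => S j y - ∑ k, pd k (Q j k) y with hPdef
  have hQ1 : ∀ j k, ContDiffOn ℝ 1 (Q j k) U := fun j k => (hQ j k).of_le (by norm_num)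
  have hv1 : ContDiffOn ℝ 1 v U := hv.of_le (by norm_num)
  have hpv : ∀ j, ContDiffOn ℝ 1 (pd j v) U := fun j =>
    contDiffOn_pd (n := 2) (m := 1) hU le_rfl hv j
  have hpQ : ∀ j k l, ContDiffOn ℝ 1 (pd l (Q j k)) U := fun j k l =>
    contDiffOn_pd (n := 2) (m := 1) hU le_rfl (hQ j k) l
  have hP : ∀ j, ContDiffOn ℝ 1 (P j) U := fun j =>
    (hS j).sub (ContDiffOn.sum fun k _ => hpQ j k k)
  -- The flux of the virtual work. Its divergence is the integrand, because `div P = 0` and `P + div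
  -- Q = S`.
  let V : Fin (n + 2) → Vec (n + 2) → ℝ := fun j y => P j y * v y + ∑ k, Q k j y * pd k v y
  have hV : ∀ j, ContDiffOn ℝ 1 (V j) U := fun j =>
    ((hP j).mul hv1).add (ContDiffOn.sum fun k _ => (hQ1 k j).mul (hpv k))
  have hdf : ∀ {f : Vec (n + 2) → ℝ}, ContDiffOn ℝ 1 f U → ∀ x ∈ U, DifferentiableAt ℝ f x :=
    fun hf x hx => (hf.differentiableOn one_ne_zero).differentiableAt (hU.mem_nhds hx)
  have h1 : ∀ x ∈ e.symm '' openCube (n + 2),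
      ∑ j, S j x * pd j v x + ∑ j, ∑ k, Q j k x * pd k (pd j v) x = ∑ j, pd j (V j) x := by
    intro x hx
    have hxU : x ∈ U := hcell (image_mono (openCube_subset_Icc _) hx)
    have h2 : ∀ j, pd j (V j) x = pd j (P j) x * v x + P j x * pd j v x
        + ∑ k, (pd j (Q k j) x * pd k v x + Q k j x * pd j (pd k v) x) := by
      intro j
      have := fun k => hdf (hQ1 k j) x hxU
      have := fun k => hdf (hpv k) x hxU
      rw [pd_add ((hdf (hP j) x hxU).fun_mul (hdf hv1 x hxU))
        (DifferentiableAt.fun_sum fun k _ => (hdf (hQ1 k j) x hxU).fun_mul (hdf (hpv k) x hxU)),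
        pd_mul (hdf (hP j) x hxU) (hdf hv1 x hxU),
        pd_sum fun k _ => (hdf (hQ1 k j) x hxU).fun_mul (hdf (hpv k) x hxU)]
      congr 1
      exact Finset.sum_congr rfl fun k _ => pd_mul (hdf (hQ1 k j) x hxU) (hdf (hpv k) x hxU) j
    simp only [h2, Finset.sum_add_distrib]
    rw [← Finset.sum_mul, hdiv x hx, zero_mul, zero_add,
      Finset.sum_comm (f := fun j k => pd j (Q k j) x * pd k v x),
      Finset.sum_comm (f := fun j k => Q k j x * pd j (pd k v) x), ← add_assoc]
    congr 1
    simp only [hPdef, sub_mul, Finset.sum_sub_distrib, Finset.sum_mul, sub_add_cancel]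
  have hmeas : MeasurableSet (e.symm '' openCube (n + 2)) :=
    (e.symm.isOpen_image_of_subset_source (isOpen_openCube _)
      ((openCube_subset_Icc _).trans hcube)).measurableSet
  rw [setIntegral_congr_fun hmeas h1, he.integral_divergence hcube hU hcell hV,
    ← Finset.sum_add_distrib]
  refine Finset.sum_congr rfl fun a _ => ?_
  rw [← Finset.sum_add_distrib]
  refine Finset.sum_congr rfl fun b _ => ?_
  set ν := unitNormal e a b with hν
  have hO : IsOpen (U ∩ e.source) := hU.inter e.open_source
  have hνc : ∀ j, ContDiffOn ℝ 1 (ν j) (U ∩ e.source) := fun j =>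
    (he.contDiffOn_unitNormal a b j).mono inter_subset_right
  have hcell' : e.symm '' Icc 0 1 ⊆ U ∩ e.source := fun x hx => ⟨hcell hx, by
    obtain ⟨y, hy, rfl⟩ := hx
    exact e.map_target (hcube hy)⟩
  set X : Vec (n + 2) → ℝ := fun x => tractionOf ν P Q x * v x
    + doubleTractionOf ν Q x * normalDeriv ν v x with hX
  set B : Fin (n + 2) → Vec (n + 2) → ℝ := fun j y => (∑ k, Q j k y * ν k y) * v y with hB
  have hBc : ∀ j, ContDiffOn ℝ 1 (B j) (U ∩ e.source) := fun j =>
    (ContDiffOn.sum fun k _ => ((hQ1 j k).mono inter_subset_left).mul (hνc k)).mul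
      (hv1.mono inter_subset_left)
  have hXc : ContinuousOn X (U ∩ e.source) :=
    ((continuousOn_tractionOf hO hνc (fun j => (hP j).continuousOn.mono inter_subset_left)
      fun j k => (hQ1 j k).mono inter_subset_left).mul (hv.continuousOn.mono inter_subset_left)).add
      ((continuousOn_doubleTractionOf hνc fun j k => (hQ1 j k).mono inter_subset_left).mul
        (continuousOn_normalDeriv hO hνc (hv1.mono inter_subset_left)))
  have hVc : ContinuousOn (fun x => ∑ j, V j x * ν j x) (U ∩ e.source) :=
    continuousOn_finsetSum _ fun j _ => ((hV j).continuousOn.mono inter_subset_left).mul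
      (hνc j).continuousOn
  set Y : Vec (n + 2) → ℝ := fun x => ∑ j, surfaceGrad ν j (B j) x
    - (∑ l, surfaceGrad ν l (ν l) x) * ∑ j, B j x * ν j x with hY
  have hVXY : ∀ x ∈ U ∩ e.source, ∑ j, V j x * ν j x = X x + Y x := fun x hx =>
    sum_mul_normal_eq_traction (fun j => he.differentiableAt_unitNormal hx.2 a b j)
      (fun j k => hdf (hQ1 j k) x hx.1) (hdf hv1 x hx.1)
  have hmem : ∀ z ∈ openCube (n + 1), faceMap e a b z ∈ U ∩ e.source := fun z hz =>
    hcell' (mem_image_of_mem _ (ins_mem_Icc a (sideVal_mem b) (openCube_subset_Icc _ hz)))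
  have iX := he.integrableOn_faceMap hcube hcell hXc a b
  -- `Y` is the difference of the normal flux and `X`, both already known to be integrable on the
  -- side.
  have iY : IntegrableOn (fun z => Y (faceMap e a b z) * areaDensity (faceMap e a b) z)
      (openCube (n + 1)) := by
    refine ((he.integrableOn_faceMap hcube hcell hVc a b).sub iX).congr_fun (fun z hz => ?_)
      (isOpen_openCube _).measurableSet
    simp only [Pi.sub_apply, hVXY _ (hmem z hz)]
    ring
  have hsurf := he.integral_surface_divergence hcube hO hcell' hBc a b
  have hedge : ∑ a₁, ∑ b₁, ∫ w in openCube n,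
          (fun x => (∑ j, ∑ k, Q j k x * unitConormal e a b (a.succAbove a₁) b₁ j x *
            ν k x) * v x) (edgeMap e a b a₁ b₁ w) * areaDensity (edgeMap e a b a₁ b₁) w
      = ∫ z in openCube (n + 1), Y (faceMap e a b z) * areaDensity (faceMap e a b) z := by
    refine Eq.trans ?_ hsurf.symm
    refine Finset.sum_congr rfl fun a₁ _ => Finset.sum_congr rfl fun b₁ _ => ?_
    refine setIntegral_congr_fun (isOpen_openCube _).measurableSet fun w _ => ?_
    simp only [hB, Finset.sum_mul]
    exact Finset.sum_congr rfl fun _ _ => Finset.sum_congr rfl fun _ _ => by ring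
  rw [hedge, ← integral_add iX iY]
  refine setIntegral_congr_fun (isOpen_openCube _).measurableSet fun z hz => ?_
  simp only [hVXY _ (hmem z hz)]
  ring

end Edge

end IsC2Chart

end Flexo
end

noncomputable section
namespace Flexo

variable {d n : ℕ}

/-! ### Curves in curvilinear coordinates -/

lemma hasDerivAt_line {f : Vec d → ℝ} {x : Vec d} (hf : DifferentiableAt ℝ f x) (v : Vec d) :
    HasDerivAt (fun t : ℝ => f (x + t • v)) (∑ j, v j * pd j f x) 0 := by
  rw [← fderiv_apply_eq_sum_pd]
  exact hf.hasFDerivAt.hasLineDerivAt v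

lemma eventually_pos_of_hasDerivAt {f : ℝ → ℝ} {f' : ℝ} (hf : HasDerivAt f f' 0) (h0 : f 0 = 0)
    (hf' : 0 < f') : ∀ᶠ t in 𝓝[>] 0, 0 < f t := by
  have h := (hasDerivAt_iff_tendsto_slope.1 hf).mono_left
    (nhdsWithin_mono (0 : ℝ) (t := {0}ᶜ) (s := Ioi 0) fun t (ht : 0 < t) => ht.ne')
  filter_upwards [h.eventually (lt_mem_nhds hf'), self_mem_nhdsWithin] with t ht (ht0 : 0 < t)
  rw [slope_def_field, h0, sub_zero, sub_zero] at ht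
  exact (div_pos_iff_of_pos_right ht0).1 ht

lemma nonneg_of_hasDerivAt {f : ℝ → ℝ} {f' : ℝ} (hf : HasDerivAt f f' 0) (h0 : f 0 = 0)
    (h : ∀ᶠ t in 𝓝[>] 0, 0 ≤ f t) : 0 ≤ f' := by
  by_contra! hneg
  have h1 := eventually_pos_of_hasDerivAt (f := fun t => -f t) hf.neg (by simp [h0])
    (neg_pos.2 hneg)
  obtain ⟨t, ht1, ht2⟩ := (h.and h1).exists
  linarith

lemma tendsto_line (x v : Vec d) : Tendsto (fun t : ℝ => x + t • v) (𝓝[>] 0) (𝓝 x) := by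
  have : Continuous fun t : ℝ => x + t • v := by fun_prop
  simpa using (this.tendsto 0).mono_left nhdsWithin_le_nhds

/-- Lines in the coordinates of a chart. -/
def coordLine (e : OpenPartialHomeomorph (Vec d) (Vec d)) (x : Vec d) (β : Fin d) (c t : ℝ) :
    Vec d := e.symm (e x + t • Pi.single β c)

lemma coordLine_zero {e : OpenPartialHomeomorph (Vec d) (Vec d)} {x : Vec d} (hx : x ∈ e.source)
    (β : Fin d) (c : ℝ) : coordLine e x β c 0 = x := by
  simp [coordLine, e.left_inv hx]

lemma tendsto_coordLine {e : OpenPartialHomeomorph (Vec d) (Vec d)} {x : Vec d} (hx : x ∈ e.source)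
    (β : Fin d) (c : ℝ) : Tendsto (coordLine e x β c) (𝓝 0) (𝓝 x) := by
  have h1 : Tendsto (fun t : ℝ => e x + t • Pi.single β c) (𝓝 0) (𝓝 (e x)) := by
    have : Continuous fun t : ℝ => e x + t • (Pi.single β c : Vec d) := by fun_prop
    simpa using this.tendsto 0
  have h2 := (e.continuousAt_symm (e.map_source hx)).tendsto.comp h1
  rwa [e.left_inv hx] at h2

lemma eventually_coordLine {e : OpenPartialHomeomorph (Vec d) (Vec d)} {x : Vec d}
    (hx : x ∈ e.source) (β : Fin d) (c : ℝ) : ∀ᶠ t in 𝓝 (0 : ℝ), coordLine e x β c t ∈ e.source ∧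
      e (coordLine e x β c t) = e x + t • Pi.single β c := by
  have h1 : Tendsto (fun t : ℝ => e x + t • Pi.single β c) (𝓝 0) (𝓝 (e x)) := by
    have : Continuous fun t : ℝ => e x + t • (Pi.single β c : Vec d) := by fun_prop
    simpa using this.tendsto 0
  filter_upwards [h1.eventually (e.open_target.mem_nhds (e.map_source hx))] with t ht
  exact ⟨e.map_target ht, e.right_inv ht⟩

namespace IsC2Chart

variable {e : OpenPartialHomeomorph (Vec d) (Vec d)} (he : IsC2Chart e)

include he

lemma hasDerivAt_coordLine {f : Vec d → ℝ} {x : Vec d} (hx : x ∈ e.source)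
    (hf : DifferentiableAt ℝ f x) (β : Fin d) (c : ℝ) :
    HasDerivAt (fun t => f (coordLine e x β c t))
      (c * ∑ j, tanMat e.symm (e x) β j * pd j f x) 0 := by
  have hf' : DifferentiableAt ℝ f (e.symm (e x)) := by rwa [e.left_inv hx]
  have hs := he.symm_differentiableAt (e.map_source hx)
  have h := hasDerivAt_line (f := fun y => f (e.symm y)) (x := e x)
    (hf'.comp (e x) hs) (Pi.single β c)
  refine h.congr_deriv ?_
  rw [Finset.sum_eq_single β (fun j _ hj => by rw [Pi.single_eq_of_ne hj, zero_mul]) (by simp),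
    Pi.single_eq_same, pd_comp hf' hs, e.left_inv hx]
  congr 1
  exact Finset.sum_congr rfl fun _ _ => mul_comm _ _

lemma pd_eq_sum_gradMat {f : Vec d → ℝ} {x : Vec d} (hx : x ∈ e.source) (j : Fin d) :
    pd j f x = ∑ a, (∑ l, tanMat e.symm (e x) a l * pd l f x) * gradMat e x a j := by
  simp only [Finset.sum_mul]
  rw [Finset.sum_comm]
  have : ∀ l, ∑ a, tanMat e.symm (e x) a l * pd l f x * gradMat e x a j
      = pd l f x * ∑ a, gradMat e x a j * tanMat e.symm (e x) a l := by
    intro l; rw [Finset.mul_sum]; exact Finset.sum_congr rfl fun _ _ => by ring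
  simp only [this, he.sum_gradMat_mul_tanMat' hx]
  simp

/-- A function that is constant on an open face has no derivatives along the face. -/
lemma sum_tanMat_mul_pd_eq_zero {f : Vec d → ℝ} {s : Fin d → Option Bool} {x : Vec d}
    (hx : x ∈ openFaceOf e s) (hf : DifferentiableAt ℝ f x)
    (hconst : ∀ y ∈ openFaceOf e s, f y = f x) {β : Fin d} (hβ : s β = none) :
    ∑ j, tanMat e.symm (e x) β j * pd j f x = 0 := by
  have h := he.hasDerivAt_coordLine hx.1 hf β 1
  have hev : (fun t => f (coordLine e x β 1 t)) =ᶠ[𝓝 0] fun _ => f x := by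
    have h1 : ∀ᶠ t in 𝓝 (0 : ℝ), e x β + t ∈ Ioo (0 : ℝ) 1 := by
      have : Tendsto (fun t : ℝ => e x β + t) (𝓝 0) (𝓝 (e x β)) := by
        have : Continuous fun t : ℝ => e x β + t := by fun_prop
        simpa using this.tendsto 0
      exact this.eventually (isOpen_Ioo.mem_nhds (hx.2.1 β hβ))
    filter_upwards [eventually_coordLine hx.1 β 1, h1] with t ht ht1
    refine hconst _ ⟨ht.1, fun i hi => ?_, fun i b hi => ?_⟩
    · rw [ht.2]
      by_cases h : i = β
      · subst h; simpa using ht1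
      · simpa [Pi.single_eq_of_ne h] using hx.2.1 i hi
    · have h : i ≠ β := by rintro rfl; simp [hβ] at hi
      rw [ht.2]
      simpa [Pi.single_eq_of_ne h] using hx.2.2 i b hi
  have h2 := (hasDerivAt_const (0 : ℝ) (f x)).congr_of_eventuallyEq hev
  have := h.unique h2
  rwa [one_mul] at this

end IsC2Chart

/-! ### Faces of cells -/

/-- The specification of a side. -/
def sideSpec (a : Fin d) (b : Bool) : Fin d → Option Bool := fun i => if i = a then some b else none

/-- The specification of an edge. -/
def edgeSpec (a : Fin d) (b : Bool) (a' : Fin d) (b' : Bool) : Fin d → Option Bool :=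
  fun i => if i = a then some b else if i = a' then some b' else none

section Faces

variable {e : OpenPartialHomeomorph (Vec d) (Vec d)}

lemma mem_sideSpec {a : Fin d} {b : Bool} {x : Vec d} : x ∈ openFaceOf e (sideSpec a b) ↔
    x ∈ e.source ∧ e x a = sideVal b ∧ ∀ i, i ≠ a → e x i ∈ Ioo (0 : ℝ) 1 := by
  refine and_congr_right fun _ => ⟨fun h => ⟨h.2 a b (by simp [sideSpec]), fun i hi =>
    h.1 i (by simp [sideSpec, hi])⟩, fun h => ⟨fun i hi => h.2 i fun h => ?_, fun i b' hi => ?_⟩⟩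
  · simp [sideSpec, h] at hi
  · by_cases h' : i = a
    · subst h'
      simp only [sideSpec, if_true, Option.some.injEq] at hi
      rw [← hi]; exact h.1
    · simp [sideSpec, h'] at hi

lemma openFaceOf_none (ht : Icc 0 1 ⊆ e.target) :
    openFaceOf e (fun _ => none) = e.symm '' openCube d := by
  ext x
  constructor
  · intro hx
    exact ⟨e x, mem_openCube.2 fun i => hx.2.1 i rfl, e.left_inv hx.1⟩
  · rintro ⟨y, hy, rfl⟩
    have hy' := ht (openCube_subset_Icc _ hy)
    refine ⟨e.map_target hy', fun i _ => ?_, fun i b h => by simp at h⟩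
    rw [e.right_inv hy']
    exact mem_openCube.1 hy i

lemma cellOf_eq (ht : Icc 0 1 ⊆ e.target) : cellOf e = e.symm '' Icc 0 1 := by
  ext x
  constructor
  · intro hx
    exact ⟨e x, hx.2, e.left_inv hx.1⟩
  · rintro ⟨y, hy, rfl⟩
    refine ⟨e.map_target (ht hy), ?_⟩
    rwa [e.right_inv (ht hy)]

lemma isCompact_cellOf (ht : Icc 0 1 ⊆ e.target) : IsCompact (cellOf e) := by
  rw [cellOf_eq ht]
  exact isCompact_Icc.image_of_continuousOn (e.continuousOn_symm.mono ht)

lemma openFaceOf_subset_cellOf (s : Fin d → Option Bool) : openFaceOf e s ⊆ cellOf e := by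
  intro x hx
  have h : ∀ i, e x i ∈ Icc (0 : ℝ) 1 := by
    intro i
    rcases hs : s i with _ | b
    · exact Ioo_subset_Icc_self (hx.2.1 i hs)
    · rw [hx.2.2 i b hs]; exact sideVal_mem b
  exact ⟨hx.1, fun i => (h i).1, fun i => (h i).2⟩

lemma exists_openFaceOf {x : Vec d} (hx : x ∈ cellOf e) : ∃ s, x ∈ openFaceOf e s := by
  refine ⟨fun i => if e x i = 0 then some false else if e x i = 1 then some true else none,
    hx.1, fun i hi => ?_, fun i b hi => ?_⟩
  · by_cases h0 : e x i = 0
    · simp [h0] at hi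
    by_cases h1 : e x i = 1
    · simp [h1] at hi
    exact ⟨lt_of_le_of_ne (hx.2.1 i) (Ne.symm h0), lt_of_le_of_ne (hx.2.2 i) h1⟩
  · by_cases h0 : e x i = 0
    · simp only [h0, if_true, Option.some.injEq] at hi
      rw [h0, ← hi]; rfl
    by_cases h1 : e x i = 1
    · simp only [h1, one_ne_zero, if_true, if_false, Option.some.injEq] at hi
      rw [h1, ← hi]; rfl
    · simp [h0, h1] at hi

lemma openFaceOf_spec_unique {x : Vec d} {s s' : Fin d → Option Bool} (h : x ∈ openFaceOf e s)
    (h' : x ∈ openFaceOf e s') : s = s' := by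
  funext i
  have key : ∀ {s s' : Fin d → Option Bool}, x ∈ openFaceOf e s → x ∈ openFaceOf e s' →
      ∀ b, s i = some b → s' i = some b := by
    intro s s' h h' b hb
    have h1 := h.2.2 i b hb
    rcases hs : s' i with _ | b'
    · have h2 := h'.2.1 i hs
      rw [h1] at h2
      cases b <;> simp [sideVal] at h2
    · have h2 := h'.2.2 i b' hs
      rw [h1] at h2
      cases b <;> cases b' <;> simp [sideVal] at h2 ⊢
  rcases hs : s i with _ | b
  · rcases hs' : s' i with _ | b
    · rfl
    · rw [key h' h b hs'] at hs; simp at hs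
  · rw [key h h' b hs]

lemma openFaceOf_nonempty (ht : Icc 0 1 ⊆ e.target) (s : Fin d → Option Bool) :
    (openFaceOf e s).Nonempty := by
  let y : Vec d := fun i => (s i).elim (1 / 2) sideVal
  have hy : y ∈ Icc (0 : Vec d) 1 := by
    have : ∀ i, y i ∈ Icc (0 : ℝ) 1 := by
      intro i
      rcases hs : s i with _ | b
      · simp only [y, hs, Option.elim]; norm_num
      · simp only [y, hs, Option.elim]; exact sideVal_mem b
    exact ⟨fun i => (this i).1, fun i => (this i).2⟩
  refine ⟨e.symm y, e.map_target (ht hy), fun i hi => ?_, fun i b hi => ?_⟩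
  · rw [e.right_inv (ht hy)]
    simp only [y, hi, Option.elim]; norm_num
  · rw [e.right_inv (ht hy)]
    simp only [y, hi, Option.elim]

lemma openFaceOf_sideSpec_eq {e : OpenPartialHomeomorph (Vec (n + 1)) (Vec (n + 1))}
    (ht : Icc 0 1 ⊆ e.target) (a : Fin (n + 1)) (b : Bool) :
    openFaceOf e (sideSpec a b) = faceMap e a b '' openCube n := by
  ext x
  rw [mem_sideSpec]
  constructor
  · rintro ⟨hx, ha, hi⟩
    refine ⟨fun i => e x (a.succAbove i), mem_openCube.2 fun i => hi _ (Fin.succAbove_ne a i), ?_⟩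
    have : ins a (sideVal b) (fun i => e x (a.succAbove i)) = e x := by
      funext i
      rcases Fin.eq_self_or_eq_succAbove a i with rfl | ⟨j, rfl⟩
      · simp [ha]
      · simp
    rw [faceMap, this, e.left_inv hx]
  · rintro ⟨z, hz, rfl⟩
    have hy := ht (ins_mem_Icc a (sideVal_mem b) (openCube_subset_Icc _ hz))
    refine ⟨e.map_target hy, ?_, fun i hi => ?_⟩
    · rw [faceMap, e.right_inv hy, ins_same]
    · obtain ⟨j, rfl⟩ := Fin.exists_succAbove_eq hi
      rw [faceMap, e.right_inv hy, ins_succAbove]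
      exact mem_openCube.1 hz j

lemma mem_edgeSpec {a a' : Fin d} (ha : a' ≠ a) {b b' : Bool} {x : Vec d} :
    x ∈ openFaceOf e (edgeSpec a b a' b') ↔ x ∈ e.source ∧ e x a = sideVal b ∧ e x a' = sideVal b' ∧
      ∀ i, i ≠ a → i ≠ a' → e x i ∈ Ioo (0 : ℝ) 1 := by
  refine and_congr_right fun _ => ⟨fun h => ⟨h.2 a b (by simp [edgeSpec]),
    h.2 a' b' (by simp [edgeSpec, ha]), fun i hi hi' =>
    h.1 i (by simp [edgeSpec, hi, hi'])⟩, fun h => ⟨fun i hi => h.2.2 i ?_ ?_, fun i c hi => ?_⟩⟩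
  · rintro rfl; simp [edgeSpec] at hi
  · rintro rfl; simp [edgeSpec, ha] at hi
  · by_cases h1 : i = a
    · subst h1
      simp only [edgeSpec, if_true, Option.some.injEq] at hi
      rw [← hi]; exact h.1
    by_cases h2 : i = a'
    · subst h2
      simp only [edgeSpec, h1, if_true, if_false, Option.some.injEq] at hi
      rw [← hi]; exact h.2.1
    · simp [edgeSpec, h1, h2] at hi

lemma openFaceOf_edgeSpec_eq {e : OpenPartialHomeomorph (Vec (n + 2)) (Vec (n + 2))}
    (ht : Icc 0 1 ⊆ e.target) (a : Fin (n + 2)) (b : Bool) (a₁ : Fin (n + 1)) (b₁ : Bool) :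
    openFaceOf e (edgeSpec a b (a.succAbove a₁) b₁) = edgeMap e a b a₁ b₁ '' openCube n := by
  ext x
  rw [mem_edgeSpec (Fin.succAbove_ne a a₁)]
  constructor
  · rintro ⟨hx, ha, ha', hi⟩
    refine ⟨fun i => e x (a.succAbove (a₁.succAbove i)), mem_openCube.2 fun i =>
      hi _ (Fin.succAbove_ne a _) fun h => Fin.succAbove_ne a₁ i (Fin.succAbove_right_injective h), ?_⟩
    have : ins a (sideVal b) (ins a₁ (sideVal b₁) fun i => e x (a.succAbove (a₁.succAbove i)))
        = e x := by
      funext i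
      rcases Fin.eq_self_or_eq_succAbove a i with rfl | ⟨j, rfl⟩
      · simp [ha]
      · rcases Fin.eq_self_or_eq_succAbove a₁ j with rfl | ⟨l, rfl⟩
        · simp [ha']
        · simp
    rw [edgeMap, faceMap, this, e.left_inv hx]
  · rintro ⟨w, hw, rfl⟩
    have hy := ht (ins_mem_Icc a (sideVal_mem b)
      (ins_mem_Icc a₁ (sideVal_mem b₁) (openCube_subset_Icc _ hw)))
    refine ⟨e.map_target hy, ?_, ?_, fun i hi hi' => ?_⟩
    · rw [edgeMap, faceMap, e.right_inv hy, ins_same]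
    · rw [edgeMap, faceMap, e.right_inv hy, ins_succAbove, ins_same]
    · obtain ⟨j, rfl⟩ := Fin.exists_succAbove_eq hi
      obtain ⟨l, rfl⟩ := Fin.exists_succAbove_eq (fun h => hi' (congrArg a.succAbove h))
      rw [edgeMap, faceMap, e.right_inv hy, ins_succAbove, ins_succAbove]
      exact mem_openCube.1 hw l

end Faces

lemma ncard_none_add (s : Fin d → Option Bool) :
    {i | s i = none}.ncard + {i | s i ≠ none}.ncard = d := by
  have : {i | s i ≠ none} = {i | s i = none}ᶜ := rfl
  rw [this, Set.ncard_add_ncard_compl]; simp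

lemma eq_sideSpec_of_ncard {s : Fin d → Option Bool} {a : Fin d} {b : Bool}
    (h : {i | sideSpec a b i = none}.ncard = {i | s i = none}.ncard) :
    ∃ a' b', s = sideSpec a' b' := by
  have h1 := ncard_none_add s
  have h2 := ncard_none_add (sideSpec a b)
  have h3 : {i | sideSpec a b i ≠ none} = {a} := by
    ext i; by_cases h : i = a <;> simp [sideSpec, h]
  rw [h3, Set.ncard_singleton] at h2
  obtain ⟨a', ha'⟩ := Set.ncard_eq_one.1 (show {i | s i ≠ none}.ncard = 1 by omega)
  have h4 : s a' ≠ none := by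
    have : a' ∈ {i | s i ≠ none} := ha' ▸ rfl
    exact this
  obtain ⟨b', hb'⟩ := Option.ne_none_iff_exists'.1 h4
  refine ⟨a', b', funext fun i => ?_⟩
  by_cases hi : i = a'
  · subst hi; simp [sideSpec, hb']
  · have : i ∉ {i | s i ≠ none} := by rw [ha']; exact hi
    simp only [mem_ofPred_eq, not_not] at this
    simp [sideSpec, hi, this]

lemma eq_edgeSpec_of_ncard {s : Fin d → Option Bool} {a a' a₀ : Fin d} {b b' b₀ : Bool}
    (ha : a' ≠ a) (h : {i | edgeSpec a b a' b' i = none}.ncard = {i | s i = none}.ncard)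
    (h0 : s a₀ = some b₀) :
    ∃ a₁ b₁, a₁ ≠ a₀ ∧ s = edgeSpec a₀ b₀ a₁ b₁ := by
  have h1 := ncard_none_add s
  have h2 := ncard_none_add (edgeSpec a b a' b')
  have h3 : {i | edgeSpec a b a' b' i ≠ none} = {a, a'} := by
    ext i
    by_cases h : i = a
    · simp [edgeSpec, h]
    · by_cases h' : i = a' <;> simp [edgeSpec, h, h', ha]
  rw [h3, Set.ncard_pair ha.symm] at h2
  obtain ⟨p, q, hpq, hs⟩ := Set.ncard_eq_two.1 (show {i | s i ≠ none}.ncard = 2 by omega)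
  have h4 : a₀ ∈ ({p, q} : Set (Fin d)) := by rw [← hs]; simp [h0]
  obtain ⟨a₁, ha₁, hs₁⟩ : ∃ a₁, a₁ ≠ a₀ ∧ {i | s i ≠ none} = {a₀, a₁} := by
    rcases h4 with rfl | h4
    · exact ⟨q, hpq.symm, hs⟩
    · rw [mem_singleton_iff] at h4; subst h4
      exact ⟨p, hpq, by rw [hs, Set.pair_comm]⟩
  have h5 : s a₁ ≠ none := by
    have : a₁ ∈ {i | s i ≠ none} := by rw [hs₁]; simp
    exact this
  obtain ⟨b₁, hb₁⟩ := Option.ne_none_iff_exists'.1 h5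
  refine ⟨a₁, b₁, ha₁, funext fun i => ?_⟩
  by_cases hi : i = a₀
  · subst hi; simp [edgeSpec, h0]
  by_cases hi' : i = a₁
  · subst hi'; simp [edgeSpec, ha₁, hb₁]
  · have : i ∉ {i | s i ≠ none} := by rw [hs₁]; simp [hi, hi']
    simp only [mem_ofPred_eq, not_not] at this
    simp [edgeSpec, hi, hi', this]

/-! ### Lattice translations -/

section Lattice

variable {L : Vec d}

@[simp] lemma latticeShift_zero (x : Vec d) : latticeShift L 0 x = x := by
  funext i; simp [latticeShift]

@[simp] lemma latticeShift_latticeShift (k l : Fin d → ℤ) (x : Vec d) :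
    latticeShift L k (latticeShift L l x) = latticeShift L (k + l) x := by
  funext i; simp [latticeShift]; ring

lemma mem_latticeShift_image {k : Fin d → ℤ} {s : Set (Vec d)} {x : Vec d} :
    x ∈ latticeShift L k '' s ↔ latticeShift L (-k) x ∈ s := by
  constructor
  · rintro ⟨y, hy, rfl⟩; simpa using hy
  · intro h; exact ⟨_, h, by simp⟩

lemma latticeShift_eq_add (k : Fin d → ℤ) :
    latticeShift L k = fun x => x + fun i => (k i : ℝ) * L i := rfl

lemma continuous_latticeShift (k : Fin d → ℤ) : Continuous (latticeShift L k) := by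
  rw [latticeShift_eq_add]; fun_prop

lemma latticeShift_image_zero (s : Set (Vec d)) : latticeShift L 0 '' s = s := by
  ext x; rw [mem_latticeShift_image]; simp

lemma latticeShift_image_image (k l : Fin d → ℤ) (s : Set (Vec d)) :
    latticeShift L k '' (latticeShift L l '' s) = latticeShift L (k + l) '' s := by
  rw [image_image]; simp

lemma pd_latticeShift (f : Vec d → ℝ) (k : Fin d → ℤ) (x : Vec d) (j : Fin d) :
    pd j (fun y => f (latticeShift L k y)) x = pd j f (latticeShift L k x) := by
  simp only [pd, latticeShift_eq_add]
  rw [fderiv_comp_add_right]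

lemma eq_zero_of_latticeShift_image (hL : ∀ i, 0 < L i) {s : Set (Vec d)} (hs : s.Nonempty)
    (hbox : s ⊆ Icc 0 L) {k : Fin d → ℤ} (h : latticeShift L k '' s = s) : k = 0 := by
  obtain ⟨x, hx⟩ := hs
  have h1 : latticeShift L k x ∈ s := h ▸ mem_image_of_mem _ hx
  -- One translation does not suffice, since opposite points of the box differ by exactly one
  -- period. Two translations move some coordinate by at least two periods.
  have h2 : latticeShift L k (latticeShift L k x) ∈ s := by
    have := mem_image_of_mem (latticeShift L k) h1
    rwa [h] at this
  have h3 := hbox h2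
  have h0 := hbox hx
  funext i
  have a1 := h3.1 i
  have a2 := h3.2 i
  have a3 := h0.1 i
  have a4 := h0.2 i
  simp only [latticeShift, Pi.zero_apply] at a1 a2 a3 a4 ⊢
  have hLi := hL i
  by_contra hne
  rcases lt_or_gt_of_ne hne with hk | hk
  · have : (k i : ℝ) ≤ -1 := by exact_mod_cast (show k i ≤ -1 by omega)
    nlinarith
  · have : (1 : ℝ) ≤ k i := by exact_mod_cast (show 1 ≤ k i by omega)
    nlinarith

end Lattice

end Flexo
end

/-! ### Sides shared by two translated cells. -/

noncomputable section
namespace Flexo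

variable {d n : ℕ}

namespace IsC2Chart

variable {e : OpenPartialHomeomorph (Vec d) (Vec d)} (he : IsC2Chart e)

include he

/-- In the basis of coordinate gradients the coefficients of the gradient of `f` are its derivatives
along the coordinate lines. Those along the side vanish, and only the multiple of the normal
remains. -/
lemma exists_pd_eq_mul_unitNormal {f : Vec d → ℝ} {a : Fin d} (b : Bool) {x : Vec d}
    (hx : x ∈ openFaceOf e (sideSpec a b)) (hf : DifferentiableAt ℝ f x)
    (hconst : ∀ y ∈ openFaceOf e (sideSpec a b), f y = f x) :
    ∃ c : ℝ, ∀ j, pd j f x = c * unitNormal e a b j x := by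
  refine ⟨(∑ l, tanMat e.symm (e x) a l * pd l f x) *
    (sideSign b * √(∑ l, gradMat e x a l ^ 2)), fun j => ?_⟩
  rw [he.pd_eq_sum_gradMat hx.1 j, Finset.sum_eq_single a, mul_assoc, ← he.gradMat_eq hx.1]
  · intro c _ hc
    rw [he.sum_tanMat_mul_pd_eq_zero hx hf hconst (by simp [sideSpec, hc]), zero_mul]
  · simp

/-- Along an inward direction the coordinate `a` moves strictly inward to first order, and the other
coordinates stay in `(0,1)` by continuity. -/
lemma eventually_mem_openCell {a : Fin d} {b : Bool} {x : Vec d}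
    (hx : x ∈ openFaceOf e (sideSpec a b)) {v : Vec d}
    (hv : sideSign b * ∑ j, v j * gradMat e x a j < 0) :
    ∀ᶠ t in 𝓝[>] (0 : ℝ), x + t • v ∈ openFaceOf e (fun _ => none) := by
  rw [mem_sideSpec] at hx
  have hd := hasDerivAt_line (differentiableAt_pi.1 (he.differentiableAt hx.1) a) v
  have h1 : ∀ᶠ t in 𝓝[>] (0 : ℝ), 0 < -sideSign b * (e (x + t • v) a - sideVal b) := by
    refine eventually_pos_of_hasDerivAt ((hd.sub_const _).const_mul (-sideSign b)) ?_ ?_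
    · simp [hx.2.1]
    · have : -sideSign b * ∑ j, v j * gradMat e x a j > 0 := by linarith
      exact this
  have ht := tendsto_line x v
  have h2 := ht.eventually (e.open_source.mem_nhds hx.1)
  have hc : ContinuousAt e x := e.continuousAt hx.1
  have h3 : ∀ᶠ t in 𝓝[>] (0 : ℝ), ∀ i, i ≠ a → e (x + t • v) i ∈ Ioo (0 : ℝ) 1 := by
    rw [eventually_all]
    intro i
    by_cases hi : i = a
    · simp [hi]
    · have := ((continuous_apply i).continuousAt.comp hc).tendsto.comp ht
      filter_upwards [this.eventually (isOpen_Ioo.mem_nhds (hx.2.2 i hi))] with t h _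
      exact h
  have h4 : ∀ᶠ t in 𝓝[>] (0 : ℝ), e (x + t • v) a ∈ Ioo (-1 : ℝ) 2 := by
    have := ((continuous_apply a).continuousAt.comp hc).tendsto.comp ht
    refine this.eventually (isOpen_Ioo.mem_nhds ?_)
    simp only [Function.comp_apply, hx.2.1]
    cases b <;> simp [sideVal]
  have h5 : ∀ᶠ t in 𝓝[>] (0 : ℝ), |e (x + t • v) a - sideVal b| < 1 := by
    have := ((continuous_apply a).continuousAt.comp hc).tendsto.comp ht
    have h6 := this.eventually (Metric.ball_mem_nhds _ one_pos)
    filter_upwards [h6] with t h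
    simpa [Real.dist_eq, hx.2.1] using h
  filter_upwards [h1, h2, h3, h5] with t h1 h2 h3 h5
  refine ⟨h2, fun i _ => ?_, fun i b h => by simp at h⟩
  by_cases hi : i = a
  · subst hi
    rw [abs_lt] at h5
    cases b <;> simp only [sideSign, sideVal] at h1 h5 <;> constructor <;> linarith
  · exact h3 i hi

lemma eventually_notMem_cell {a : Fin d} {b : Bool} {x : Vec d}
    (hx : x ∈ openFaceOf e (sideSpec a b)) {v : Vec d}
    (hv : 0 < sideSign b * ∑ j, v j * gradMat e x a j) :
    ∀ᶠ t in 𝓝[>] (0 : ℝ), x + t • v ∉ cellOf e := by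
  rw [mem_sideSpec] at hx
  have hd := hasDerivAt_line (differentiableAt_pi.1 (he.differentiableAt hx.1) a) v
  have h1 : ∀ᶠ t in 𝓝[>] (0 : ℝ), 0 < sideSign b * (e (x + t • v) a - sideVal b) := by
    refine eventually_pos_of_hasDerivAt ((hd.sub_const _).const_mul (sideSign b)) ?_ hv
    simp [hx.2.1]
  filter_upwards [h1] with t h1 hmem
  have h2 := hmem.2.1 a
  have h3 := hmem.2.2 a
  simp only [Pi.zero_apply, Pi.one_apply] at h2 h3
  cases b <;> simp only [sideSign, sideVal] at h1 <;> linarith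

lemma sideSign_mul_sum_unitNormal {x : Vec d} (hx : x ∈ e.source) (a : Fin d) (b : Bool) :
    sideSign b * ∑ j, unitNormal e a b j x * gradMat e x a j = √(∑ l, gradMat e x a l ^ 2) := by
  have : ∀ j, unitNormal e a b j x * gradMat e x a j = sideSign b * √(∑ l, gradMat e x a l ^ 2) *
      (unitNormal e a b j x * unitNormal e a b j x) := by
    intro j
    conv_lhs => rw [he.gradMat_eq hx a b j]
    ring
  simp only [this]
  rw [← Finset.mul_sum, he.sum_unitNormal_sq hx, mul_one, ← mul_assoc, sideSign_mul_self, one_mul]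

end IsC2Chart

lemma sideSpec_injective {a a' : Fin d} {b b' : Bool} (h : sideSpec a b = sideSpec a' b') :
    a = a' ∧ b = b' := by
  have h1 := congrFun h a
  simp only [sideSpec, if_true] at h1
  by_cases h2 : a = a'
  · simp [h2] at h1; exact ⟨h2, h1⟩
  · simp [h2] at h1

namespace RVE

variable (R : RVE d)

lemma isC2Chart (c : Fin R.N) : IsC2Chart (R.chart c) :=
  ⟨R.chart_contDiffOn c, R.chart_symm_contDiffOn c⟩

lemma sideInterior_eq (F : R.Side) :
    R.sideInterior F = openFaceOf (R.chart F.1) (sideSpec F.2.1 F.2.2) := rfl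

lemma normal_eq (F : R.Side) : R.normal F = unitNormal (R.chart F.1) F.2.1 F.2.2 := rfl

lemma sideInterior_subset_cell (F : R.Side) : R.sideInterior F ⊆ cellOf (R.chart F.1) :=
  openFaceOf_subset_cellOf _

lemma sideInterior_subset_box (F : R.Side) : R.sideInterior F ⊆ R.box :=
  (R.sideInterior_subset_cell F).trans (R.cell_subset _)

lemma sideInterior_nonempty (F : R.Side) : (R.sideInterior F).Nonempty :=
  openFaceOf_nonempty (R.cube_subset _) _

lemma sideInterior_injective {F F' : R.Side} (hc : F.1 = F'.1)
    (h : R.sideInterior F = R.sideInterior F') : F = F' := by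
  obtain ⟨c, a, b⟩ := F
  obtain ⟨c', a', b'⟩ := F'
  subst hc
  obtain ⟨x, hx⟩ := R.sideInterior_nonempty (c, a, b)
  have hx' := hx
  rw [h] at hx'
  obtain ⟨rfl, rfl⟩ := sideSpec_injective (openFaceOf_spec_unique hx hx')
  rfl

lemma cellOf_subset_region (c : Fin R.N) : cellOf (R.chart c) ⊆ R.region :=
  subset_iUnion (fun c => cellOf (R.chart c)) c

lemma isCompact_region : IsCompact R.region :=
  isCompact_iUnion fun c => isCompact_cellOf (R.cube_subset c)

lemma region_subset_box : R.region ⊆ R.box := iUnion_subset R.cell_subset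

lemma openFaceOf_image_eq {c c' : Fin R.N} {s s' : Fin d → Option Bool} {k k' : Fin d → ℤ}
    (h : openFaceOf (R.chart c) s = latticeShift R.L k '' openFaceOf (R.chart c') s')
    (h' : openFaceOf (R.chart c) s = latticeShift R.L k' '' openFaceOf (R.chart c') s') :
    k = k' := by
  have h1 : latticeShift R.L (-k' + k) '' openFaceOf (R.chart c') s' = openFaceOf (R.chart c') s' := by
    rw [← latticeShift_image_image, ← h, h', latticeShift_image_image]
    simp
  have := eq_zero_of_latticeShift_image R.L_pos (openFaceOf_nonempty (R.cube_subset c') s')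
    ((openFaceOf_subset_cellOf _).trans (R.cell_subset _)) h1
  exact (neg_add_eq_zero.1 this).symm

/-- Distinct sides that coincide up to a lattice translation. -/
structure Mate (F F' : R.Side) (k : Fin d → ℤ) : Prop where
  ne : F ≠ F'
  image_eq : R.sideInterior F = latticeShift R.L k '' R.sideInterior F'

variable {R}

namespace Mate

variable {F F' F'' : R.Side} {k k' : Fin d → ℤ}

lemma symm (h : R.Mate F F' k) : R.Mate F' F (-k) :=
  ⟨h.ne.symm, by rw [h.image_eq, latticeShift_image_image]; simp⟩

lemma shift_mem (h : R.Mate F F' k) {x : Vec d} (hx : x ∈ R.sideInterior F) :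
    latticeShift R.L (-k) x ∈ R.sideInterior F' := by
  rw [h.image_eq, mem_latticeShift_image] at hx; exact hx

/-- The normals of coinciding sides of nonoverlapping cells are opposite. -/
lemma normal_eq_neg (h : R.Mate F F' k) {x : Vec d} (hx : x ∈ R.sideInterior F) (j : Fin d) :
    R.normal F' j (latticeShift R.L (-k) x) = -R.normal F j x := by
  set x' := latticeShift R.L (-k) x with hx'def
  have hx' : x' ∈ R.sideInterior F' := h.shift_mem hx
  have he := R.isC2Chart F.1
  have he' := R.isC2Chart F'.1
  have hfd : DifferentiableAt ℝ (fun y => R.chart F'.1 (latticeShift R.L (-k) y) F'.2.1) x := by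
    refine DifferentiableAt.comp (g := fun y => R.chart F'.1 y F'.2.1) x
      (differentiableAt_pi.1 (he'.differentiableAt hx'.1) F'.2.1) ?_
    rw [latticeShift_eq_add]; fun_prop
  -- The coordinate that is fixed on `F'`, transported by the translation, is constant on `F`. Its
  -- gradient is therefore parallel to the normal of `F`, and the two unit normals agree up to sign.
  obtain ⟨c, hc⟩ := he.exists_pd_eq_mul_unitNormal (a := F.2.1) F.2.2 hx hfd fun y hy => by
    rw [(mem_sideSpec.1 (h.shift_mem hy)).2.1, (mem_sideSpec.1 hx').2.1]
  have hc' : ∀ j, gradMat (R.chart F'.1) x' F'.2.1 j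
      = c * unitNormal (R.chart F.1) F.2.1 F.2.2 j x := by
    intro j
    rw [← hc j]
    exact (pd_latticeShift (fun y => R.chart F'.1 y F'.2.1) (-k) x j).symm
  set ν := fun j => unitNormal (R.chart F.1) F.2.1 F.2.2 j x with hν
  set ν' := fun j => unitNormal (R.chart F'.1) F'.2.1 F'.2.2 j x' with hν'
  set μ := sideSign F'.2.2 * c / √(∑ l, gradMat (R.chart F'.1) x' F'.2.1 l ^ 2) with hμ
  have h1 : ∀ j, ν' j = μ * ν j := by
    intro j
    simp only [hν', unitNormal, hc', hμ, hν]
    ring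
  have h2 : μ * μ = 1 := by
    have := he'.sum_unitNormal_sq hx'.1 F'.2.1 F'.2.2
    change ∑ j, ν' j * ν' j = 1 at this
    simp only [h1] at this
    rw [← this]
    have h3 := he.sum_unitNormal_sq hx.1 F.2.1 F.2.2
    change ∑ j, ν j * ν j = 1 at h3
    rw [← mul_one (μ * μ), ← h3, Finset.mul_sum]
    exact Finset.sum_congr rfl fun _ _ => by ring
  rcases mul_self_eq_one_iff.1 h2 with h3 | h3
  -- With equal normals, a short inward step from the common point would enter both open cells.
  -- Nonoverlap then forces the same cell and no translation, hence the same side.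
  · exfalso
    have h4 : ν' = ν := funext fun j => by rw [h1, h3, one_mul]
    have i1 := he.eventually_mem_openCell (v := fun j => -ν j) hx (by
      simp only [neg_mul, Finset.sum_neg_distrib, mul_neg, neg_lt_zero, hν]
      rw [he.sideSign_mul_sum_unitNormal hx.1]
      exact he.sqrt_sum_gradMat_pos hx.1 _)
    have i2 := he'.eventually_mem_openCell (v := fun j => -ν' j) hx' (by
      simp only [neg_mul, Finset.sum_neg_distrib, mul_neg, neg_lt_zero, hν']
      rw [he'.sideSign_mul_sum_unitNormal hx'.1]
      exact he'.sqrt_sum_gradMat_pos hx'.1 _)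
    obtain ⟨t, ht1, ht2⟩ := (i1.and i2).exists
    have h5 : x' + t • (fun j => -ν' j) = latticeShift R.L (-k) (x + t • fun j => -ν j) := by
      rw [h4, hx'def, latticeShift_eq_add]; exact add_right_comm _ _ _
    rw [h5, ← mem_latticeShift_image] at ht2
    obtain ⟨hcc, hk⟩ := R.nonoverlapping F.1 F'.1 k ⟨_, ht1, ht2⟩
    refine h.ne (R.sideInterior_injective hcc ?_)
    rw [h.image_eq, hk, latticeShift_image_zero]
  · change ν' j = -ν j
    rw [h1, h3, neg_one_mul]

lemma trans (h : R.Mate F F' k) (h' : R.Mate F F'' k') (hne : F' ≠ F'') :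
    R.Mate F' F'' (-k + k') :=
  ⟨hne, by
    rw [← latticeShift_image_image, ← h'.image_eq, h.image_eq, latticeShift_image_image]
    simp⟩

/-- Three different coinciding sides would have pairwise opposite normals, which is impossible for
nonzero vectors. -/
lemma unique (h : R.Mate F F' k) (h' : R.Mate F F'' k') : F' = F'' ∧ k = k' := by
  have h1 : F' = F'' := by
    by_contra hne
    obtain ⟨x, hx⟩ := R.sideInterior_nonempty F
    have h3 := fun j => (h.trans h' hne).normal_eq_neg (h.shift_mem hx) j
    have h4 := fun j => h.normal_eq_neg hx j
    have h5 := fun j => h'.normal_eq_neg hx j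
    have h6 : latticeShift R.L (-(-k + k')) (latticeShift R.L (-k) x) = latticeShift R.L (-k') x := by
      rw [latticeShift_latticeShift]; congr 1; abel
    have h7 := (R.isC2Chart F.1).sum_unitNormal_sq hx.1 F.2.1 F.2.2
    rw [Finset.sum_eq_zero] at h7
    · simp at h7
    · intro j _
      have a1 := h3 j
      rw [h6, h5 j, h4 j] at a1
      have : R.normal F j x = 0 := by linarith
      rw [← R.normal_eq, this, mul_zero]
  subst h1
  exact ⟨rfl, R.openFaceOf_image_eq h.image_eq h'.image_eq⟩

end Mate

variable (R)

/-- The point lies in some open face of the translated cell. Conformity makes that face coincide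
with the side, and equality of dimensions makes it a side as well. -/
lemma exists_mate_of_mem {F : R.Side} {x : Vec d} (hx : x ∈ R.sideInterior F) {c : Fin R.N}
    {k : Fin d → ℤ} (hxc : x ∈ latticeShift R.L k '' cellOf (R.chart c))
    (hck : ¬(c = F.1 ∧ k = 0)) : ∃ F' : R.Side, F'.1 = c ∧ R.Mate F F' k := by
  rw [mem_latticeShift_image] at hxc
  obtain ⟨s, hs⟩ := exists_openFaceOf hxc
  obtain ⟨h1, h2⟩ := R.conforming F.1 c (sideSpec F.2.1 F.2.2) s k
    ⟨x, hx, mem_latticeShift_image.2 hs⟩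
  obtain ⟨a, b, rfl⟩ := eq_sideSpec_of_ncard h2
  refine ⟨(c, a, b), rfl, ?_, h1⟩
  rintro rfl
  refine hck ⟨rfl, R.openFaceOf_image_eq h1 ?_⟩
  rw [latticeShift_image_zero]

lemma exists_mate_of_not_boundary {F : R.Side} (h : ¬R.IsBoundaryPatch F) :
    ∃ F', R.Mate F F' 0 := by
  simp only [IsBoundaryPatch, not_forall] at h
  obtain ⟨c, hc, h⟩ := h
  obtain ⟨x, hx, hx'⟩ := not_disjoint_iff.1 h
  obtain ⟨F', -, hF'⟩ := R.exists_mate_of_mem hx (c := c) (k := 0)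
    (by rwa [latticeShift_image_zero]) (fun h => hc h.1)
  exact ⟨F', hF'⟩

/-- A further cell attached inside the same unit cell would provide a second mate, with zero
translation, against uniqueness. -/
lemma isBoundaryPatch_of_mate {F F' : R.Side} {k : Fin d → ℤ} (h : R.Mate F F' k) (hk : k ≠ 0) :
    R.IsBoundaryPatch F := by
  by_contra hb
  obtain ⟨F'', hF''⟩ := R.exists_mate_of_not_boundary hb
  exact hk (h.unique hF'').2

lemma not_isBoundaryPatch_of_mate {F F' : R.Side} (h : R.Mate F F' 0) :
    ¬R.IsBoundaryPatch F := by
  intro hb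
  obtain ⟨x, hx⟩ := R.sideInterior_nonempty F
  have hx' := h.shift_mem hx
  rw [neg_zero, latticeShift_zero] at hx'
  by_cases hc : F'.1 = F.1
  · refine h.ne (R.sideInterior_injective hc.symm ?_)
    rw [h.image_eq, latticeShift_image_zero]
  · exact disjoint_left.1 (hb F'.1 hc) hx (R.sideInterior_subset_cell F' hx')

/-- A side that meets the periodic structure is attached to a further translated cell. -/
lemma exists_mate_of_mem_periodicStructure {F : R.Side} {x : Vec d} (hx : x ∈ R.sideInterior F)
    (hxp : x ∈ R.periodicStructure) : ∃ F' k, R.Mate F F' k := by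
  have he := R.isC2Chart F.1
  set v : Vec d := fun j => unitNormal (R.chart F.1) F.2.1 F.2.2 j x with hv
  have ht := tendsto_line x v
  have h1 := he.eventually_notMem_cell (v := v) hx (by
    rw [he.sideSign_mul_sum_unitNormal hx.1]
    exact he.sqrt_sum_gradMat_pos hx.1 _)
  have h2 := ht.eventually (isOpen_interior.mem_nhds hxp)
  have hbox := R.sideInterior_subset_box F hx
  -- Points near the box are reached only by translates with entries between -2 and 2. A finite
  -- union of compact cells is closed, so membership passes to the limit on the outward ray.
  have h3 : ∀ᶠ t in 𝓝[>] (0 : ℝ), ∀ i, (x + t • v) i ∈ Ioo (-R.L i) (2 * R.L i) := by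
    rw [eventually_all]
    intro i
    have := ((continuous_apply i).continuousAt (x := x)).tendsto.comp ht
    refine this.eventually (isOpen_Ioo.mem_nhds ⟨?_, ?_⟩)
    · have := hbox.1 i; have := R.L_pos i; simp only [Pi.zero_apply] at *; linarith
    · have := hbox.2 i; have := R.L_pos i; linarith
  let K : Set (Fin R.N × (Fin d → ℤ)) := {p | p.2 ∈ Icc (-2) 2 ∧ ¬(p.1 = F.1 ∧ p.2 = 0)}
  have hK : K.Finite := by
    refine ((finite_univ (α := Fin R.N)).prod (finite_Icc (-2 : Fin d → ℤ) 2)).subset ?_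
    rintro ⟨c, k⟩ h
    exact ⟨mem_univ _, h.1⟩
  have hclosed : IsClosed (⋃ p ∈ K, latticeShift R.L p.2 '' cellOf (R.chart p.1)) :=
    hK.isClosed_biUnion fun p _ =>
      ((isCompact_cellOf (R.cube_subset p.1)).image (continuous_latticeShift p.2)).isClosed
  have hmem : ∀ᶠ t in 𝓝[>] (0 : ℝ),
      x + t • v ∈ ⋃ p ∈ K, latticeShift R.L p.2 '' cellOf (R.chart p.1) := by
    filter_upwards [h1, h2, h3] with t h1 h2 h3
    obtain ⟨k, hk⟩ := mem_iUnion.1 (interior_subset h2)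
    rw [mem_latticeShift_image] at hk
    obtain ⟨c, hc⟩ := mem_iUnion.1 hk
    refine mem_iUnion₂.2 ⟨(c, k), ⟨⟨fun i => ?_, fun i => ?_⟩, ?_⟩, mem_latticeShift_image.2 hc⟩
    · have a1 := (R.cell_subset c hc).1 i
      have a2 := (R.cell_subset c hc).2 i
      have a3 := h3 i
      have a4 := R.L_pos i
      simp only [latticeShift, Pi.neg_apply, Pi.ofNat_apply] at a1 a2 ⊢
      push_cast at a1 a2
      by_contra! hlt
      have : (k i : ℝ) ≤ -3 := by exact_mod_cast (show k i ≤ -3 by omega)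
      nlinarith [a3.1]
    · have a1 := (R.cell_subset c hc).1 i
      have a2 := (R.cell_subset c hc).2 i
      have a3 := h3 i
      have a4 := R.L_pos i
      simp only [latticeShift, Pi.neg_apply, Pi.ofNat_apply] at a1 a2 ⊢
      push_cast at a1 a2
      by_contra! hlt
      have : (3 : ℝ) ≤ k i := by exact_mod_cast (show 3 ≤ k i by omega)
      nlinarith [a3.2]
    · rintro ⟨rfl, rfl⟩
      rw [neg_zero, latticeShift_zero] at hc
      exact h1 hc
  obtain ⟨p, hp, hxp⟩ := mem_iUnion₂.1 (hclosed.mem_of_tendsto ht hmem)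
  obtain ⟨F', -, hF'⟩ := R.exists_mate_of_mem hx hxp hp.2
  exact ⟨F', p.2, hF'⟩

/-- The normal of a side in a coordinate plane. -/
lemma normal_of_const {F : R.Side} {x : Vec d} (hx : x ∈ R.sideInterior F) {ζ : Fin d}
    (h : ∀ y ∈ R.sideInterior F, y ζ = x ζ) :
    ∃ σ : ℝ, ∀ j, R.normal F j x = if ζ = j then σ else 0 := by
  have he := R.isC2Chart F.1
  obtain ⟨c, hc⟩ := he.exists_pd_eq_mul_unitNormal (f := fun y => y ζ) F.2.2 hx
    (differentiableAt_apply ζ x) h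
  simp only [pd_coord] at hc
  have hc0 : c ≠ 0 := by
    rintro rfl
    have := hc ζ
    simp at this
  refine ⟨1 / c, fun j => ?_⟩
  have := hc j
  rw [R.normal_eq]
  split_ifs at this ⊢ with h
  · field_simp; linarith
  · simpa [hc0] using this.symm

/-- The normal of a side in a coordinate plane is along the corresponding axis; it cannot be along
two different axes. -/
lemma eq_of_const {F : R.Side} {ζ ζ' : Fin d} {z z' : ℝ} (h : ∀ y ∈ R.sideInterior F, y ζ = z)
    (h' : ∀ y ∈ R.sideInterior F, y ζ' = z') : ζ = ζ' := by
  obtain ⟨x, hx⟩ := R.sideInterior_nonempty F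
  obtain ⟨σ, hσ⟩ := R.normal_of_const hx fun y hy => (h y hy).trans (h x hx).symm
  obtain ⟨σ', hσ'⟩ := R.normal_of_const hx fun y hy => (h' y hy).trans (h' x hx).symm
  by_contra hne
  have h7 := (R.isC2Chart F.1).sum_unitNormal_sq hx.1 F.2.1 F.2.2
  rw [Finset.sum_eq_zero] at h7
  · simp at h7
  · intro j _
    rw [← R.normal_eq]
    by_cases hj : ζ = j
    · rw [hσ', if_neg (fun h => hne (hj.trans h.symm)), mul_zero]
    · rw [hσ, if_neg hj, mul_zero]

end RVE

end Flexo
end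

noncomputable section
namespace Flexo

variable {d n k : ℕ}

/-! ### Integrals over coinciding faces -/

section Param

variable {L : Vec d} {P P' : Vec k → Vec d} {π π' : Vec d → Vec k} {κ : Fin d → ℤ}

/-- The transition map is `π'` applied to the translate of `P`. The left inverses are chart
coordinates in the uses below, differentiable in the ambient space, so smoothness of the transition
map is immediate from the chain rule. -/
lemma exists_reparam (hP : DifferentiableOn ℝ P (openCube k))
    (hπ : ∀ w ∈ openCube k, π (P w) = w) (hπ' : ∀ w ∈ openCube k, π' (P' w) = w)
    (hdπ' : ∀ w ∈ openCube k, DifferentiableAt ℝ π' (P' w))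
    (himg : P '' openCube k = latticeShift L κ '' (P' '' openCube k)) :
    ∃ T : Vec k → Vec k, DifferentiableOn ℝ T (openCube k) ∧ InjOn T (openCube k) ∧
      T '' openCube k = openCube k ∧ ∀ w ∈ openCube k, latticeShift L (-κ) (P w) = P' (T w) := by
  have h1 : ∀ w ∈ openCube k, ∃ w' ∈ openCube k, P' w' = latticeShift L (-κ) (P w) := by
    intro w hw
    have := mem_image_of_mem P hw
    rwa [himg, mem_latticeShift_image] at this
  refine ⟨fun w => π' (latticeShift L (-κ) (P w)), ?_, ?_, ?_, ?_⟩
  · intro w hw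
    obtain ⟨w', hw', h⟩ := h1 w hw
    have hd : DifferentiableAt ℝ π' (latticeShift L (-κ) (P w)) := h ▸ hdπ' w' hw'
    refine DifferentiableAt.comp_differentiableWithinAt w hd ?_
    rw [latticeShift_eq_add]
    exact (hP w hw).add_const _
  · intro w hw w₂ hw₂ h
    obtain ⟨w', hw', h'⟩ := h1 w hw
    obtain ⟨w₂', hw₂', h₂'⟩ := h1 w₂ hw₂
    beta_reduce at h
    rw [← h', ← h₂', hπ' _ hw', hπ' _ hw₂'] at h
    rw [h, h₂'] at h'
    have := congrArg (latticeShift L κ) h'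
    simp only [latticeShift_latticeShift, add_neg_cancel, latticeShift_zero] at this
    rw [← hπ w hw, ← hπ w₂ hw₂, this]
  · ext w'
    constructor
    · rintro ⟨w, hw, rfl⟩
      obtain ⟨w', hw', h'⟩ := h1 w hw
      beta_reduce
      rwa [← h', hπ' _ hw']
    · intro hw'
      have : latticeShift L κ (P' w') ∈ P '' openCube k := by
        rw [himg]; exact mem_image_of_mem _ (mem_image_of_mem _ hw')
      obtain ⟨w, hw, h⟩ := this
      refine ⟨w, hw, ?_⟩
      beta_reduce
      rw [h, latticeShift_latticeShift, neg_add_cancel, latticeShift_zero, hπ' _ hw']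
  · intro w hw
    obtain ⟨w', hw', h'⟩ := h1 w hw
    beta_reduce
    rw [← h', hπ' _ hw']

lemma areaDensity_latticeShift (κ : Fin d → ℤ) (w : Vec k) :
    areaDensity (fun w => latticeShift L κ (P w)) w = areaDensity P w := by
  have : tanMat (fun w => latticeShift L κ (P w)) w = tanMat P w := by
    ext α j
    simp only [tanMat, Matrix.of_apply, pd, latticeShift]
    rw [fderiv_add_const]
  unfold areaDensity; rw [this]

lemma setIntegral_param_eq (hP : DifferentiableOn ℝ P (openCube k))
    (hP' : DifferentiableOn ℝ P' (openCube k))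
    (hπ : ∀ w ∈ openCube k, π (P w) = w) (hπ' : ∀ w ∈ openCube k, π' (P' w) = w)
    (hdπ' : ∀ w ∈ openCube k, DifferentiableAt ℝ π' (P' w))
    (himg : P '' openCube k = latticeShift L κ '' (P' '' openCube k)) (g : Vec d → ℝ) :
    ∫ w in openCube k, g (P' w) * areaDensity P' w
      = ∫ w in openCube k, g (latticeShift L (-κ) (P w)) * areaDensity P w := by
  obtain ⟨T, hT, hinj, hT', h⟩ := exists_reparam hP hπ hπ' hdπ' himg
  rw [setIntegral_reparam hT hinj hT' hP' h g]
  simp only [areaDensity_latticeShift]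

lemma integrableOn_param (hP : DifferentiableOn ℝ P (openCube k))
    (hP' : DifferentiableOn ℝ P' (openCube k))
    (hπ : ∀ w ∈ openCube k, π (P w) = w) (hπ' : ∀ w ∈ openCube k, π' (P' w) = w)
    (hdπ' : ∀ w ∈ openCube k, DifferentiableAt ℝ π' (P' w))
    (himg : P '' openCube k = latticeShift L κ '' (P' '' openCube k)) (g : Vec d → ℝ)
    (hg : IntegrableOn (fun w => g (P' w) * areaDensity P' w) (openCube k)) :
    IntegrableOn (fun w => g (latticeShift L (-κ) (P w)) * areaDensity P w) (openCube k) := by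
  obtain ⟨T, hT, hinj, hT', h⟩ := exists_reparam hP hπ hπ' hdπ' himg
  have := integrableOn_reparam hT hinj hT' hP' h g hg
  simpa only [areaDensity_latticeShift] using this

end Param

/-! ### Surface gradients and tractions on coinciding faces -/

lemma surfaceGrad_neg_normal {ν ν' : Fin d → Vec d → ℝ} {x : Vec d} (h : ∀ j, ν' j x = -ν j x)
    (j : Fin d) (f : Vec d → ℝ) : surfaceGrad ν' j f x = surfaceGrad ν j f x := by
  simp [surfaceGrad, h]

lemma surfaceGrad_neg (ν : Fin d → Vec d → ℝ) (j : Fin d) (f : Vec d → ℝ) (x : Vec d) :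
    surfaceGrad ν j (fun y => -f y) x = -surfaceGrad ν j f x := by
  simp [surfaceGrad, pd_neg]

/-- If two functions agree on the side, their gradients differ by a multiple of the normal, which
the surface projection kills. Surface derivatives thus do not depend on how the normal is extended
off the side, although each chart extends it differently. -/
lemma IsC2Chart.surfaceGrad_congr {e : OpenPartialHomeomorph (Vec d) (Vec d)} (he : IsC2Chart e)
    {a : Fin d} {b : Bool} {x : Vec d} (hx : x ∈ openFaceOf e (sideSpec a b)) {f g : Vec d → ℝ}
    (hf : DifferentiableAt ℝ f x) (hg : DifferentiableAt ℝ g x)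
    (hfg : ∀ y ∈ openFaceOf e (sideSpec a b), f y = g y) (j : Fin d) :
    surfaceGrad (unitNormal e a b) j f x = surfaceGrad (unitNormal e a b) j g x := by
  obtain ⟨c, hc⟩ := he.exists_pd_eq_mul_unitNormal b hx (hf.fun_sub hg) fun y hy => by
    rw [hfg y hy, hfg x hx]; simp
  have hc' : ∀ k, pd k f x = pd k g x + c * unitNormal e a b k x := by
    intro k; rw [← hc, pd_sub hf hg]; ring
  have h1 : ∑ k, c * unitNormal e a b k x * unitNormal e a b k x = c := by
    simp only [mul_assoc]
    rw [← Finset.mul_sum, he.sum_unitNormal_sq hx.1, mul_one]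
  simp only [surfaceGrad_eq, hc', add_mul, Finset.sum_add_distrib, h1]
  ring

namespace RVE

variable {R : RVE d}

namespace Mate

variable {F F' : R.Side} {κ : Fin d → ℤ}

lemma image_eq_of_zero (h : R.Mate F F' 0) : R.sideInterior F' = R.sideInterior F := by
  rw [h.image_eq, latticeShift_image_zero]

lemma normal_eq_neg_of_zero (h : R.Mate F F' 0) {x : Vec d} (hx : x ∈ R.sideInterior F)
    (j : Fin d) : R.normal F' j x = -R.normal F j x := by
  simpa using h.normal_eq_neg hx j

lemma surfaceGrad_eq (h : R.Mate F F' 0) {x : Vec d} (hx : x ∈ R.sideInterior F)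
    (j : Fin d) (f : Vec d → ℝ) :
    surfaceGrad (R.normal F') j f x = surfaceGrad (R.normal F) j f x :=
  surfaceGrad_neg_normal (fun j => h.normal_eq_neg_of_zero hx j) j f

/-- Every term of the traction is odd in the normal. The two normal fields are opposite on the side
only, so their derivatives are compared through `surfaceGrad_congr`. -/
lemma tractionOf_eq_neg (h : R.Mate F F' 0) {x : Vec d} (hx : x ∈ R.sideInterior F)
    {P : Fin d → Vec d → ℝ} {Q : Fin d → Fin d → Vec d → ℝ}
    (hQ : ∀ j k, DifferentiableAt ℝ (Q j k) x) :
    tractionOf (R.normal F') P Q x = -tractionOf (R.normal F) P Q x := by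
  have hx' : x ∈ R.sideInterior F' := h.image_eq_of_zero ▸ hx
  have hn := fun j => h.normal_eq_neg_of_zero hx j
  have hd : ∀ j, DifferentiableAt ℝ (R.normal F j) x := fun j =>
    (R.isC2Chart F.1).differentiableAt_unitNormal hx.1 _ _ j
  have hd' : ∀ j, DifferentiableAt ℝ (R.normal F' j) x := fun j =>
    (R.isC2Chart F'.1).differentiableAt_unitNormal hx'.1 _ _ j
  have hH : ∀ l, surfaceGrad (R.normal F') l (R.normal F' l) x
      = -surfaceGrad (R.normal F) l (R.normal F l) x := by
    intro l
    rw [h.surfaceGrad_eq hx, ← surfaceGrad_neg]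
    exact (R.isC2Chart F.1).surfaceGrad_congr hx (hd' l) (hd l).fun_neg
      (fun y hy => h.normal_eq_neg_of_zero hy l) l
  have hA : ∀ j, surfaceGrad (R.normal F') j (fun y => ∑ k, Q j k y * R.normal F' k y) x
      = -surfaceGrad (R.normal F) j (fun y => ∑ k, Q j k y * R.normal F k y) x := by
    intro j
    rw [h.surfaceGrad_eq hx, ← surfaceGrad_neg]
    refine (R.isC2Chart F.1).surfaceGrad_congr hx
      (DifferentiableAt.fun_sum fun k _ => (hQ j k).fun_mul (hd' k))
      (DifferentiableAt.fun_sum fun k _ => (hQ j k).fun_mul (hd k)).fun_neg (fun y hy => ?_) j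
    rw [← Finset.sum_neg_distrib]
    exact Finset.sum_congr rfl fun k _ => by rw [h.normal_eq_neg_of_zero hy]; ring
  simp only [tractionOf, hH, hA, hn, Finset.sum_neg_distrib, mul_neg, neg_mul, neg_neg]
  ring

lemma doubleTractionOf_eq (h : R.Mate F F' 0) {x : Vec d} (hx : x ∈ R.sideInterior F)
    (Q : Fin d → Fin d → Vec d → ℝ) :
    doubleTractionOf (R.normal F') Q x = doubleTractionOf (R.normal F) Q x := by
  simp [doubleTractionOf, h.normal_eq_neg_of_zero hx]

/-- Both the side and its translate lie in the box, whose width is one period. A nonzero shift can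
then only be one full period, between opposite faces. -/
lemma shift_coord (h : R.Mate F F' κ) {i : Fin d} (hi : κ i ≠ 0) :
    (κ i = 1 ∧ ∀ y ∈ R.sideInterior F, y i = R.L i) ∨
      (κ i = -1 ∧ ∀ y ∈ R.sideInterior F, y i = 0) := by
  have hL := R.L_pos i
  have key : ∀ y ∈ R.sideInterior F,
      (κ i = 1 ∧ y i = R.L i) ∨ (κ i = -1 ∧ y i = 0) := by
    intro y hy
    have a1 := (R.sideInterior_subset_box F hy).1 i
    have a2 := (R.sideInterior_subset_box F hy).2 i
    have a3 := (R.sideInterior_subset_box F' (h.shift_mem hy)).1 i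
    have a4 := (R.sideInterior_subset_box F' (h.shift_mem hy)).2 i
    simp only [latticeShift, Pi.zero_apply, Pi.neg_apply] at a1 a2 a3 a4
    push_cast at a3 a4
    have hk1 : (κ i : ℝ) ≤ 1 := by by_contra! hlt; nlinarith
    have hk2 : (-1 : ℝ) ≤ κ i := by by_contra! hlt; nlinarith
    have hk1' : κ i ≤ 1 := by exact_mod_cast hk1
    have hk2' : -1 ≤ κ i := by exact_mod_cast hk2
    have : κ i = 1 ∨ κ i = -1 := by omega
    rcases this with hk | hk
    · left; refine ⟨hk, ?_⟩; rw [hk] at a3; push_cast at a3; linarith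
    · right; refine ⟨hk, ?_⟩; rw [hk] at a4; push_cast at a4; linarith
  obtain ⟨x, hx⟩ := R.sideInterior_nonempty F
  rcases key x hx with ⟨hk, -⟩ | ⟨hk, -⟩
  · left; refine ⟨hk, fun y hy => ?_⟩
    rcases key y hy with h | h
    · exact h.2
    · omega
  · right; refine ⟨hk, fun y hy => ?_⟩
    rcases key y hy with h | h
    · omega
    · exact h.2

/-- Distinct translates of cells share sides in the coordinate planes only. -/
lemma exists_direction (h : R.Mate F F' κ) (hκ : κ ≠ 0) :
    ∃ ζ, (κ = Pi.single ζ 1 ∨ κ = -Pi.single ζ 1 ∧ ∀ y ∈ R.sideInterior F, y ζ = 0) := by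
  obtain ⟨ζ, hζ⟩ := Function.ne_iff.1 hκ
  have hz : ∀ i, i ≠ ζ → κ i = 0 := by
    intro i hi
    by_contra h0
    have h1 : ∃ z, ∀ y ∈ R.sideInterior F, y i = z := by
      rcases h.shift_coord h0 with h | h
      · exact ⟨_, h.2⟩
      · exact ⟨_, h.2⟩
    have h2 : ∃ z, ∀ y ∈ R.sideInterior F, y ζ = z := by
      rcases h.shift_coord hζ with h | h
      · exact ⟨_, h.2⟩
      · exact ⟨_, h.2⟩
    obtain ⟨z, hz⟩ := h1
    obtain ⟨z', hz'⟩ := h2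
    exact hi (R.eq_of_const hz hz')
  refine ⟨ζ, ?_⟩
  rcases h.shift_coord hζ with ⟨h1, h2⟩ | ⟨h1, h2⟩
  · left
    funext i
    by_cases hi : i = ζ
    · subst hi; simp [h1]
    · simp [hz i hi, hi]
  · right
    refine ⟨funext fun i => ?_, h2⟩
    by_cases hi : i = ζ
    · subst hi; simp [h1]
    · simp [hz i hi, hi]

end Mate

/-! ### Cancellation of the work on the sides. -/

variable (R)

lemma latticeShift_mem_periodicStructure {κ : Fin d → ℤ} {x : Vec d} :
    latticeShift R.L κ x ∈ R.periodicStructure ↔ x ∈ R.periodicStructure := by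
  set U := ⋃ k : Fin d → ℤ, latticeShift R.L k '' R.region with hU
  have h1 : (Homeomorph.addRight (fun i => (κ i : ℝ) * R.L i : Vec d)) ⁻¹' U = U := by
    ext y
    change latticeShift R.L κ y ∈ U ↔ y ∈ U
    simp only [hU, mem_iUnion, mem_latticeShift_image, latticeShift_latticeShift]
    constructor
    · rintro ⟨l, hl⟩
      exact ⟨l - κ, by rwa [neg_sub, sub_eq_add_neg, add_comm]⟩
    · rintro ⟨l, hl⟩
      exact ⟨l + κ, by rwa [neg_add, neg_add_cancel_right]⟩
  have h2 := (Homeomorph.addRight (fun i => (κ i : ℝ) * R.L i : Vec d)).preimage_interior U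
  rw [h1] at h2
  change x ∈ (Homeomorph.addRight (fun i => (κ i : ℝ) * R.L i : Vec d)) ⁻¹' interior U ↔ _
  rw [h2]; rfl

lemma isOpen_openCell (c : Fin R.N) : IsOpen (openFaceOf (R.chart c) fun _ => none) := by
  rw [openFaceOf_none (R.cube_subset c)]
  exact (R.chart c).symm.isOpen_image_of_subset_source (isOpen_openCube _)
      ((openCube_subset_Icc _).trans (R.cube_subset c))

lemma region_subset_iUnion : R.region ⊆ ⋃ k : Fin d → ℤ, latticeShift R.L k '' R.region := by
  intro x hx
  exact mem_iUnion.2 ⟨0, by rwa [latticeShift_image_zero]⟩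

lemma openCell_subset_periodicStructure (c : Fin R.N) :
    openFaceOf (R.chart c) (fun _ => none) ⊆ R.periodicStructure :=
  interior_maximal (((openFaceOf_subset_cellOf _).trans (R.cellOf_subset_region c)).trans
    R.region_subset_iUnion) (R.isOpen_openCell c)

lemma sideInterior_subset_closure (F : R.Side) :
    R.sideInterior F ⊆ closure R.periodicStructure := by
  intro x hx
  have he := R.isC2Chart F.1
  have h := he.eventually_mem_openCell (v := fun j => -unitNormal (R.chart F.1) F.2.1 F.2.2 j x)
    hx (by
      simp only [neg_mul, Finset.sum_neg_distrib, mul_neg, neg_lt_zero]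
      rw [he.sideSign_mul_sum_unitNormal hx.1]
      exact he.sqrt_sum_gradMat_pos hx.1 _)
  exact mem_closure_of_tendsto (tendsto_line x _)
    (h.mono fun t ht => R.openCell_subset_periodicStructure F.1 ht)

lemma mem_actualBoundary {F : R.Side} {x : Vec d} (hx : x ∈ R.sideInterior F)
    (hxp : x ∉ R.periodicStructure) : x ∈ R.actualBoundary := by
  refine ⟨?_, R.sideInterior_subset_box F hx⟩
  rw [frontier, interior_eq_iff_isOpen.2 (show IsOpen R.periodicStructure from isOpen_interior)]
  exact ⟨R.sideInterior_subset_closure F hx, hxp⟩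

lemma mem_interior_box {x : Vec d} : x ∈ interior R.box ↔ ∀ i, 0 < x i ∧ x i < R.L i := by
  rw [box, ← pi_univ_Icc, interior_pi_set finite_univ]
  simp

lemma mem_frontier_box {x : Vec d} : x ∈ frontier R.box ↔ x ∈ R.box ∧ ∃ i, x i = 0 ∨ x i = R.L i := by
  rw [frontier, IsClosed.closure_eq (show IsClosed R.box from isClosed_Icc), Set.mem_sdiff,
    R.mem_interior_box, not_forall]
  refine and_congr_right fun hx => exists_congr fun i => ?_
  have h1 := hx.1 i
  have h2 := hx.2 i
  simp only [Pi.zero_apply] at h1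
  rw [not_and_or, not_lt, not_lt]
  constructor
  · rintro (h | h)
    · exact Or.inl (le_antisymm h h1)
    · exact Or.inr (le_antisymm h2 h)
  · rintro (h | h)
    · exact Or.inl h.le
    · exact Or.inr h.ge

/-- The Neumann conditions and the high-order equilibrium on the faces for a single field
component with stress `P` and double stress `Q`. -/
structure FaceBalance (P : Fin d → Vec d → ℝ) (Q : Fin d → Fin d → Vec d → ℝ) : Prop where
  traction_eq : ∀ F, R.IsBoundaryPatch F → ∀ x ∈ R.sideInterior F ∩ R.actualBoundary,
    tractionOf (R.normal F) P Q x = 0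
  doubleTraction_eq : ∀ F, R.IsBoundaryPatch F → ∀ x ∈ R.sideInterior F ∩ R.actualBoundary,
    doubleTractionOf (R.normal F) Q x = 0
  traction_add : ∀ ζ F G x, OppositePoints R ζ F G x →
    tractionOf (R.normal G) P Q (latticeShift R.L (Pi.single ζ 1) x)
      + tractionOf (R.normal F) P Q x = 0
  doubleTraction_sub : ∀ ζ F G x, OppositePoints R ζ F G x →
    doubleTractionOf (R.normal G) Q (latticeShift R.L (Pi.single ζ 1) x)
      - doubleTractionOf (R.normal F) Q x = 0

/-- The virtual work of the tractions on a side. -/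
def faceWork (P : Fin d → Vec d → ℝ) (Q : Fin d → Fin d → Vec d → ℝ) (v : Vec d → ℝ) (F : R.Side)
    (x : Vec d) : ℝ :=
  tractionOf (R.normal F) P Q x * v x
    + doubleTractionOf (R.normal F) Q x * normalDeriv (R.normal F) v x

variable {R} {P : Fin d → Vec d → ℝ} {Q : Fin d → Fin d → Vec d → ℝ} {v : Vec d → ℝ}

lemma FaceBalance.faceWork_eq_zero (hb : R.FaceBalance P Q) {F : R.Side} {x : Vec d}
    (hF : R.IsBoundaryPatch F) (hx : x ∈ R.sideInterior F) (hxp : x ∉ R.periodicStructure) :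
    R.faceWork P Q v F x = 0 := by
  have := R.mem_actualBoundary hx hxp
  rw [faceWork, hb.traction_eq F hF x ⟨hx, this⟩, hb.doubleTraction_eq F hF x ⟨hx, this⟩]
  ring

lemma sideInterior_subset_region (F : R.Side) : R.sideInterior F ⊆ R.region :=
  (R.sideInterior_subset_cell F).trans (R.cellOf_subset_region _)

/-- On a fictitious side tractions are opposite while `v` agrees, and double tractions agree while
the normal derivatives are opposite. The latter needs only the periodicity of `∂v/∂ζ`, because the
normal is along the axis `ζ`. Off the periodic structure both works vanish by the Neumann
conditions. -/
lemma FaceBalance.faceWork_add_aux (hb : R.FaceBalance P Q) {m : ℕ} (hv : R.IsPeriodicField m v)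
    {F F' : R.Side} {ζ : Fin d} (h : R.Mate F F' (-Pi.single ζ 1))
    (hζ : ∀ y ∈ R.sideInterior F, y ζ = 0) {x : Vec d} (hx : x ∈ R.sideInterior F) :
    R.faceWork P Q v F x + R.faceWork P Q v F' (latticeShift R.L (Pi.single ζ 1) x) = 0 := by
  have hx' : latticeShift R.L (Pi.single ζ 1) x ∈ R.sideInterior F' := by
    simpa using h.shift_mem hx
  have hne : (-Pi.single ζ 1 : Fin d → ℤ) ≠ 0 := by
    intro h0
    have := congrFun h0 ζ
    simp at this
  have hF := R.isBoundaryPatch_of_mate h hne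
  have hF' := R.isBoundaryPatch_of_mate h.symm (neg_ne_zero.2 hne)
  by_cases hxp : x ∈ R.periodicStructure
  · have hopp : OppositePoints R ζ F F' x :=
      ⟨hF, hF', ⟨hx, R.mem_frontier_box.2 ⟨R.sideInterior_subset_box F hx, ζ, Or.inl (hζ x hx)⟩, hxp⟩,
        hζ x hx, hx'⟩
    have h1 := hb.traction_add ζ F F' x hopp
    have h2 := hb.doubleTraction_sub ζ F F' x hopp
    have h3 := hv.periodic x (R.sideInterior_subset_region F hx) _
      (R.sideInterior_subset_region F' hx')
    have h4 := hv.periodic_deriv x (R.sideInterior_subset_region F hx) ζ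
      (R.sideInterior_subset_region F' hx')
    obtain ⟨σ, hσ⟩ := R.normal_of_const hx fun y hy => (hζ y hy).trans (hζ x hx).symm
    have h5 : ∀ j, R.normal F' j (latticeShift R.L (Pi.single ζ 1) x) = -R.normal F j x := by
      intro j
      simpa using h.normal_eq_neg hx j
    have h6 : normalDeriv (R.normal F') v (latticeShift R.L (Pi.single ζ 1) x)
        = -normalDeriv (R.normal F) v x := by
      simp only [normalDeriv, h5, hσ]
      simp [h4]
    rw [faceWork, faceWork, h6, h3]
    linear_combination v x * h1 - normalDeriv (R.normal F) v x * h2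
  · rw [hb.faceWork_eq_zero hF hx hxp, hb.faceWork_eq_zero hF' hx'
      (fun h => hxp (R.latticeShift_mem_periodicStructure.1 h)), add_zero]

/-- The virtual works of the tractions on coinciding sides cancel. -/
lemma FaceBalance.faceWork_add (hb : R.FaceBalance P Q) {m : ℕ} (hv : R.IsPeriodicField m v)
    (hQ : ∀ x ∈ R.region, ∀ j k, DifferentiableAt ℝ (Q j k) x)
    {F F' : R.Side} {κ : Fin d → ℤ} (h : R.Mate F F' κ) {x : Vec d} (hx : x ∈ R.sideInterior F) :
    R.faceWork P Q v F x + R.faceWork P Q v F' (latticeShift R.L (-κ) x) = 0 := by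
  by_cases hκ : κ = 0
  · subst hκ
    have h1 := h.tractionOf_eq_neg (P := P) hx (hQ x (R.sideInterior_subset_region F hx))
    have h2 := h.doubleTractionOf_eq hx Q
    have h3 : normalDeriv (R.normal F') v x = -normalDeriv (R.normal F) v x := by
      simp [normalDeriv, h.normal_eq_neg_of_zero hx]
    rw [neg_zero, latticeShift_zero, faceWork, faceWork, h1, h2, h3]
    ring
  · obtain ⟨ζ, rfl | ⟨rfl, hζ⟩⟩ := h.exists_direction hκ
    -- Here it is the mate that lies in the plane `ζ = 0`, so the auxiliary lemma is applied with
    -- the two sides exchanged.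
    · have hx' := h.shift_mem hx
      have hζ' : ∀ y ∈ R.sideInterior F', y ζ = 0 := by
        intro y hy
        have h1 := h.symm.shift_coord (i := ζ) (by simp)
        simp only [Pi.neg_apply, Pi.single_eq_same] at h1
        rcases h1 with h1 | h1
        · omega
        · exact h1.2 y hy
      have := hb.faceWork_add_aux hv h.symm hζ' hx'
      rw [latticeShift_latticeShift, add_neg_cancel, latticeShift_zero] at this
      rw [add_comm]; exact this
    · have := hb.faceWork_add_aux hv h hζ hx
      rwa [neg_neg]

section Integrals

variable {R : RVE (n + 1)} {P : Fin (n + 1) → Vec (n + 1) → ℝ}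
  {Q : Fin (n + 1) → Fin (n + 1) → Vec (n + 1) → ℝ} {v : Vec (n + 1) → ℝ}

lemma setIntegral_mate {F F' : R.Side} {κ : Fin (n + 1) → ℤ} (h : R.Mate F F' κ)
    (g : Vec (n + 1) → ℝ) :
    ∫ z in openCube n, g (faceMap (R.chart F'.1) F'.2.1 F'.2.2 z) *
        areaDensity (faceMap (R.chart F'.1) F'.2.1 F'.2.2) z
      = ∫ z in openCube n, g (latticeShift R.L (-κ) (faceMap (R.chart F.1) F.2.1 F.2.2 z)) *
        areaDensity (faceMap (R.chart F.1) F.2.1 F.2.2) z := by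
  have ht : ∀ (F : R.Side), ∀ z ∈ openCube n, ins F.2.1 (sideVal F.2.2) z ∈ (R.chart F.1).target :=
    fun F z hz => R.cube_subset F.1 (ins_mem_Icc _ (sideVal_mem _) (openCube_subset_Icc _ hz))
  have hd : ∀ F : R.Side, DifferentiableOn ℝ (faceMap (R.chart F.1) F.2.1 F.2.2) (openCube n) :=
    fun F z hz => (((R.isC2Chart F.1).symm_differentiableAt (ht F z hz)).comp z
      ((contDiff_ins _ _).differentiable (by norm_num) z)).differentiableWithinAt
  let π : R.Side → Vec (n + 1) → Vec n := fun F x i => R.chart F.1 x (F.2.1.succAbove i)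
  have hl : ∀ F : R.Side, ∀ z ∈ openCube n, π F (faceMap (R.chart F.1) F.2.1 F.2.2 z) = z := by
    intro F z hz
    funext i
    simp only [π, faceMap, (R.chart F.1).right_inv (ht F z hz), ins_succAbove]
  refine setIntegral_param_eq (π := π F) (π' := π F') (hd F) (hd F') (hl F) (hl F') (fun z hz => ?_) ?_ g
  · exact differentiableAt_pi.2 fun i => differentiableAt_pi.1
      ((R.isC2Chart F'.1).differentiableAt ((R.chart F'.1).map_target (ht F' z hz))) _
  · rw [← openFaceOf_sideSpec_eq (R.cube_subset _), ← openFaceOf_sideSpec_eq (R.cube_subset _)]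
    exact h.image_eq

open Classical in
/-- The total virtual work of the tractions on all sides vanishes. -/
lemma FaceBalance.sum_integral_faceWork (hb : R.FaceBalance P Q) {m : ℕ}
    (hv : R.IsPeriodicField m v) (hQ : ∀ x ∈ R.region, ∀ j k, DifferentiableAt ℝ (Q j k) x) :
    ∑ F : R.Side, ∫ z in openCube n,
      R.faceWork P Q v F (faceMap (R.chart F.1) F.2.1 F.2.2 z) *
        areaDensity (faceMap (R.chart F.1) F.2.1 F.2.2) z = 0 := by
  have hmem : ∀ F : R.Side, ∀ z ∈ openCube n,
      faceMap (R.chart F.1) F.2.1 F.2.2 z ∈ R.sideInterior F := by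
    intro F z hz
    rw [sideInterior_eq, openFaceOf_sideSpec_eq (R.cube_subset _)]
    exact mem_image_of_mem _ hz
  -- Uniqueness of mates makes this an involution. Its fixed points are the sides without mate,
  -- whose integrals vanish by themselves.
  let g : R.Side → R.Side := fun F => if h : ∃ F' κ, R.Mate F F' κ then h.choose else F
  have hg : ∀ {F F' κ}, R.Mate F F' κ → g F = F' := by
    intro F F' κ h
    have h' : ∃ F' κ, R.Mate F F' κ := ⟨F', κ, h⟩
    simp only [g, dif_pos h']
    obtain ⟨κ', hκ'⟩ := h'.choose_spec
    exact (hκ'.unique h).1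
  have hg0 : ∀ {F}, (¬∃ F' κ, R.Mate F F' κ) → g F = F := fun h => dif_neg h
  have hzero : ∀ {F : R.Side}, (¬∃ F' κ, R.Mate F F' κ) → ∫ z in openCube n,
      R.faceWork P Q v F (faceMap (R.chart F.1) F.2.1 F.2.2 z) *
        areaDensity (faceMap (R.chart F.1) F.2.1 F.2.2) z = 0 := by
    intro F h
    refine setIntegral_eq_zero_of_forall_eq_zero fun z hz => ?_
    have hF : R.IsBoundaryPatch F := by
      by_contra hF
      obtain ⟨F', hF'⟩ := R.exists_mate_of_not_boundary hF
      exact h ⟨F', 0, hF'⟩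
    rw [hb.faceWork_eq_zero hF (hmem F z hz) fun hp =>
      h (R.exists_mate_of_mem_periodicStructure (hmem F z hz) hp), zero_mul]
  refine Finset.sum_involution (fun F _ => g F) ?_ ?_ (fun _ _ => Finset.mem_univ _) ?_
  · intro F _
    by_cases h : ∃ F' κ, R.Mate F F' κ
    · obtain ⟨F', κ, h⟩ := h
      rw [hg h, setIntegral_mate h (R.faceWork P Q v F'), add_eq_zero_iff_eq_neg, ← integral_neg]
      refine setIntegral_congr_fun (isOpen_openCube _).measurableSet fun z hz => ?_
      have := hb.faceWork_add hv hQ h (hmem F z hz)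
      linear_combination (areaDensity (faceMap (R.chart F.1) F.2.1 F.2.2) z) * this
    · rw [hg0 h, hzero h, add_zero]
  · intro F _ hne heq
    by_cases h : ∃ F' κ, R.Mate F F' κ
    · obtain ⟨F', κ, h⟩ := h
      rw [hg h] at heq
      exact h.ne heq.symm
    · exact hne (hzero h)
  · intro F _
    by_cases h : ∃ F' κ, R.Mate F F' κ
    · obtain ⟨F', κ, h⟩ := h
      rw [hg h, hg h.symm]
    · rw [hg0 h, hg0 h]

end Integrals

end RVE

end Flexo
end

noncomputable section
namespace Flexo

variable {d n : ℕ}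

/-! ### Edges -/

lemma edgeSpec_injective {a a₁ a₂ : Fin d} {b b₁ b₂ : Bool} (h₁ : a₁ ≠ a)
    (h : edgeSpec a b a₁ b₁ = edgeSpec a b a₂ b₂) : a₁ = a₂ ∧ b₁ = b₂ := by
  have h1 := congrFun h a₁
  simp only [edgeSpec, if_neg h₁, if_true] at h1
  by_cases h2 : a₁ = a₂
  · simp [h2] at h1; exact ⟨h2, h1⟩
  · simp [h2] at h1

lemma sideVal_injective {b b' : Bool} (h : sideVal b = sideVal b') : b = b' := by
  cases b <;> cases b' <;> simp [sideVal] at h ⊢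

lemma sideVal_notMem_Ioo (b : Bool) : sideVal b ∉ Ioo (0 : ℝ) 1 := by cases b <;> simp [sideVal]

lemma sideVal_sub_mem_Ioo (b : Bool) {t : ℝ} (ht : t ∈ Ioo (0 : ℝ) 1) :
    sideVal b + t * -sideSign b ∈ Ioo (0 : ℝ) 1 := by
  obtain ⟨h0, h1⟩ := ht
  cases b <;> simp only [sideVal, sideSign] <;> constructor <;> linarith

lemma sideSign_mul_sub_nonneg (b : Bool) {s : ℝ} (hs : s ∈ Ioo (0 : ℝ) 1) :
    0 ≤ -sideSign b * (s - sideVal b) := by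
  obtain ⟨h0, h1⟩ := hs
  cases b <;> simp only [sideVal, sideSign] <;> linarith

/-- The coordinate lines of `a'` run from the edge into the side. -/
lemma eventually_coordLine_mem_side {e : OpenPartialHomeomorph (Vec d) (Vec d)} {a a' : Fin d}
    (ha : a' ≠ a) {b b' : Bool} {x : Vec d} (hx : x ∈ openFaceOf e (edgeSpec a b a' b')) :
    ∀ᶠ t in 𝓝[>] (0 : ℝ), coordLine e x a' (-sideSign b') t ∈ openFaceOf e (sideSpec a b) := by
  rw [mem_edgeSpec ha] at hx
  have h1 := (eventually_coordLine hx.1 a' (-sideSign b')).filter_mono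
    (nhdsWithin_le_nhds (s := Ioi 0))
  filter_upwards [h1, Ioo_mem_nhdsGT one_pos] with t ht ht1
  rw [mem_sideSpec]
  refine ⟨ht.1, ?_, fun i hi => ?_⟩
  · rw [ht.2]
    simp [Pi.single_eq_of_ne ha.symm, hx.2.1]
  · rw [ht.2]
    by_cases h : i = a'
    · subst h
      have := sideVal_sub_mem_Ioo b' ht1
      simpa [hx.2.2.1] using this
    · simpa [Pi.single_eq_of_ne h] using hx.2.2.2 i hi h

namespace RVE

variable {R : RVE d}

lemma conormal_eq (F : R.Side) :
    R.conormal F = unitConormal (R.chart F.1) F.2.1 F.2.2 := rfl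

lemma edgeInterior_subset_region (F : R.Side) (a' : Fin d) (b' : Bool) :
    R.edgeInterior F a' b' ⊆ R.region :=
  (openFaceOf_subset_cellOf _).trans (R.cellOf_subset_region _)

/-- An edge of a side is an edge of any coinciding side, with the same conormal. -/
lemma Mate.exists_edge {F F' : R.Side} (h : R.Mate F F' 0) {a' : Fin d} {b' : Bool}
    (ha : a' ≠ F.2.1) {x : Vec d} (hx : x ∈ R.edgeInterior F a' b') :
    ∃ a'' b'', a'' ≠ F'.2.1 ∧ x ∈ R.edgeInterior F' a'' b'' ∧
      (∀ j, R.normal F' j x = -R.normal F j x) ∧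
      ∀ j, R.conormal F' a'' b'' j x = R.conormal F a' b' j x := by
  have he := R.isC2Chart F.1
  have he' := R.isC2Chart F'.1
  -- A curve that starts on the edge and runs inside the open side, where `F` and `F'` coincide.
  -- Information on the open side is carried to the edge by letting `t` tend to 0.
  set γ := coordLine (R.chart F.1) x a' (-sideSign b') with hγdef
  have hγ : Tendsto γ (𝓝[>] 0) (𝓝 x) := (tendsto_coordLine hx.1 _ _).mono_left nhdsWithin_le_nhds
  have hγF : ∀ᶠ t in 𝓝[>] (0 : ℝ), γ t ∈ R.sideInterior F := eventually_coordLine_mem_side ha hx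
  have hγF' : ∀ᶠ t in 𝓝[>] (0 : ℝ), γ t ∈ R.sideInterior F' := by
    rwa [h.image_eq_of_zero]
  have hxc : x ∈ cellOf (R.chart F'.1) :=
    (isCompact_cellOf (R.cube_subset F'.1)).isClosed.mem_of_tendsto hγ
      (hγF'.mono fun t ht => R.sideInterior_subset_cell F' ht)
  have hxa : R.chart F'.1 x F'.2.1 = sideVal F'.2.2 := by
    have h1 := ((continuous_apply F'.2.1).continuousAt.comp
      ((R.chart F'.1).continuousAt hxc.1)).tendsto.comp hγ
    refine tendsto_nhds_unique h1 (tendsto_const_nhds.congr' ?_)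
    filter_upwards [hγF'] with t ht
    exact (mem_sideSpec.1 ht).2.1.symm
  obtain ⟨s, hs⟩ := exists_openFaceOf hxc
  obtain ⟨h1, h2⟩ := R.conforming F.1 F'.1 (edgeSpec F.2.1 F.2.2 a' b') s 0
    ⟨x, hx, by rwa [latticeShift_image_zero]⟩
  rw [latticeShift_image_zero] at h1
  have hsa : s F'.2.1 = some F'.2.2 := by
    rcases h3 : s F'.2.1 with _ | b
    · have := hs.2.1 _ h3
      rw [hxa] at this
      exact absurd this (sideVal_notMem_Ioo _)
    · have := hs.2.2 _ b h3
      rw [hxa] at this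
      rw [sideVal_injective this]
  obtain ⟨a'', b'', ha'', rfl⟩ := eq_edgeSpec_of_ncard ha h2 hsa
  have hn : ∀ j, R.normal F' j x = -R.normal F j x := by
    intro j
    have c1 := (he.differentiableAt_unitNormal hx.1 F.2.1 F.2.2 j).continuousAt.tendsto.comp hγ
    have c2 := (he'.differentiableAt_unitNormal hxc.1 F'.2.1 F'.2.2 j).continuousAt.tendsto.comp hγ
    refine tendsto_nhds_unique c2 (c1.neg.congr' ?_)
    filter_upwards [hγF] with t ht
    exact (h.normal_eq_neg_of_zero ht j).symm
  refine ⟨a'', b'', ha'', hs, hn, ?_⟩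
  have hf : DifferentiableAt ℝ (fun y => R.chart F'.1 y a'') x :=
    differentiableAt_pi.1 (he'.differentiableAt hxc.1) a''
  have hxa'' := ((mem_edgeSpec ha'').1 hs).2.2.1
  have hconst : ∀ y ∈ openFaceOf (R.chart F.1) (edgeSpec F.2.1 F.2.2 a' b'),
      R.chart F'.1 y a'' = R.chart F'.1 x a'' := by
    intro y hy
    rw [h1] at hy
    rw [hxa'', ((mem_edgeSpec ha'').1 hy).2.2.1]
  -- The coordinate `a''` is constant along the edge, so its gradient involves only the gradients of
  -- the two fixed coordinates of `F`. Projection onto the side removes the one normal to `F`, which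
  -- makes the two surface gradients parallel (`hτ`).
  set c : Fin d → ℝ := fun β => ∑ l, tanMat (R.chart F.1).symm (R.chart F.1 x) β l *
    pd l (fun y => R.chart F'.1 y a'') x with hc
  have hc0 : ∀ β, β ≠ F.2.1 → β ≠ a' → c β = 0 := fun β hβ hβ' =>
    he.sum_tanMat_mul_pd_eq_zero hx hf hconst (by simp [hβ, hβ'])
  have hpd : ∀ j, gradMat (R.chart F'.1) x a'' j
      = c F.2.1 * gradMat (R.chart F.1) x F.2.1 j + c a' * gradMat (R.chart F.1) x a' j := by
    intro j
    change pd j (fun y => R.chart F'.1 y a'') x = _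
    rw [he.pd_eq_sum_gradMat hx.1 j, ← Finset.sum_pair ha.symm
      (f := fun β => c β * gradMat (R.chart F.1) x β j)]
    refine (Finset.sum_subset (Finset.subset_univ _) fun β _ hβ => ?_).symm
    simp only [Finset.mem_insert, Finset.mem_singleton, not_or] at hβ
    change c β * _ = 0
    rw [hc0 β hβ.1 hβ.2, zero_mul]
  have hτ : ∀ j, surfaceCoordGrad (R.chart F'.1) F'.2.1 F'.2.2 a'' j x
      = c a' * surfaceCoordGrad (R.chart F.1) F.2.1 F.2.2 a' j x := by
    intro j
    have h3 : surfaceCoordGrad (R.chart F.1) F.2.1 F.2.2 F.2.1 j x = 0 := by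
      rw [surfaceCoordGrad_eq]
      have : ∑ k, gradMat (R.chart F.1) x F.2.1 k * unitNormal (R.chart F.1) F.2.1 F.2.2 k x
          = sideSign F.2.2 * √(∑ l, gradMat (R.chart F.1) x F.2.1 l ^ 2) := by
        conv_lhs => enter [2, k]; rw [he.gradMat_eq hx.1 F.2.1 F.2.2 k, mul_assoc]
        rw [← Finset.mul_sum, he.sum_unitNormal_sq hx.1, mul_one]
      rw [this, he.gradMat_eq hx.1 F.2.1 F.2.2 j]; ring
    have h4 : surfaceCoordGrad (R.chart F'.1) F'.2.1 F'.2.2 a'' j x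
        = gradMat (R.chart F'.1) x a'' j - (∑ k, gradMat (R.chart F'.1) x a'' k *
          unitNormal (R.chart F.1) F.2.1 F.2.2 k x) * unitNormal (R.chart F.1) F.2.1 F.2.2 j x := by
      rw [surfaceCoordGrad_eq]
      simp only [← R.normal_eq, hn, mul_neg, Finset.sum_neg_distrib, neg_mul, neg_neg]
    rw [h4, surfaceCoordGrad_eq]
    rw [surfaceCoordGrad_eq] at h3
    simp only [hpd, add_mul, Finset.sum_add_distrib, mul_assoc, ← Finset.mul_sum]
    linear_combination c F.2.1 * h3
  -- The curve `γ` enters `F` and, since the sides coincide, also enters `F'`. This fixes the sign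
  -- of the factor, so the outward conormals are equal rather than opposite.
  have hsign : 0 ≤ sideSign b'' * sideSign b' * c a' := by
    have hd := ((he.hasDerivAt_coordLine hx.1 hf a' (-sideSign b')).sub_const
      (sideVal b'')).const_mul (-sideSign b'')
    have := nonneg_of_hasDerivAt hd (by simp [coordLine_zero hx.1, hxa'']) (by
      filter_upwards [hγF'] with t ht
      exact sideSign_mul_sub_nonneg b'' ((mem_sideSpec.1 ht).2.2 a'' ha''))
    calc (0 : ℝ) ≤ _ := this
      _ = _ := by simp only [hc]; ring
  have hpos := he'.sum_surfaceCoordGrad_sq_pos hxc.1 F'.2.2 ha''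
  have hsq : ∑ l, surfaceCoordGrad (R.chart F'.1) F'.2.1 F'.2.2 a'' l x ^ 2
      = c a' ^ 2 * ∑ l, surfaceCoordGrad (R.chart F.1) F.2.1 F.2.2 a' l x ^ 2 := by
    simp only [hτ, mul_pow, Finset.mul_sum]
  have hca : c a' ≠ 0 := by
    intro h0
    rw [hsq, h0] at hpos
    simp at hpos
  have habs : sideSign b'' * c a' = |c a'| * sideSign b' := by
    have : sideSign b'' * sideSign b' * c a' = |c a'| := by
      rw [← abs_of_nonneg hsign, abs_mul, abs_mul, abs_sideSign, abs_sideSign]; ring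
    rw [← this]
    linear_combination (-sideSign b'' * c a') * sideSign_mul_self b'
  intro j
  rw [conormal_eq, conormal_eq]
  unfold unitConormal
  rw [hsq, Real.sqrt_mul (sq_nonneg _), Real.sqrt_sq_eq_abs, hτ, ← mul_assoc, habs, mul_assoc,
    mul_div_mul_left _ _ (abs_ne_zero.2 hca)]

open Classical in
/-- The contribution of the side `F` to the jump at edges. -/
def edgeSum (A : Fin d → Fin d → ℝ) (F : R.Side) (x : Vec d) : ℝ :=
  ∑ a' : Fin d, ∑ b' : Bool, if a' ≠ F.2.1 ∧ x ∈ R.edgeInterior F a' b' then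
    ∑ j, ∑ k, A j k * R.conormal F a' b' j x * R.normal F k x else 0

lemma edgeSum_eq (A : Fin d → Fin d → ℝ) {F : R.Side} {x : Vec d} {a' : Fin d} {b' : Bool}
    (ha : a' ≠ F.2.1) (hx : x ∈ R.edgeInterior F a' b') :
    edgeSum A F x = ∑ j, ∑ k, A j k * R.conormal F a' b' j x * R.normal F k x := by
  have huniq : ∀ a₁ b₁, a₁ ≠ F.2.1 ∧ x ∈ R.edgeInterior F a₁ b₁ → a₁ = a' ∧ b₁ = b' :=
    fun a₁ b₁ h => edgeSpec_injective h.1 (openFaceOf_spec_unique h.2 hx)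
  rw [edgeSum, Finset.sum_eq_single a', Finset.sum_eq_single b', if_pos ⟨ha, hx⟩]
  · intro b _ hb
    exact if_neg fun h => hb (huniq _ _ h).2
  · simp
  · intro a _ hne
    exact Finset.sum_eq_zero fun b _ => if_neg fun h => hne (huniq _ _ h).1
  · simp

lemma edgeSum_eq_zero (A : Fin d → Fin d → ℝ) {F : R.Side} {x : Vec d}
    (h : ∀ a' b', a' ≠ F.2.1 → x ∉ R.edgeInterior F a' b') : edgeSum A F x = 0 :=
  Finset.sum_eq_zero fun a' _ => Finset.sum_eq_zero fun b' _ => if_neg fun h' => h a' b' h'.1 h'.2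

/-- Coinciding sides have the same edges with equal conormals and opposite normals, and the jump is
linear in each of the two vectors. -/
lemma Mate.edgeSum_add {F F' : R.Side} (h : R.Mate F F' 0) (A : Fin d → Fin d → ℝ) (x : Vec d) :
    edgeSum A F x + edgeSum A F' x = 0 := by
  by_cases hx : ∃ a' b', a' ≠ F.2.1 ∧ x ∈ R.edgeInterior F a' b'
  · obtain ⟨a', b', ha, hx⟩ := hx
    obtain ⟨a'', b'', ha'', hx'', hn, hm⟩ := h.exists_edge ha hx
    rw [edgeSum_eq A ha hx, edgeSum_eq A ha'' hx'']
    simp [hn, hm]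
  · by_cases hx' : ∃ a' b', a' ≠ F'.2.1 ∧ x ∈ R.edgeInterior F' a' b'
    · obtain ⟨a', b', ha, hx'⟩ := hx'
      have h' := h.symm
      rw [neg_zero] at h'
      obtain ⟨a'', b'', ha'', hx'', -⟩ := h'.exists_edge ha hx'
      exact absurd ⟨a'', b'', ha'', hx''⟩ hx
    · push Not at hx hx'
      rw [edgeSum_eq_zero A hx, edgeSum_eq_zero A hx', add_zero]

open Classical in
/-- The jump at edges may be computed with all sides, because sides shared by two cells do not
contribute. -/
lemma edgeJump_eq_sum (A : Fin d → Fin d → ℝ) (x : Vec d) :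
    R.edgeJump A x = ∑ F : R.Side, edgeSum A F x := by
  have h1 : R.edgeJump A x = ∑ F : R.Side, if R.IsBoundaryPatch F then edgeSum A F x else 0 := by
    refine Finset.sum_congr rfl fun F _ => ?_
    by_cases hF : R.IsBoundaryPatch F
    · simp only [hF, if_true, true_and, edgeSum]
    · simp [hF]
  have h2 : ∑ F : R.Side, (if R.IsBoundaryPatch F then 0 else edgeSum A F x) = 0 := by
    let g : R.Side → R.Side := fun F => if h : ∃ F', R.Mate F F' 0 then h.choose else F
    have hg : ∀ {F F'}, R.Mate F F' 0 → g F = F' := by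
      intro F F' h
      have h' : ∃ F', R.Mate F F' 0 := ⟨F', h⟩
      simp only [g, dif_pos h']
      exact (h'.choose_spec.unique h).1
    refine Finset.sum_involution (fun F _ => if R.IsBoundaryPatch F then F else g F) ?_ ?_
      (fun _ _ => Finset.mem_univ _) ?_
    · intro F _
      by_cases hF : R.IsBoundaryPatch F
      · simp [hF]
      · obtain ⟨F', h⟩ := R.exists_mate_of_not_boundary hF
        have h' : R.Mate F' F 0 := by simpa using h.symm
        simp only [hF, if_false, hg h, R.not_isBoundaryPatch_of_mate h', h.edgeSum_add]
    · intro F _ hne heq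
      by_cases hF : R.IsBoundaryPatch F
      · simp [hF] at hne
      · obtain ⟨F', h⟩ := R.exists_mate_of_not_boundary hF
        simp only [hF, if_false, hg h] at heq
        exact h.ne heq.symm
    · intro F _
      by_cases hF : R.IsBoundaryPatch F
      · simp [hF]
      · obtain ⟨F', h⟩ := R.exists_mate_of_not_boundary hF
        have h' : R.Mate F' F 0 := by simpa using h.symm
        simp only [hF, if_false, hg h, R.not_isBoundaryPatch_of_mate h', hg h']
  have h3 : ∑ F : R.Side, edgeSum A F x
      = ∑ F : R.Side, ((if R.IsBoundaryPatch F then edgeSum A F x else 0)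
        + if R.IsBoundaryPatch F then 0 else edgeSum A F x) := by
    refine Finset.sum_congr rfl fun F _ => ?_
    split_ifs <;> simp
  rw [h1, h3, Finset.sum_add_distrib, h2, add_zero]

lemma edgeJump_eq_zero_of_notMem_box (A : Fin d → Fin d → ℝ) {x : Vec d} (hx : x ∉ R.box) :
    R.edgeJump A x = 0 := by
  rw [edgeJump_eq_sum]
  exact Finset.sum_eq_zero fun F _ => edgeSum_eq_zero A fun a' b' _ h =>
    hx (R.region_subset_box (edgeInterior_subset_region F a' b' h))

variable (R) in
/-- The balance of the jumps of `Q` at lattice-equivalent points of the edges. -/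
def EdgeBalance (Q : Fin d → Fin d → Vec d → ℝ) : Prop :=
  ∀ x : Vec d, (∀ ζ, 0 ≤ x ζ ∧ x ζ < R.L ζ) → ∑ κ : Fin d → Fin 2,
    R.edgeJump (fun j k => Q j k (latticeShift R.L (fun ζ => ((κ ζ : ℕ) : ℤ)) x))
      (latticeShift R.L (fun ζ => ((κ ζ : ℕ) : ℤ)) x) = 0

/-- Interior and boundary edges are merged into one condition over the half-open box. For an
interior point every nontrivial translate leaves the box, where the jump vanishes, and the sum
reduces to the point itself. -/
lemma edgeBalance_of {Q : Fin d → Fin d → Vec d → ℝ}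
    (hint : ∀ x ∈ interior R.box, R.edgeJump (fun j k => Q j k x) x = 0)
    (hfr : ∀ x ∈ frontier R.box, (∀ ζ, x ζ < R.L ζ) → ∑ κ : Fin d → Fin 2,
      R.edgeJump (fun j k => Q j k (latticeShift R.L (fun ζ => ((κ ζ : ℕ) : ℤ)) x))
        (latticeShift R.L (fun ζ => ((κ ζ : ℕ) : ℤ)) x) = 0) : R.EdgeBalance Q := by
  intro x hx
  by_cases h : x ∈ interior R.box
  · rw [Finset.sum_eq_single 0]
    · have : (fun ζ => (((0 : Fin d → Fin 2) ζ : ℕ) : ℤ)) = 0 := by funext ζ; simp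
      rw [this, latticeShift_zero]
      exact hint x h
    · intro κ _ hκ
      refine edgeJump_eq_zero_of_notMem_box _ fun hmem => ?_
      obtain ⟨ζ, hζ⟩ := Function.ne_iff.1 hκ
      have h1 : κ ζ = 1 := by
        have := (κ ζ).2
        apply Fin.ext
        have h0 : (κ ζ : ℕ) ≠ 0 := fun h => hζ (Fin.ext h)
        simp; omega
      have h2 := hmem.2 ζ
      have h3 := (R.mem_interior_box.1 h ζ).1
      simp [latticeShift, h1] at h2
      linarith
    · simp
  · refine hfr x ?_ fun ζ => (hx ζ).2
    refine R.mem_frontier_box.2 ⟨⟨fun ζ => (hx ζ).1, fun ζ => (hx ζ).2.le⟩, ?_⟩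
    rw [R.mem_interior_box, not_forall] at h
    obtain ⟨ζ, hζ⟩ := h
    refine ⟨ζ, Or.inl (le_antisymm (not_lt.1 fun h => hζ ⟨h, (hx ζ).2⟩) (hx ζ).1)⟩

end RVE

end Flexo
end

/-! ### Cancellation of the work on the edges over lattice classes. -/

noncomputable section
namespace Flexo

variable {n : ℕ}

namespace RVE

variable (R : RVE (n + 2))

/-- An edge of a side. -/
abbrev Flag := R.Side × Fin (n + 1) × Bool

variable {R}

/-- The relative interior of the edge of a flag. -/
def Flag.interior (Φ : R.Flag) : Set (Vec (n + 2)) :=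
  R.edgeInterior Φ.1 (Φ.1.2.1.succAbove Φ.2.1) Φ.2.2

/-- The parametrization of the edge of a flag. -/
def Flag.map (Φ : R.Flag) : Vec n → Vec (n + 2) :=
  edgeMap (R.chart Φ.1.1) Φ.1.2.1 Φ.1.2.2 Φ.2.1 Φ.2.2

/-- The virtual work of the edge forces exerted by the side of a flag. -/
def edgeWork (Q : Fin (n + 2) → Fin (n + 2) → Vec (n + 2) → ℝ) (v : Vec (n + 2) → ℝ) (Φ : R.Flag)
    (x : Vec (n + 2)) : ℝ :=
  (∑ j, ∑ k, Q j k x * R.conormal Φ.1 (Φ.1.2.1.succAbove Φ.2.1) Φ.2.2 j x * R.normal Φ.1 k x) * v x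

lemma Flag.interior_eq (Φ : R.Flag) : Φ.interior = Φ.map '' openCube n :=
  openFaceOf_edgeSpec_eq (R.cube_subset _) _ _ _ _

lemma Flag.interior_subset_region (Φ : R.Flag) : Φ.interior ⊆ R.region :=
  edgeInterior_subset_region _ _ _

open Classical in
lemma edgeJump_mul_eq_sum (Q : Fin (n + 2) → Fin (n + 2) → Vec (n + 2) → ℝ)
    (v : Vec (n + 2) → ℝ) (x : Vec (n + 2)) :
    R.edgeJump (fun j k => Q j k x) x * v x
      = ∑ Φ : R.Flag, if x ∈ Φ.interior then edgeWork Q v Φ x else 0 := by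
  rw [edgeJump_eq_sum, Finset.sum_mul]
  refine Eq.trans ?_ (Fintype.sum_prod_type _).symm
  refine Finset.sum_congr rfl fun F _ => ?_
  refine Eq.trans ?_ (Fintype.sum_prod_type _).symm
  rw [edgeSum, Fin.sum_univ_succAbove _ F.2.1]
  simp only [ne_eq, not_true_eq_false, false_and, if_false, Finset.sum_const_zero, zero_add,
    Finset.sum_mul]
  refine Finset.sum_congr rfl fun a₁ _ => Finset.sum_congr rfl fun b₁ _ => ?_
  simp only [Fin.succAbove_ne, not_false_eq_true, true_and, ite_mul, zero_mul]
  rfl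

/-- Edges that coincide up to a lattice translation. -/
def flagSetoid (R : RVE (n + 2)) : Setoid R.Flag where
  r Φ Φ' := ∃ κ, Φ.interior = latticeShift R.L κ '' Φ'.interior
  iseqv := by
    refine ⟨fun Φ => ⟨0, by rw [latticeShift_image_zero]⟩, ?_, ?_⟩
    · rintro Φ Φ' ⟨κ, h⟩
      exact ⟨-κ, by rw [h, latticeShift_image_image, neg_add_cancel, latticeShift_image_zero]⟩
    · rintro Φ Φ' Φ'' ⟨κ, h⟩ ⟨κ', h'⟩
      exact ⟨κ + κ', by rw [h, h', latticeShift_image_image]⟩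

open Classical in
/-- The translation between equivalent edges. -/
def flagShift (Φ Φ' : R.Flag) : Fin (n + 2) → ℤ :=
  if h : ∃ κ, Φ.interior = latticeShift R.L κ '' Φ'.interior then h.choose else 0

lemma flagShift_spec {Φ Φ' : R.Flag} (h : R.flagSetoid Φ Φ') :
    Φ.interior = latticeShift R.L (flagShift Φ Φ') '' Φ'.interior := by
  have h' : ∃ κ, Φ.interior = latticeShift R.L κ '' Φ'.interior := h
  rw [flagShift, dif_pos h']
  exact h'.choose_spec

lemma flagShift_eq {Φ Φ' : R.Flag} {κ : Fin (n + 2) → ℤ}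
    (h : Φ.interior = latticeShift R.L κ '' Φ'.interior) : flagShift Φ Φ' = κ :=
  R.openFaceOf_image_eq (flagShift_spec (Φ := Φ) (Φ' := Φ') ⟨κ, h⟩) h

/-- Conformity upgrades a single common point to coincidence of the whole open edges. -/
lemma Flag.interior_eq_of_mem {Φ Φ' : R.Flag} {κ : Fin (n + 2) → ℤ} {x : Vec (n + 2)}
    (h : x ∈ Φ.interior) (h' : latticeShift R.L (-κ) x ∈ Φ'.interior) :
    Φ.interior = latticeShift R.L κ '' Φ'.interior :=
  (R.conforming _ _ _ _ κ ⟨x, h, mem_latticeShift_image.2 h'⟩).1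

-- The flags equivalent to `Φ` are exactly those passing through one of the `2^d` translates of the
-- representative `x₀` of `x` in the half-open box, and each passes through exactly one of them. The
-- sum over the class is thus the sum of the jumps at these translates, times the common value of
-- `v`.
open Classical in
lemma EdgeBalance.sum_edgeWork {Q : Fin (n + 2) → Fin (n + 2) → Vec (n + 2) → ℝ}
    (hb : R.EdgeBalance Q) {v : Vec (n + 2) → ℝ} {m : ℕ} (hv : R.IsPeriodicField m v)
    (Φ : R.Flag) {x : Vec (n + 2)} (hx : x ∈ Φ.interior) :
    ∑ Φ' ∈ Finset.univ.filter (fun Φ' => R.flagSetoid Φ Φ'),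
      edgeWork Q v Φ' (latticeShift R.L (-flagShift Φ Φ') x) = 0 := by
  have hxr := Φ.interior_subset_region hx
  have hxb := R.region_subset_box hxr
  -- One period is subtracted in the directions in which `x` lies on the upper face, which moves it
  -- into the half-open box.
  set μ : Fin (n + 2) → ℤ := fun ζ => if x ζ < R.L ζ then 0 else 1 with hμ
  set x₀ := latticeShift R.L (-μ) x with hx₀
  have hx₀b : ∀ ζ, 0 ≤ x₀ ζ ∧ x₀ ζ < R.L ζ := by
    intro ζ
    have h1 := hxb.1 ζ
    have h2 := hxb.2 ζ
    simp only [hx₀, latticeShift, Pi.neg_apply, hμ, Pi.zero_apply] at h1 ⊢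
    split_ifs with h
    · simpa using ⟨h1, h⟩
    · push_cast
      have := R.L_pos ζ
      constructor <;> linarith
  have hbal := hb x₀ hx₀b
  set y : (Fin (n + 2) → Fin 2) → Vec (n + 2) := fun κ =>
    latticeShift R.L (fun ζ => ((κ ζ : ℕ) : ℤ)) x₀ with hy
  have hyx : ∀ κ, y κ = latticeShift R.L (-(μ - fun ζ => ((κ ζ : ℕ) : ℤ))) x := by
    intro κ
    rw [hy, hx₀]
    simp only [latticeShift_latticeShift]
    congr 1; abel
  have hvy : ∀ κ (Φ' : R.Flag), y κ ∈ Φ'.interior → v (y κ) = v x := by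
    intro κ Φ' h
    have := Φ'.interior_subset_region h
    rw [hyx] at this ⊢
    exact hv.periodic x hxr _ this
  have h1 : ∑ κ, R.edgeJump (fun j k => Q j k (y κ)) (y κ) * v x = 0 := by
    rw [← Finset.sum_mul, hbal, zero_mul]
  have h2 : ∀ κ, R.edgeJump (fun j k => Q j k (y κ)) (y κ) * v x
      = ∑ Φ' : R.Flag, if y κ ∈ Φ'.interior then edgeWork Q v Φ' (y κ) else 0 := by
    intro κ
    rw [← edgeJump_mul_eq_sum]
    by_cases h : ∃ Φ' : R.Flag, y κ ∈ Φ'.interior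
    · obtain ⟨Φ', h⟩ := h
      rw [hvy κ Φ' h]
    -- With no edge through the translate, it may lie outside the region, where periodicity says
    -- nothing about `v`. Testing with the constant 1 shows that the jump is zero there, so the
    -- value of `v` is irrelevant.
    · have h3 := edgeJump_mul_eq_sum (R := R) Q (fun _ => 1) (y κ)
      rw [Finset.sum_eq_zero fun Φ' _ => if_neg fun h' => h ⟨Φ', h'⟩, mul_one] at h3
      rw [h3, zero_mul, zero_mul]
  simp only [h2] at h1
  rw [Finset.sum_comm] at h1
  rw [Finset.sum_filter]
  refine Eq.trans ?_ h1
  refine Finset.sum_congr rfl fun Φ' _ => ?_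
  split_ifs with h
  · set κ' := flagShift Φ Φ' with hκ'
    have hmem : latticeShift R.L (-κ') x ∈ Φ'.interior := by
      rw [← mem_latticeShift_image, ← flagShift_spec h]; exact hx
    have hbox := R.region_subset_box (Φ'.interior_subset_region hmem)
    have hxx : latticeShift R.L (-κ') x = latticeShift R.L (μ - κ') x₀ := by
      rw [hx₀, latticeShift_latticeShift]; congr 1; abel
    -- Both points are in the box and `x₀` is strictly below the upper faces, so no coordinate can
    -- shift downward or by two periods.
    have h01 : ∀ ζ, μ ζ - κ' ζ = 0 ∨ μ ζ - κ' ζ = 1 := by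
      intro ζ
      have a1 := hbox.1 ζ
      have a2 := hbox.2 ζ
      have a3 := hx₀b ζ
      have a4 := R.L_pos ζ
      rw [hxx] at a1 a2
      simp only [latticeShift, Pi.sub_apply, Pi.zero_apply] at a1 a2
      have h3 : (-1 : ℝ) < ((μ ζ - κ' ζ : ℤ) : ℝ) := by by_contra! hlt; nlinarith
      have h4 : ((μ ζ - κ' ζ : ℤ) : ℝ) < 2 := by by_contra! hlt; nlinarith
      have h3' : -1 < μ ζ - κ' ζ := by exact_mod_cast h3
      have h4' : μ ζ - κ' ζ < 2 := by exact_mod_cast h4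
      omega
    set κ₀ : Fin (n + 2) → Fin 2 := fun ζ => if μ ζ - κ' ζ = 0 then 0 else 1 with hκ₀
    have hκ₀' : (fun ζ => ((κ₀ ζ : ℕ) : ℤ)) = μ - κ' := by
      funext ζ
      rcases h01 ζ with h | h <;> simp [hκ₀, h]
    have hyκ₀ : y κ₀ = latticeShift R.L (-κ') x := by
      rw [hy, hxx]; simp only [hκ₀']
    rw [Finset.sum_eq_single κ₀, if_pos (by rw [hyκ₀]; exact hmem), hyκ₀]
    -- The translation between two equivalent edges is unique, so no second translate of `x₀` can
    -- lie on the same edge.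
    · intro κ _ hκ
      refine if_neg fun hm => hκ ?_
      rw [hyx] at hm
      have h3 : κ' = _ := flagShift_eq (Flag.interior_eq_of_mem hx hm)
      have h4 : (fun ζ => ((κ₀ ζ : ℕ) : ℤ)) = fun ζ => ((κ ζ : ℕ) : ℤ) := by
        rw [hκ₀', h3]; abel
      funext ζ
      have := congrFun h4 ζ
      exact Fin.ext (by exact_mod_cast this.symm)
    · simp
  · symm
    refine Finset.sum_eq_zero fun κ _ => if_neg fun hm => h ?_
    rw [hyx] at hm
    exact ⟨_, Flag.interior_eq_of_mem hx hm⟩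

section Reparam

variable {Φ Φ' : R.Flag}

lemma Flag.mem_target (Φ : R.Flag) {w : Vec n} (hw : w ∈ openCube n) :
    ins Φ.1.2.1 (sideVal Φ.1.2.2) (ins Φ.2.1 (sideVal Φ.2.2) w) ∈ (R.chart Φ.1.1).target :=
  R.cube_subset _ (ins_mem_Icc _ (sideVal_mem _) (ins_mem_Icc _ (sideVal_mem _)
    (openCube_subset_Icc _ hw)))

lemma Flag.map_mem_source (Φ : R.Flag) {w : Vec n} (hw : w ∈ openCube n) :
    Φ.map w ∈ (R.chart Φ.1.1).source := (R.chart Φ.1.1).map_target (Φ.mem_target hw)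

lemma Flag.differentiableOn_map (Φ : R.Flag) : DifferentiableOn ℝ Φ.map (openCube n) :=
  fun w hw => (((R.isC2Chart Φ.1.1).symm_differentiableAt (Φ.mem_target hw)).comp w
      (((contDiff_ins _ _).differentiable (by norm_num) _).comp w
        ((contDiff_ins _ _).differentiable (by norm_num) w))).differentiableWithinAt

/-- The coordinates on the edge of a flag. -/
def Flag.coord (Φ : R.Flag) (x : Vec (n + 2)) : Vec n :=
  fun i => R.chart Φ.1.1 x (Φ.1.2.1.succAbove (Φ.2.1.succAbove i))

lemma Flag.coord_map (Φ : R.Flag) {w : Vec n} (hw : w ∈ openCube n) : Φ.coord (Φ.map w) = w := by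
  funext i
  simp only [Flag.coord, Flag.map, edgeMap, faceMap, (R.chart Φ.1.1).right_inv (Φ.mem_target hw),
    ins_succAbove]

lemma Flag.differentiableAt_coord (Φ : R.Flag) {w : Vec n} (hw : w ∈ openCube n) :
    DifferentiableAt ℝ Φ.coord (Φ.map w) :=
  differentiableAt_pi.2 fun _ => differentiableAt_pi.1
      ((R.isC2Chart Φ.1.1).differentiableAt (Φ.map_mem_source hw)) _

lemma setIntegral_flag (h : R.flagSetoid Φ Φ') (g : Vec (n + 2) → ℝ) :
    ∫ w in openCube n, g (Φ'.map w) * areaDensity Φ'.map w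
      = ∫ w in openCube n, g (latticeShift R.L (-flagShift Φ Φ') (Φ.map w)) *
        areaDensity Φ.map w :=
  setIntegral_param_eq Φ.differentiableOn_map Φ'.differentiableOn_map (fun _ => Φ.coord_map)
    (fun _ => Φ'.coord_map) (fun _ => Φ'.differentiableAt_coord)
    (by rw [← Flag.interior_eq, ← Flag.interior_eq]; exact flagShift_spec h) g

lemma integrableOn_flag (h : R.flagSetoid Φ Φ') (g : Vec (n + 2) → ℝ)
    (hg : IntegrableOn (fun w => g (Φ'.map w) * areaDensity Φ'.map w) (openCube n)) :
    IntegrableOn (fun w => g (latticeShift R.L (-flagShift Φ Φ') (Φ.map w)) *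
        areaDensity Φ.map w) (openCube n) :=
  integrableOn_param Φ.differentiableOn_map Φ'.differentiableOn_map (fun _ => Φ.coord_map)
    (fun _ => Φ'.coord_map) (fun _ => Φ'.differentiableAt_coord)
    (by rw [← Flag.interior_eq, ← Flag.interior_eq]; exact flagShift_spec h) g hg

end Reparam

lemma integrableOn_edgeWork {Q : Fin (n + 2) → Fin (n + 2) → Vec (n + 2) → ℝ}
    {v : Vec (n + 2) → ℝ} {U : Set (Vec (n + 2))} (hU : R.region ⊆ U)
    (hQ : ∀ j k, ContinuousOn (Q j k) U) (hv : ContinuousOn v U) (Φ : R.Flag) :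
    IntegrableOn (fun w => edgeWork Q v Φ (Φ.map w) * areaDensity Φ.map w) (openCube n) := by
  have he := R.isC2Chart Φ.1.1
  refine he.integrableOn_edgeMap (R.cube_subset _) (U := U) ?_ ?_ _ _ _ _
  · rw [← cellOf_eq (R.cube_subset _)]
    exact (R.cellOf_subset_region _).trans hU
  · refine ContinuousOn.mul (continuousOn_finsetSum _ fun j _ => continuousOn_finsetSum _ fun k _ =>
      (((hQ j k).mono inter_subset_left).mul ?_).mul ?_) (hv.mono inter_subset_left)
    · exact (he.contDiffOn_unitConormal (Fin.succAbove_ne _ _) _ _ j).continuousOn.mono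
        inter_subset_right
    · exact (he.contDiffOn_unitNormal _ _ k).continuousOn.mono inter_subset_right

open Classical in
/-- The total virtual work of the edge forces vanishes. -/
lemma EdgeBalance.sum_integral_edgeWork {Q : Fin (n + 2) → Fin (n + 2) → Vec (n + 2) → ℝ}
    (hb : R.EdgeBalance Q) {v : Vec (n + 2) → ℝ} {m : ℕ} (hv : R.IsPeriodicField m v)
    {U : Set (Vec (n + 2))} (hU : R.region ⊆ U)
    (hQ : ∀ j k, ContinuousOn (Q j k) U) (hvc : ContinuousOn v U) :
    ∑ Φ : R.Flag, ∫ w in openCube n, edgeWork Q v Φ (Φ.map w) * areaDensity Φ.map w = 0 := by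
  -- Within a class all integrals are pulled back to the parameters of one flag, where the
  -- integrands cancel pointwise.
  refine Finset.sum_cancels_of_partition_cancels R.flagSetoid fun Φ _ => ?_
  have h1 : ∀ Φ' ∈ Finset.univ.filter (fun Φ' => R.flagSetoid Φ Φ'),
      ∫ w in openCube n, edgeWork Q v Φ' (Φ'.map w) * areaDensity Φ'.map w
        = ∫ w in openCube n, edgeWork Q v Φ' (latticeShift R.L (-flagShift Φ Φ') (Φ.map w)) *
        areaDensity Φ.map w := fun Φ' h => setIntegral_flag (Finset.mem_filter.1 h).2 _
  have h2 : Finset.univ.filter (fun Φ' => R.flagSetoid Φ' Φ)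
      = Finset.univ.filter (fun Φ' => R.flagSetoid Φ Φ') := by
    ext Φ'
    simp only [Finset.mem_filter, Finset.mem_univ, true_and]
    exact ⟨R.flagSetoid.symm', R.flagSetoid.symm'⟩
  have h3 : ∑ Φ' ∈ Finset.univ.filter (fun Φ' => R.flagSetoid Φ Φ'),
      ∫ w in openCube n, edgeWork Q v Φ' (Φ'.map w) * areaDensity Φ'.map w = 0 := by
    rw [Finset.sum_congr rfl h1, ← integral_finsetSum _ fun Φ' h =>
      integrableOn_flag (Finset.mem_filter.1 h).2 _ (integrableOn_edgeWork hU hQ hvc Φ')]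
    refine setIntegral_eq_zero_of_forall_eq_zero fun w hw => ?_
    rw [← Finset.sum_mul, hb.sum_edgeWork hv Φ (by rw [Flag.interior_eq]; exact mem_image_of_mem _ hw),
      zero_mul]
  rw [← h3]
  exact Finset.sum_congr h2 fun _ _ => rfl

end RVE

end Flexo
end

/-! ### Decomposition of the domain into cells and virtual work of smooth periodic fields. -/

noncomputable section
namespace Flexo

variable {d n : ℕ}

namespace RVE

section Domain

variable (R : RVE d)

lemma isOpen_periodicStructure : IsOpen R.periodicStructure := isOpen_interior

lemma measurableSet_domain : MeasurableSet R.domain :=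
  R.isOpen_periodicStructure.measurableSet.inter measurableSet_Icc

lemma openCell_subset_domain (c : Fin R.N) :
    openFaceOf (R.chart c) (fun _ => none) ⊆ R.domain := fun _ hx =>
  ⟨R.openCell_subset_periodicStructure c hx, R.cell_subset c (openFaceOf_subset_cellOf _ hx)⟩

/-- In the open box only the untranslated copy of the region is present. A point of the domain on a
face of the box is a limit of points of the structure in the open box, and the region is closed. -/
lemma domain_subset_region : R.domain ⊆ R.region := by
  rintro x ⟨hx, hxb⟩
  have hcl : x ∈ closure (interior R.box) := by
    have : R.box = univ.pi fun i => Icc 0 (R.L i) := by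
      rw [box, ← pi_univ_Icc]; rfl
    rw [this, interior_pi_set finite_univ, closure_pi_set]
    intro i _
    change x i ∈ closure (interior (Icc 0 (R.L i)))
    rw [interior_Icc, closure_Ioo (R.L_pos i).ne]
    exact ⟨hxb.1 i, hxb.2 i⟩
  rw [← R.isCompact_region.isClosed.closure_eq]
  refine closure_mono ?_ (R.isOpen_periodicStructure.inter_closure ⟨hx, hcl⟩)
  rintro y ⟨hy, hyb⟩
  obtain ⟨k, hk⟩ := mem_iUnion.1 (interior_subset hy)
  rw [mem_latticeShift_image] at hk
  have hz := R.region_subset_box hk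
  rw [R.mem_interior_box] at hyb
  have hk0 : k = 0 := by
    funext i
    have h1 := hz.1 i
    have h2 := hz.2 i
    have h3 := hyb i
    have h4 := R.L_pos i
    simp only [latticeShift, Pi.neg_apply, Pi.zero_apply, Int.cast_neg] at h1 h2
    have h5 : (-1 : ℝ) < k i := by by_contra! h; nlinarith
    have h6 : (k i : ℝ) < 1 := by by_contra! h; nlinarith
    have h5' : -1 < k i := by exact_mod_cast h5
    have h6' : k i < 1 := by exact_mod_cast h6
    simp; omega
  rwa [hk0, neg_zero, latticeShift_zero] at hk

/-- The boundary of the cell is the image of the null boundary of the cube under a differentiable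
map. -/
lemma openCell_ae_eq_cell (c : Fin R.N) :
    openFaceOf (R.chart c) (fun _ => none) =ᵐ[volume] cellOf (R.chart c) := by
  refine (openFaceOf_subset_cellOf _).eventuallyLE.antisymm ?_
  rw [ae_le_set, cellOf_eq (R.cube_subset c), openFaceOf_none (R.cube_subset c)]
  refine measure_mono_null (t := (R.chart c).symm '' (Icc 0 1 \ openCube d)) ?_ ?_
  · rintro _ ⟨⟨z, hz, rfl⟩, h⟩
    exact ⟨z, ⟨hz, fun h' => h ⟨z, h', rfl⟩⟩, rfl⟩
  · refine addHaar_image_eq_zero_of_differentiableOn_of_addHaar_eq_zero volume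
      (fun z hz => ((R.isC2Chart c).symm_differentiableAt
        (R.cube_subset c hz.1)).differentiableWithinAt) ?_
    exact ae_le_set.1 (openCube_ae_eq_Icc d).symm.le

lemma iUnion_openCell_ae_eq_domain :
    (⋃ c, openFaceOf (R.chart c) fun _ => none) =ᵐ[volume] R.domain :=
  (iUnion_subset R.openCell_subset_domain).eventuallyLE.antisymm
    (R.domain_subset_region.eventuallyLE.trans
      (Filter.EventuallyEq.countable_iUnion R.openCell_ae_eq_cell).symm.le)

lemma pairwise_disjoint_openCell :
    Pairwise (Function.onFun Disjoint fun c => openFaceOf (R.chart c) fun _ => none) := by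
  intro c c' hcc
  rw [Function.onFun, ← not_not (a := Disjoint _ _), not_disjoint_iff_nonempty_inter]
  intro h
  refine hcc (R.nonoverlapping c c' 0 ?_).1
  rwa [latticeShift_image_zero]

lemma setIntegral_domain {f : Vec d → ℝ} (hf : IntegrableOn f R.domain) :
    ∫ x in R.domain, f x = ∑ c, ∫ x in openFaceOf (R.chart c) (fun _ => none), f x := by
  rw [← setIntegral_congr_set R.iUnion_openCell_ae_eq_domain]
  exact integral_iUnion_fintype (fun c => (R.isOpen_openCell c).measurableSet)
    R.pairwise_disjoint_openCell fun c => hf.mono_set (R.openCell_subset_domain c)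

lemma integrableOn_domain {f : Vec d → ℝ} {U : Set (Vec d)} (hU : R.region ⊆ U)
    (hf : ContinuousOn f U) : IntegrableOn f R.domain :=
  ((hf.mono hU).integrableOn_compact R.isCompact_region).mono_set R.domain_subset_region

end Domain

variable {R : RVE (n + 2)}

/-- The principle of virtual work for a scalar field. -/
theorem integral_virtualWork_eq_zero {U : Set (Vec (n + 2))} (hU : IsOpen U) (hRU : R.region ⊆ U)
    {S : Fin (n + 2) → Vec (n + 2) → ℝ} {Q : Fin (n + 2) → Fin (n + 2) → Vec (n + 2) → ℝ}
    (hS : ∀ j, ContDiffOn ℝ 1 (S j) U) (hQ : ∀ j k, ContDiffOn ℝ 2 (Q j k) U)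
    (hdiv : ∀ x ∈ R.domain, ∑ j, pd j (fun y => S j y - ∑ k, pd k (Q j k) y) x = 0)
    (hF : R.FaceBalance (fun j y => S j y - ∑ k, pd k (Q j k) y) Q) (hE : R.EdgeBalance Q)
    {v : Vec (n + 2) → ℝ} (hv : R.IsPeriodicField 2 v) :
    ∫ x in R.domain, (∑ j, S j x * pd j v x + ∑ j, ∑ k, Q j k x * pd k (pd j v) x) = 0 := by
  obtain ⟨W, hW, hRW, hvW⟩ := hv.smooth
  have hvW' : ContDiffOn ℝ 2 v W := hvW
  have hUW := hU.inter hW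
  have hS' : ∀ j, ContDiffOn ℝ 1 (S j) (U ∩ W) := fun j => (hS j).mono inter_subset_left
  have hQ' : ∀ j k, ContDiffOn ℝ 2 (Q j k) (U ∩ W) := fun j k => (hQ j k).mono inter_subset_left
  have hv' : ContDiffOn ℝ 2 v (U ∩ W) := hvW'.mono inter_subset_right
  have hR : R.region ⊆ U ∩ W := subset_inter hRU hRW
  have hpv : ∀ j, ContDiffOn ℝ 1 (pd j v) (U ∩ W) := fun j =>
    contDiffOn_pd (n := 2) (m := 1) hUW le_rfl hv' j
  rw [R.setIntegral_domain (R.integrableOn_domain hR ?_)]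
  · have hcell : ∀ c, (R.chart c).symm '' Icc 0 1 ⊆ U ∩ W := fun c => by
      rw [← cellOf_eq (R.cube_subset c)]; exact (R.cellOf_subset_region c).trans hR
    have h1 := fun c => (R.isC2Chart c).integral_secondGradient (R.cube_subset c) hUW (hcell c)
      hS' hQ' hv' fun x hx => hdiv x (R.openCell_subset_domain c
        (by rwa [openFaceOf_none (R.cube_subset c)]))
    simp only [openFaceOf_none (R.cube_subset _), h1, Finset.sum_add_distrib]
    have h2 := hF.sum_integral_faceWork hv fun x hx j k =>
      ((hQ' j k).differentiableOn (by norm_num)).differentiableAt (hUW.mem_nhds (hR hx))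
    have h3 := hE.sum_integral_edgeWork hv hR (fun j k => (hQ' j k).continuousOn) hv'.continuousOn
    simp only [Fintype.sum_prod_type] at h2 h3
    rw [← add_zero (0 : ℝ)]
    exact congrArg₂ (· + ·) h2 h3
  · refine ContinuousOn.add (continuousOn_finsetSum _ fun j _ =>
      (hS' j).continuousOn.mul (hpv j).continuousOn) (continuousOn_finsetSum _ fun j _ =>
        continuousOn_finsetSum _ fun k _ => (hQ' j k).continuousOn.mul
          (continuousOn_pd hUW (hpv j) k))

end RVE

end Flexo
end

noncomputable section
namespace Flexo

variable {d n : ℕ}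

/-! ### The enthalpy along a variation -/

/-- Taking `α` and `β` to be products of index sets makes every term of the enthalpy an instance of
this expansion or of its symmetric form. -/
lemma sum_perturb {α β : Type*} [Fintype α] [Fintype β] (A : α → β → ℝ) (x x' : α → ℝ)
    (y y' : β → ℝ) (τ : ℝ) :
    ∑ a, ∑ b, (x a + τ * x' a) * A a b * (y b + τ * y' b)
      = ∑ a, ∑ b, x a * A a b * y b
        + τ * (∑ a, (∑ b, A a b * y b) * x' a + ∑ b, (∑ a, A a b * x a) * y' b)
        + τ ^ 2 * ∑ a, ∑ b, x' a * A a b * y' b := by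
  simp only [Finset.sum_mul]
  rw [Finset.sum_comm (f := fun b a => A a b * x a * y' b)]
  simp only [Finset.mul_sum, ← Finset.sum_add_distrib]
  exact Finset.sum_congr rfl fun _ _ => Finset.sum_congr rfl fun _ _ => by ring

lemma sum_perturb_symm {α : Type*} [Fintype α] {A : α → α → ℝ} (hA : ∀ a b, A a b = A b a)
    (x x' : α → ℝ) (τ : ℝ) :
    ∑ a, ∑ b, (x a + τ * x' a) * A a b * (x b + τ * x' b)
      = ∑ a, ∑ b, x a * A a b * x b + τ * (2 * ∑ a, (∑ b, A a b * x b) * x' a)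
        + τ ^ 2 * ∑ a, ∑ b, x' a * A a b * x' b := by
  rw [sum_perturb, Finset.sum_congr rfl fun b _ => congrArg (· * x' b)
    (Finset.sum_congr rfl fun a _ => congrArg (· * x a) (hA a b))]
  ring

namespace Material

variable (mat : Material d)

lemma cauchy_symm (q : Kin d) (i j : Fin d) : mat.cauchy q i j = mat.cauchy q j i := by
  simp only [cauchy, mat.C_minor i j, mat.e_symm _ i j, mat.μ_symm _ i j]

lemma doubleStress_symm (q : Kin d) (i j k : Fin d) :
    mat.doubleStress q i j k = mat.doubleStress q j i k := by
  simp only [doubleStress, mat.h_minor i j, mat.μ_symm _ i j]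

lemma virtualWork_eq (q δq : Kin d) :
    mat.virtualWork q δq
      = (∑ i, ∑ j, (∑ k, ∑ l, mat.C i j k l * q.ε k l) * δq.ε i j)
        - (∑ i, ∑ j, (∑ l, mat.e l i j * q.E l) * δq.ε i j)
        + (1 / 2) * (∑ i, ∑ j, (∑ l, ∑ k, mat.μ l i j k * q.dE l k) * δq.ε i j)
        - (∑ l, (∑ m, mat.κ l m * q.E m) * δq.E l)
        - (∑ l, (∑ i, ∑ j, mat.e l i j * q.ε i j) * δq.E l)
        - (1 / 2) * (∑ l, (∑ i, ∑ j, ∑ k, mat.μ l i j k * q.dε i j k) * δq.E l)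
        + (∑ i, ∑ j, ∑ k, (∑ l, ∑ m, ∑ n, mat.h i j k l m n * q.dε l m n) * δq.dε i j k)
        - (1 / 2) * (∑ i, ∑ j, ∑ k, (∑ l, mat.μ l i j k * q.E l) * δq.dε i j k)
        - (∑ l, ∑ k, (∑ m, ∑ n, mat.M m n l k * q.dE m n) * δq.dE l k)
        + (1 / 2) * (∑ l, ∑ k, (∑ i, ∑ j, mat.μ l i j k * q.ε i j) * δq.dE l k) := by
  simp only [virtualWork, cauchy, localD, doubleStress, doubleD, sub_mul, add_mul,
    Finset.sum_add_distrib, Finset.sum_sub_distrib, mul_assoc (1 / 2 : ℝ),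
    ← Finset.mul_sum _ _ (1 / 2 : ℝ)]
  ring

/-- The enthalpy is quadratic, with the virtual work as its polarization. -/
lemma enthalpy_perturb (q δq : Kin d) (τ : ℝ) :
    mat.enthalpy (q.perturb τ δq)
      = mat.enthalpy q + τ * mat.virtualWork q δq + τ ^ 2 * mat.enthalpy δq := by
  have hC := sum_perturb_symm (A := fun a b : Fin d × Fin d => mat.C a.1 a.2 b.1 b.2)
    (fun a b => mat.C_major _ _ _ _) (fun a => q.ε a.1 a.2) (fun a => δq.ε a.1 a.2) τ
  have hh := sum_perturb_symm
    (A := fun a b : Fin d × Fin d × Fin d => mat.h a.1 a.2.1 a.2.2 b.1 b.2.1 b.2.2)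
    (fun a b => mat.h_major _ _ _ _ _ _) (fun a => q.dε a.1 a.2.1 a.2.2)
    (fun a => δq.dε a.1 a.2.1 a.2.2) τ
  have hκ := sum_perturb_symm (A := mat.κ) mat.κ_symm q.E δq.E τ
  have hM := sum_perturb_symm (A := fun a b : Fin d × Fin d => mat.M a.1 a.2 b.1 b.2)
    (fun a b => mat.M_major _ _ _ _) (fun a => q.dE a.1 a.2) (fun a => δq.dE a.1 a.2) τ
  have he := sum_perturb (fun (l : Fin d) (b : Fin d × Fin d) => mat.e l b.1 b.2) q.E δq.E
    (fun b => q.ε b.1 b.2) (fun b => δq.ε b.1 b.2) τ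
  have hμ := sum_perturb (fun (l : Fin d) (b : Fin d × Fin d × Fin d) => mat.μ l b.1 b.2.1 b.2.2)
    q.E δq.E (fun b => q.dε b.1 b.2.1 b.2.2) (fun b => δq.dε b.1 b.2.1 b.2.2) τ
  have hμ' := sum_perturb (fun (a b : Fin d × Fin d) => mat.μ a.1 b.1 b.2 a.2)
    (fun a => q.dE a.1 a.2) (fun a => δq.dE a.1 a.2) (fun b => q.ε b.1 b.2)
    (fun b => δq.ε b.1 b.2) τ
  -- The bilinear expansion groups `(l,k)` against `(i,j)`, whereas the enthalpy sums in the order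
  -- `l, i, j, k`.
  have hr : ∀ (x y : Fin d → Fin d → ℝ), ∑ l, ∑ k, ∑ i, ∑ j, x l k * mat.μ l i j k * y i j
      = ∑ l, ∑ i, ∑ j, ∑ k, x l k * mat.μ l i j k * y i j := fun x y =>
    Finset.sum_congr rfl fun l _ => Finset.sum_comm.trans
      (Finset.sum_congr rfl fun i _ => Finset.sum_comm)
  have hr₁ := hr (fun l k => q.dE l k + τ * δq.dE l k) (fun i j => q.ε i j + τ * δq.ε i j)
  have hr₂ := hr q.dE q.ε
  have hr₃ := hr δq.dE δq.ε
  have hM' : ∑ l, ∑ k, (∑ m, ∑ n, mat.M m n l k * q.dE m n) * δq.dE l k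
      = ∑ l, ∑ k, (∑ m, ∑ n, mat.M l k m n * q.dE m n) * δq.dE l k := by
    simp only [fun m n l k => mat.M_major m n l k]
  simp only [Fintype.sum_prod_type] at hC hh hκ hM he hμ hμ'
  rw [virtualWork_eq]
  simp only [enthalpy, Kin.perturb]
  linear_combination (1 / 2) * hC + (1 / 2) * hh - (1 / 2) * hκ - (1 / 2) * hM - he - (1 / 2) * hμ
    + (1 / 2) * (hμ' - hr₁ + hr₂ + τ ^ 2 * hr₃) + τ * hM'

end Material

end Flexo
end

noncomputable section
namespace Flexo

variable {d n : ℕ}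

/-! ### Square integrability -/

/-- By Hölder's inequality, multiplication by a fixed `L²` function is continuous from `L²` to `L¹`.
-/
lemma tendsto_integral_mul {α : Type*} [MeasurableSpace α] {μ : Measure α} {a g : α → ℝ}
    {f : ℕ → α → ℝ} (ha : MemLp a 2 μ) (hf : ∀ m, MemLp (f m) 2 μ) (hg : MemLp g 2 μ)
    (h : Tendsto (fun m => eLpNorm (f m - g) 2 μ) atTop (𝓝 0)) :
    Tendsto (fun m => ∫ x, a x * f m x ∂μ) atTop (𝓝 (∫ x, a x * g x ∂μ)) := by
  refine tendsto_integral_of_L1' (fun x => a x * g x)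
    (ha.integrable_mul hg).aestronglyMeasurable (Eventually.of_forall fun m => ha.integrable_mul (hf m)) ?_
  have hle : ∀ m, eLpNorm ((fun x => a x * f m x) - fun x => a x * g x) 1 μ
      ≤ eLpNorm a 2 μ * eLpNorm (f m - g) 2 μ := by
    intro m
    have := eLpNorm_smul_le_mul_eLpNorm (p := 2) (q := 2) (r := 1)
      ((hf m).sub hg).aestronglyMeasurable ha.aestronglyMeasurable
    refine le_trans (le_of_eq ?_) this
    congr 1
    funext x
    simp [mul_sub]
  refine tendsto_of_tendsto_of_tendsto_of_le_of_le tendsto_const_nhds ?_ (fun _ => zero_le) hle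
  simpa using ENNReal.Tendsto.const_mul h (Or.inr ha.eLpNorm_ne_top)

/-- Square integrability of all components of a kinematic field. -/
structure KinMemLp (q : Vec d → Kin d) (μ : Measure (Vec d)) : Prop where
  ε : ∀ i j, MemLp (fun x => (q x).ε i j) 2 μ
  dε : ∀ i j k, MemLp (fun x => (q x).dε i j k) 2 μ
  E : ∀ l, MemLp (fun x => (q x).E l) 2 μ
  dE : ∀ l k, MemLp (fun x => (q x).dE l k) 2 μ

namespace KinMemLp

variable {q δq : Vec d → Kin d} {μ : Measure (Vec d)} (mat : Material d)

lemma cauchy (h : KinMemLp q μ) (i j : Fin d) : MemLp (fun x => mat.cauchy (q x) i j) 2 μ :=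
  ((memLp_finsetSum _ fun k _ => memLp_finsetSum _ fun l _ => (h.ε k l).const_mul _).sub
    (memLp_finsetSum _ fun l _ => (h.E l).const_mul _)).add
    ((memLp_finsetSum _ fun l _ => memLp_finsetSum _ fun k _ => (h.dE l k).const_mul _).const_mul _)

lemma doubleStress (h : KinMemLp q μ) (i j k : Fin d) :
    MemLp (fun x => mat.doubleStress (q x) i j k) 2 μ :=
  (memLp_finsetSum _ fun l _ => memLp_finsetSum _ fun m _ => memLp_finsetSum _ fun n _ =>
    (h.dε l m n).const_mul _).sub
    ((memLp_finsetSum _ fun l _ => (h.E l).const_mul _).const_mul _)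

lemma localD (h : KinMemLp q μ) (l : Fin d) : MemLp (fun x => mat.localD (q x) l) 2 μ :=
  ((memLp_finsetSum _ fun m _ => (h.E m).const_mul _).add
    (memLp_finsetSum _ fun i _ => memLp_finsetSum _ fun j _ => (h.ε i j).const_mul _)).add
    ((memLp_finsetSum _ fun i _ => memLp_finsetSum _ fun j _ => memLp_finsetSum _ fun k _ =>
      (h.dε i j k).const_mul _).const_mul _)

lemma doubleD (h : KinMemLp q μ) (l k : Fin d) : MemLp (fun x => mat.doubleD (q x) l k) 2 μ :=
  (memLp_finsetSum _ fun m _ => memLp_finsetSum _ fun n _ => (h.dE m n).const_mul _).sub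
    ((memLp_finsetSum _ fun i _ => memLp_finsetSum _ fun j _ => (h.ε i j).const_mul _).const_mul _)

lemma virtualWork (h : KinMemLp q μ) (h' : KinMemLp δq μ) :
    Integrable (fun x => mat.virtualWork (q x) (δq x)) μ :=
  (((integrable_finsetSum _ fun i _ => integrable_finsetSum _ fun j _ =>
      (h.cauchy mat i j).integrable_mul (h'.ε i j)).sub
    (integrable_finsetSum _ fun l _ => (h.localD mat l).integrable_mul (h'.E l))).add
    (integrable_finsetSum _ fun i _ => integrable_finsetSum _ fun j _ =>
      integrable_finsetSum _ fun k _ =>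
      (h.doubleStress mat i j k).integrable_mul (h'.dε i j k))).sub
    (integrable_finsetSum _ fun l _ => integrable_finsetSum _ fun m _ =>
      (h.doubleD mat l m).integrable_mul (h'.dE l m))

lemma enthalpy (h : KinMemLp q μ) : Integrable (fun x => mat.enthalpy (q x)) μ := by
  have hm : ∀ {f g : Vec d → ℝ} (c : ℝ), MemLp f 2 μ → MemLp g 2 μ →
      Integrable (fun x => f x * c * g x) μ := fun c hf hg => (hf.mul_const c).integrable_mul hg
  unfold Material.enthalpy
  refine (((((Integrable.sub (Integrable.sub (Integrable.add ?_ ?_) ?_) ?_).sub ?_).sub ?_).add ?_))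
  · exact (integrable_finsetSum _ fun i _ => integrable_finsetSum _ fun j _ =>
      integrable_finsetSum _ fun k _ => integrable_finsetSum _ fun l _ =>
      hm _ (h.ε i j) (h.ε k l)).const_mul _
  · exact (integrable_finsetSum _ fun i _ => integrable_finsetSum _ fun j _ =>
      integrable_finsetSum _ fun k _ => integrable_finsetSum _ fun l _ =>
      integrable_finsetSum _ fun m _ => integrable_finsetSum _ fun n _ =>
      hm _ (h.dε i j k) (h.dε l m n)).const_mul _
  · exact (integrable_finsetSum _ fun l _ => integrable_finsetSum _ fun m _ =>
      hm _ (h.E l) (h.E m)).const_mul _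
  · exact (integrable_finsetSum _ fun m _ => integrable_finsetSum _ fun n _ =>
      integrable_finsetSum _ fun l _ => integrable_finsetSum _ fun k _ =>
      hm _ (h.dE m n) (h.dE l k)).const_mul _
  · exact integrable_finsetSum _ fun l _ => integrable_finsetSum _ fun i _ =>
      integrable_finsetSum _ fun j _ => hm _ (h.E l) (h.ε i j)
  · exact (integrable_finsetSum _ fun l _ => integrable_finsetSum _ fun i _ =>
      integrable_finsetSum _ fun j _ => integrable_finsetSum _ fun k _ =>
      hm _ (h.E l) (h.dε i j k)).const_mul _
  · exact (integrable_finsetSum _ fun l _ => integrable_finsetSum _ fun i _ =>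
      integrable_finsetSum _ fun j _ => integrable_finsetSum _ fun k _ =>
      hm _ (h.dE l k) (h.ε i j)).const_mul _

lemma integrable_enthalpy_perturb (h : KinMemLp q μ) (h' : KinMemLp δq μ) (τ : ℝ) :
    Integrable (fun x => mat.enthalpy ((q x).perturb τ (δq x))) μ := by
  simp only [Material.enthalpy_perturb]
  exact ((h.enthalpy mat).add ((h.virtualWork mat h').const_mul _)).add
    ((h'.enthalpy mat).const_mul _)

end KinMemLp

/-- The integral of the exact quadratic expansion is a polynomial in `τ` with finite coefficients,
so no derivative has to be taken under the integral sign. -/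
lemma hasDerivAt_bulkEnthalpy {R : RVE d} (mat : Material d) {q δq : Vec d → Kin d}
    (h : KinMemLp q (volume.restrict R.domain)) (h' : KinMemLp δq (volume.restrict R.domain)) :
    HasDerivAt (fun τ : ℝ => bulkEnthalpy R mat (fun x => (q x).perturb τ (δq x)))
      (∫ x in R.domain, mat.virtualWork (q x) (δq x)) 0 := by
  have h1 : (fun τ : ℝ => bulkEnthalpy R mat (fun x => (q x).perturb τ (δq x)))
      = fun τ => (∫ x in R.domain, mat.enthalpy (q x))
        + τ * (∫ x in R.domain, mat.virtualWork (q x) (δq x))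
        + τ ^ 2 * ∫ x in R.domain, mat.enthalpy (δq x) := by
    funext τ
    simp only [bulkEnthalpy, Material.enthalpy_perturb]
    have h1 := h.enthalpy mat
    have h2 := (h.virtualWork mat h').const_mul τ
    rw [integral_add (f := fun x => mat.enthalpy (q x) + τ * mat.virtualWork (q x) (δq x))
      (h1.add h2) ((h'.enthalpy mat).const_mul _), integral_add h1 h2, integral_const_mul,
      integral_const_mul]
  rw [h1]
  have h2 := (((hasDerivAt_id (0 : ℝ)).mul_const
    (∫ x in R.domain, mat.virtualWork (q x) (δq x))).const_add
      (∫ x in R.domain, mat.enthalpy (q x))).fun_add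
    (((hasDerivAt_id (0 : ℝ)).pow 2).mul_const (∫ x in R.domain, mat.enthalpy (δq x)))
  simpa using h2

namespace RVE

instance isFiniteMeasure_domain (R : RVE d) : IsFiniteMeasure (volume.restrict R.domain) :=
  ⟨by
    rw [Measure.restrict_apply_univ]
    exact (measure_mono R.domain_subset_region).trans_lt R.isCompact_region.measure_lt_top⟩

lemma memLp_domain (R : RVE d) {f : Vec d → ℝ} {U : Set (Vec d)} (hU : R.region ⊆ U)
    (hf : ContinuousOn f U) : MemLp f 2 (volume.restrict R.domain) := by
  obtain ⟨C, hC⟩ := R.isCompact_region.exists_bound_of_continuousOn (hf.mono hU)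
  refine MemLp.of_bound (R.integrableOn_domain hU hf).aestronglyMeasurable C ?_
  filter_upwards [ae_restrict_mem R.measurableSet_domain] with x hx
  exact hC x (R.domain_subset_region hx)

variable {R : RVE (n + 2)}

/-- The principle of virtual work for variations in the high-order periodic space. -/
theorem MemPeriodicH2.integral_virtualWork_eq_zero {U : Set (Vec (n + 2))} (hU : IsOpen U)
    (hRU : R.region ⊆ U) {S : Fin (n + 2) → Vec (n + 2) → ℝ}
    {Q : Fin (n + 2) → Fin (n + 2) → Vec (n + 2) → ℝ}
    (hS : ∀ j, ContDiffOn ℝ 1 (S j) U) (hQ : ∀ j k, ContDiffOn ℝ 2 (Q j k) U)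
    (hdiv : ∀ x ∈ R.domain, ∑ j, pd j (fun y => S j y - ∑ k, pd k (Q j k) y) x = 0)
    (hF : R.FaceBalance (fun j y => S j y - ∑ k, pd k (Q j k) y) Q) (hE : R.EdgeBalance Q)
    {J : Jet2 (n + 2)} (hJ : R.MemPeriodicH2 J) :
    ∫ x in R.domain, (∑ j, S j x * J.grad j x + ∑ j, ∑ k, Q j k x * J.hess j k x) = 0 := by
  have hSm : ∀ j, MemLp (S j) 2 (volume.restrict R.domain) := fun j =>
    R.memLp_domain hRU (hS j).continuousOn
  have hQm : ∀ j k, MemLp (Q j k) 2 (volume.restrict R.domain) := fun j k =>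
    R.memLp_domain hRU (hQ j k).continuousOn
  have hsum : ∀ G : Jet2 (n + 2), (∀ j, MemLp (G.grad j) 2 (volume.restrict R.domain)) →
      (∀ j k, MemLp (G.hess j k) 2 (volume.restrict R.domain)) →
      ∫ x in R.domain, (∑ j, S j x * G.grad j x + ∑ j, ∑ k, Q j k x * G.hess j k x)
        = (∑ j, ∫ x in R.domain, S j x * G.grad j x)
          + ∑ j, ∑ k, ∫ x in R.domain, Q j k x * G.hess j k x := by
    intro G hg hh
    have h1 : ∀ j, Integrable (fun x => S j x * G.grad j x) (volume.restrict R.domain) :=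
      fun j => (hSm j).integrable_mul (hg j)
    have h2 : ∀ j k, Integrable (fun x => Q j k x * G.hess j k x) (volume.restrict R.domain) :=
      fun j k => (hQm j k).integrable_mul (hh j k)
    rw [integral_add (integrable_finsetSum _ fun j _ => h1 j)
      (integrable_finsetSum _ fun j _ => integrable_finsetSum _ fun k _ => h2 j k),
      integral_finsetSum _ fun j _ => h1 j,
      integral_finsetSum _ fun j _ => integrable_finsetSum _ fun k _ => h2 j k]
    congr 1
    exact Finset.sum_congr rfl fun j _ => integral_finsetSum _ fun k _ => h2 j k
  obtain ⟨f, hf, -, hfg, hfh⟩ := hJ.approx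
  have hfm : ∀ m, (∀ j, MemLp (pd j (f m)) 2 (volume.restrict R.domain)) ∧
      ∀ j k, MemLp (pd k (pd j (f m))) 2 (volume.restrict R.domain) := by
    intro m
    obtain ⟨W, hW, hRW, hfW⟩ := (hf m).smooth
    have hp : ∀ j, ContDiffOn ℝ 1 (pd j (f m)) W := fun j =>
      contDiffOn_pd (n := 2) (m := 1) hW le_rfl hfW j
    exact ⟨fun j => R.memLp_domain hRW (hp j).continuousOn, fun j k =>
      R.memLp_domain hRW (continuousOn_pd hW (hp j) k)⟩
  have hz : ∀ m, (∑ j, ∫ x in R.domain, S j x * pd j (f m) x)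
      + ∑ j, ∑ k, ∫ x in R.domain, Q j k x * pd k (pd j (f m)) x = 0 := fun m => by
    rw [← R.integral_virtualWork_eq_zero hU hRU hS hQ hdiv hF hE (hf m)]
    exact (hsum (Jet2.ofFun (f m)) (hfm m).1 (hfm m).2).symm
  rw [hsum J hJ.memLp_grad hJ.memLp_hess]
  -- The work is linear in the derivatives of the variation with square integrable coefficients. It
  -- vanishes along the approximating smooth periodic fields and hence in the limit.
  refine tendsto_nhds_unique ((tendsto_finsetSum _ fun j _ => tendsto_integral_mul (hSm j)
      (fun m => (hfm m).1 j) (hJ.memLp_grad j) (hfg j)).add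
    (tendsto_finsetSum _ fun j _ => tendsto_finsetSum _ fun k _ => tendsto_integral_mul (hQm j k)
      (fun m => (hfm m).2 j k) (hJ.memLp_hess j k) (hfh j k))) ?_
  simp only [hz]
  exact tendsto_const_nhds

end RVE

lemma kinMemLp_variationKin {R : RVE d} {δu : Fin d → Jet2 d} {δφ : Jet2 d}
    (hu : ∀ i, R.MemPeriodicH2 (δu i)) (hφ : R.MemPeriodicH2 δφ) (δε : Fin d → Fin d → ℝ)
    (δE : Fin d → ℝ) : KinMemLp (variationKin δu δφ δε δE) (volume.restrict R.domain) where
  ε i j := by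
    simp only [variationKin, div_eq_mul_inv]
    exact ((((hu i).memLp_grad j).add ((hu j).memLp_grad i)).mul_const _).add (memLp_const _)
  dε i j k := by
    simp only [variationKin, div_eq_mul_inv]
    exact (((hu i).memLp_hess j k).add ((hu j).memLp_hess i k)).mul_const _
  E l := (hφ.memLp_grad l).neg.add (memLp_const _)
  dE l k := (hφ.memLp_hess l k).neg

/-! ### Smoothness of the kinematic fields -/

lemma contDiffOn_totalDisp {uP : Fin d → Vec d → ℝ} {U : Set (Vec d)} {i : Fin d}
    (h : ContDiffOn ℝ 4 (uP i) U) (εbar : Fin d → Fin d → ℝ) :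
    ContDiffOn ℝ 4 (totalDisp uP εbar i) U :=
  h.add (ContDiff.contDiffOn (by fun_prop))

lemma contDiffOn_totalPot {φP : Vec d → ℝ} {U : Set (Vec d)}
    (h : ContDiffOn ℝ 4 φP U) (Ebar : Fin d → ℝ) : ContDiffOn ℝ 4 (totalPot φP Ebar) U :=
  h.sub (ContDiff.contDiffOn (by fun_prop))

/-- Kinematic fields that are `C²` on a set. -/
structure KinContDiffOn (q : Vec d → Kin d) (U : Set (Vec d)) : Prop where
  ε : ∀ i j, ContDiffOn ℝ 2 (fun x => (q x).ε i j) U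
  dε : ∀ i j k, ContDiffOn ℝ 2 (fun x => (q x).dε i j k) U
  E : ∀ l, ContDiffOn ℝ 2 (fun x => (q x).E l) U
  dE : ∀ l k, ContDiffOn ℝ 2 (fun x => (q x).dE l k) U

/-- The kinematic fields involve up to two derivatives, so class `C⁴` leaves the double stresses
`C²`. Then `S - div Q` is `C¹`, as the divergence theorem requires. -/
lemma kinContDiffOn_kin {u : Fin d → Vec d → ℝ} {φ : Vec d → ℝ} {U : Set (Vec d)} (hU : IsOpen U)
    (hu : ∀ i, ContDiffOn ℝ 4 (u i) U) (hφ : ContDiffOn ℝ 4 φ U) : KinContDiffOn (kin u φ) U := by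
  have h1 : ∀ i j, ContDiffOn ℝ 3 (pd j (u i)) U := fun i j =>
    contDiffOn_pd (n := 4) (m := 3) hU (by norm_num) (hu i) j
  have h2 : ∀ i j, ContDiffOn ℝ 3 (strain u i j) U := fun i j =>
    ((h1 i j).add (h1 j i)).div_const 2
  have h3 : ∀ l, ContDiffOn ℝ 3 (elecField φ l) U := fun l =>
    (contDiffOn_pd (n := 4) (m := 3) hU (by norm_num) hφ l).neg
  exact ⟨fun i j => (h2 i j).of_le (by norm_num),
    fun i j k => contDiffOn_pd (n := 3) (m := 2) hU (by norm_num) (h2 i j) k,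
    fun l => (h3 l).of_le (by norm_num),
    fun l k => contDiffOn_pd (n := 3) (m := 2) hU (by norm_num) (h3 l) k⟩

namespace KinContDiffOn

variable {q : Vec d → Kin d} {U : Set (Vec d)} (mat : Material d)

lemma memLp (h : KinContDiffOn q U) {R : RVE d} (hU : R.region ⊆ U) :
    KinMemLp q (volume.restrict R.domain) where
  ε i j := R.memLp_domain hU (h.ε i j).continuousOn
  dε i j k := R.memLp_domain hU (h.dε i j k).continuousOn
  E l := R.memLp_domain hU (h.E l).continuousOn
  dE l k := R.memLp_domain hU (h.dE l k).continuousOn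

lemma cauchy (h : KinContDiffOn q U) (i j : Fin d) :
    ContDiffOn ℝ 2 (fun x => mat.cauchy (q x) i j) U :=
  ((ContDiffOn.sum fun k _ => ContDiffOn.sum fun l _ => contDiffOn_const.mul (h.ε k l)).sub
    (ContDiffOn.sum fun l _ => contDiffOn_const.mul (h.E l))).add
    (contDiffOn_const.mul (ContDiffOn.sum fun l _ => ContDiffOn.sum fun k _ =>
      contDiffOn_const.mul (h.dE l k)))

lemma doubleStress (h : KinContDiffOn q U) (i j k : Fin d) :
    ContDiffOn ℝ 2 (fun x => mat.doubleStress (q x) i j k) U :=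
  (ContDiffOn.sum fun l _ => ContDiffOn.sum fun m _ => ContDiffOn.sum fun n _ =>
    contDiffOn_const.mul (h.dε l m n)).sub
    (contDiffOn_const.mul (ContDiffOn.sum fun l _ => contDiffOn_const.mul (h.E l)))

lemma localD (h : KinContDiffOn q U) (l : Fin d) :
    ContDiffOn ℝ 2 (fun x => mat.localD (q x) l) U :=
  ((ContDiffOn.sum fun m _ => contDiffOn_const.mul (h.E m)).add
    (ContDiffOn.sum fun i _ => ContDiffOn.sum fun j _ => contDiffOn_const.mul (h.ε i j))).add
    (contDiffOn_const.mul (ContDiffOn.sum fun i _ => ContDiffOn.sum fun j _ =>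
      ContDiffOn.sum fun k _ => contDiffOn_const.mul (h.dε i j k)))

lemma doubleD (h : KinContDiffOn q U) (l k : Fin d) :
    ContDiffOn ℝ 2 (fun x => mat.doubleD (q x) l k) U :=
  (ContDiffOn.sum fun m _ => ContDiffOn.sum fun n _ => contDiffOn_const.mul (h.dE m n)).sub
    (contDiffOn_const.mul (ContDiffOn.sum fun i _ => ContDiffOn.sum fun j _ =>
      contDiffOn_const.mul (h.ε i j)))

end KinContDiffOn

end Flexo
end

noncomputable section
namespace Flexo

variable {d n : ℕ}

/-! ### Balance of the Neumann quantities -/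

section Balance

variable {R : RVE d} {mat : Material d} {q : Vec d → Kin d}

lemma faceBalance_stress (hN : HomogeneousNeumann R mat q) (hEq : HighOrderEquilibrium R mat q)
    (i : Fin d) : R.FaceBalance
      (fun j y => mat.cauchy (q y) i j - ∑ k, pd k (fun x => mat.doubleStress (q x) i j k) y)
      (fun j k y => mat.doubleStress (q y) i j k) where
  traction_eq F hF x hx := hN.traction_eq F hF x hx i
  doubleTraction_eq F hF x hx := hN.doubleTraction_eq F hF x hx i
  traction_add ζ F G x h := hEq.traction_add ζ F G x h i
  doubleTraction_sub ζ F G x h := hEq.doubleTraction_sub ζ F G x h i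

/-- Up to an overall sign the charges are the tractions of the electric displacements. The potential
is thus covered by the same scalar theory as the displacement components. -/
lemma surfaceCharge_eq_neg_tractionOf (F : R.Side) (x : Vec d) :
    surfaceCharge R mat q F x = -tractionOf (R.normal F)
      (fun l y => mat.localD (q y) l - ∑ k, pd k (fun x => mat.doubleD (q x) l k) y)
      (fun l k y => mat.doubleD (q y) l k) x :=
  (neg_add_eq_sub _ _).trans (neg_sub _ _).symm

lemma doubleCharge_eq_neg_doubleTractionOf (F : R.Side) (x : Vec d) :
    doubleCharge R mat q F x
      = -doubleTractionOf (R.normal F) (fun l k y => mat.doubleD (q y) l k) x := rfl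

lemma faceBalance_electric (hN : HomogeneousNeumann R mat q)
    (hEq : HighOrderEquilibrium R mat q) : R.FaceBalance
      (fun l y => mat.localD (q y) l - ∑ k, pd k (fun x => mat.doubleD (q x) l k) y)
      (fun l k y => mat.doubleD (q y) l k) where
  traction_eq F hF x hx := by
    have h := hN.surfaceCharge_eq F hF x hx
    rwa [surfaceCharge_eq_neg_tractionOf, neg_eq_zero] at h
  doubleTraction_eq F hF x hx := by
    have h := hN.doubleCharge_eq F hF x hx
    rwa [doubleCharge_eq_neg_doubleTractionOf, neg_eq_zero] at h
  traction_add ζ F G x h := by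
    have h := hEq.surfaceCharge_add ζ F G x h
    rw [surfaceCharge_eq_neg_tractionOf, surfaceCharge_eq_neg_tractionOf] at h
    linarith
  doubleTraction_sub ζ F G x h := by
    have h := hEq.doubleCharge_sub ζ F G x h
    rw [doubleCharge_eq_neg_doubleTractionOf, doubleCharge_eq_neg_doubleTractionOf] at h
    linarith

lemma edgeBalance_stress (hN : HomogeneousNeumann R mat q) (hEq : HighOrderEquilibrium R mat q)
    (i : Fin d) : R.EdgeBalance (fun j k y => mat.doubleStress (q y) i j k) :=
  R.edgeBalance_of (fun x hx => hN.edgeForce_eq x hx i) fun x hx hx' => hEq.edgeForce_sum x hx hx' i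

lemma edgeBalance_electric (hN : HomogeneousNeumann R mat q)
    (hEq : HighOrderEquilibrium R mat q) :
    R.EdgeBalance (fun l k y => mat.doubleD (q y) l k) := by
  refine R.edgeBalance_of (fun x hx => neg_eq_zero.1 (hN.edgeCharge_eq x hx)) fun x hx hx' => ?_
  have h := hEq.edgeCharge_sum x hx hx'
  simp only [edgeCharge, Finset.sum_neg_distrib, neg_eq_zero] at h
  exact h

end Balance

lemma RVE.boxVolume_pos (R : RVE d) : 0 < R.boxVolume := by
  rw [RVE.boxVolume, RVE.box, Measure.real, Real.volume_Icc_pi_toReal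
    (show (0 : Fin d → ℝ) ≤ R.L from fun i => (R.L_pos i).le)]
  exact Finset.prod_pos fun i _ => by simpa using R.L_pos i

lemma sum_symm_mul_half {A X : Fin d → Fin d → ℝ} (hA : ∀ i j, A i j = A j i) :
    ∑ i, ∑ j, A i j * ((X i j + X j i) / 2) = ∑ i, ∑ j, A i j * X i j := by
  have h : ∑ i, ∑ j, A i j * X j i = ∑ i, ∑ j, A i j * X i j := by
    rw [Finset.sum_comm]
    exact Finset.sum_congr rfl fun i _ => Finset.sum_congr rfl fun j _ => by rw [hA]
  calc _ = (∑ i, ∑ j, A i j * X i j + ∑ i, ∑ j, A i j * X j i) / 2 := by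
        simp only [← Finset.sum_add_distrib, Finset.sum_div]
        exact Finset.sum_congr rfl fun i _ => Finset.sum_congr rfl fun j _ => by ring
    _ = _ := by rw [h]; ring

lemma integral_add_add_sub {α : Type*} [MeasurableSpace α] {μ : Measure α} {f g h k : α → ℝ}
    (hf : Integrable f μ) (hg : Integrable g μ) (hh : Integrable h μ) (hk : Integrable k μ) :
    ∫ x, (f x + g x + (h x - k x)) ∂μ
      = ∫ x, f x ∂μ + ∫ x, g x ∂μ + (∫ x, h x ∂μ - ∫ x, k x ∂μ) := by
  rw [integral_add (f := fun x => f x + g x) (g := fun x => h x - k x) (hf.add hg) (hh.sub hk),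
    integral_add hf hg, integral_sub hh hk]

/-- The virtual work splits into the work on the displacement components, the work on the
potential, and the macroscopic work. -/
lemma virtualWork_variationKin (mat : Material d) (q : Kin d) (δu : Fin d → Jet2 d) (δφ : Jet2 d)
    (δε : Fin d → Fin d → ℝ) (δE : Fin d → ℝ) (x : Vec d) :
    mat.virtualWork q (variationKin δu δφ δε δE x)
      = (∑ i, (∑ j, mat.cauchy q i j * (δu i).grad j x
          + ∑ j, ∑ k, mat.doubleStress q i j k * (δu i).hess j k x))
        + (∑ l, mat.localD q l * δφ.grad l x + ∑ l, ∑ k, mat.doubleD q l k * δφ.hess l k x)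
        + ((∑ i, ∑ j, mat.cauchy q i j * δε i j) - ∑ l, mat.localD q l * δE l) := by
  have h1 := sum_symm_mul_half (mat.cauchy_symm q) (X := fun i j => (δu i).grad j x)
  have h2 : ∑ i, ∑ j, ∑ k, mat.doubleStress q i j k * (((δu i).hess j k x + (δu j).hess i k x) / 2)
      = ∑ i, ∑ j, ∑ k, mat.doubleStress q i j k * (δu i).hess j k x := by
    -- The double stress is symmetric in its first two indices, so `k` is moved outermost and the
    -- two-index statement is used for each fixed `k`.
    have hc : ∀ f : Fin d → Fin d → Fin d → ℝ,
        ∑ i, ∑ j, ∑ k, f i j k = ∑ k, ∑ i, ∑ j, f i j k := fun f =>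
      (Finset.sum_congr rfl fun i _ => Finset.sum_comm).trans Finset.sum_comm
    exact (hc _).trans ((Finset.sum_congr rfl fun k _ => sum_symm_mul_half
      (fun i j => mat.doubleStress_symm q i j k) (X := fun i j => (δu i).hess j k x)).trans
        (hc _).symm)
  simp only [Material.virtualWork, variationKin, mul_add, mul_neg, Finset.sum_add_distrib,
    Finset.sum_neg_distrib] at h1 h2 ⊢
  rw [h1, h2]
  ring

end Flexo

end

/-! ### The macrohomogeneity condition. -/

theorem mainTheorem1 {d : ℕ} (hd : d = 2 ∨ d = 3) (R : Flexo.RVE d) (mat : Flexo.Material d)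
    (uP : Fin d → Flexo.Vec d → ℝ) (φP : Flexo.Vec d → ℝ)
    (εbar : Fin d → Fin d → ℝ) (Ebar : Fin d → ℝ)
    (hεbar : ∀ i j, εbar i j = εbar j i)
    (huP : ∀ i, R.IsPeriodicField 4 (uP i)) (hφP : R.IsPeriodicField 4 φP)
    (q : Flexo.Vec d → Flexo.Kin d)
    (hq : q = Flexo.kin (Flexo.totalDisp uP εbar) (Flexo.totalPot φP Ebar))
    (hEL : Flexo.EulerLagrange R mat q)
    (hN : Flexo.HomogeneousNeumann R mat q)
    (hEq : Flexo.HighOrderEquilibrium R mat q) :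
    (∀ i j, IntegrableOn (fun x => mat.cauchy (q x) i j) R.domain) ∧
    (∀ l, IntegrableOn (fun x => mat.localD (q x) l) R.domain) ∧
    ∀ (δu : Fin d → Flexo.Jet2 d) (δφ : Flexo.Jet2 d)
      (δε : Fin d → Fin d → ℝ) (δE : Fin d → ℝ) (δq : Flexo.Vec d → Flexo.Kin d),
      (∀ i, R.MemPeriodicH2 (δu i)) → R.MemPeriodicH2 δφ → (∀ i j, δε i j = δε j i) →
      δq = Flexo.variationKin δu δφ δε δE →
        -- the bulk enthalpy is well defined along the variation
        (∀ τ : ℝ, IntegrableOn (fun x => mat.enthalpy ((q x).perturb τ (δq x))) R.domain) ∧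
        IntegrableOn (fun x => mat.virtualWork (q x) (δq x)) R.domain ∧
        -- its first variation is the internal virtual work
        HasDerivAt (fun τ : ℝ => Flexo.bulkEnthalpy R mat (fun x => (q x).perturb τ (δq x)))
          (∫ x in R.domain, mat.virtualWork (q x) (δq x)) 0 ∧
        -- which equals the macroscopic virtual work
        ∫ x in R.domain, mat.virtualWork (q x) (δq x) =
          R.boxVolume * ((∑ i, ∑ j, Flexo.macroStress R mat q i j * δε i j)
            - ∑ l, Flexo.macroD R mat q l * δE l) := by
  -- Sides then have `n + 1` parameters and edges have `n`. For `d = 2` the edges are corners, and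
  -- an integral over the zero-dimensional cube is evaluation at a point.
  obtain ⟨n, rfl⟩ : ∃ n, d = n + 2 := by
    rcases hd with rfl | rfl
    exacts [⟨0, rfl⟩, ⟨1, rfl⟩]
  choose U hU hRU huU using fun i => (huP i).smooth
  obtain ⟨W, hW, hRW, hφW⟩ := hφP.smooth
  set V := (⋂ i, U i) ∩ W with hV
  have hVo : IsOpen V := (isOpen_iInter_of_finite hU).inter hW
  have hRV : R.region ⊆ V := subset_inter (subset_iInter hRU) hRW
  have hqs : Flexo.KinContDiffOn q V := by
    rw [hq]
    exact Flexo.kinContDiffOn_kin hVo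
      (fun i => Flexo.contDiffOn_totalDisp
        ((huU i).mono (inter_subset_left.trans (iInter_subset U i))) εbar)
      (Flexo.contDiffOn_totalPot (hφW.mono inter_subset_right) Ebar)
  have hqm := hqs.memLp hRV
  have hσ : ∀ i j, IntegrableOn (fun x => mat.cauchy (q x) i j) R.domain := fun i j =>
    (hqm.cauchy mat i j).integrable (by norm_num)
  have hD : ∀ l, IntegrableOn (fun x => mat.localD (q x) l) R.domain := fun l =>
    (hqm.localD mat l).integrable (by norm_num)
  refine ⟨hσ, hD, ?_⟩
  rintro δu δφ δε δE δq hδu hδφ - rfl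
  have hδm := Flexo.kinMemLp_variationKin hδu hδφ δε δE
  refine ⟨fun τ => hqm.integrable_enthalpy_perturb mat hδm τ, hqm.virtualWork mat hδm,
    Flexo.hasDerivAt_bulkEnthalpy mat hqm hδm, ?_⟩
  have hu0 : ∀ i, ∫ x in R.domain, (∑ j, mat.cauchy (q x) i j * (δu i).grad j x
      + ∑ j, ∑ k, mat.doubleStress (q x) i j k * (δu i).hess j k x) = 0 := fun i =>
    (hδu i).integral_virtualWork_eq_zero hVo hRV
      (fun j => (hqs.cauchy mat i j).of_le (by norm_num)) (fun j k => hqs.doubleStress mat i j k)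
      (fun x hx => (hEL x hx).1 i) (Flexo.faceBalance_stress hN hEq i)
      (Flexo.edgeBalance_stress hN hEq i)
  have hφ0 : ∫ x in R.domain, (∑ l, mat.localD (q x) l * δφ.grad l x
      + ∑ l, ∑ k, mat.doubleD (q x) l k * δφ.hess l k x) = 0 :=
    hδφ.integral_virtualWork_eq_zero hVo hRV
      (fun l => (hqs.localD mat l).of_le (by norm_num)) (fun l k => hqs.doubleD mat l k)
      (fun x hx => (hEL x hx).2) (Flexo.faceBalance_electric hN hEq)
      (Flexo.edgeBalance_electric hN hEq)
  have hui : ∀ i, Integrable (fun x => ∑ j, mat.cauchy (q x) i j * (δu i).grad j x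
      + ∑ j, ∑ k, mat.doubleStress (q x) i j k * (δu i).hess j k x)
      (volume.restrict R.domain) := fun i =>
    (integrable_finsetSum _ fun j _ => (hqm.cauchy mat i j).integrable_mul
      ((hδu i).memLp_grad j)).add (integrable_finsetSum _ fun j _ => integrable_finsetSum _
        fun k _ => (hqm.doubleStress mat i j k).integrable_mul ((hδu i).memLp_hess j k))
  have hφi : Integrable (fun x => ∑ l, mat.localD (q x) l * δφ.grad l x
      + ∑ l, ∑ k, mat.doubleD (q x) l k * δφ.hess l k x) (volume.restrict R.domain) :=
    (integrable_finsetSum _ fun l _ => (hqm.localD mat l).integrable_mul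
      (hδφ.memLp_grad l)).add (integrable_finsetSum _ fun l _ => integrable_finsetSum _
        fun k _ => (hqm.doubleD mat l k).integrable_mul (hδφ.memLp_hess l k))
  have hσi : ∀ i j, Integrable (fun x => mat.cauchy (q x) i j * δε i j)
      (volume.restrict R.domain) := fun i j => (hσ i j).mul_const _
  have hDi : ∀ l, Integrable (fun x => mat.localD (q x) l * δE l) (volume.restrict R.domain) :=
    fun l => (hD l).mul_const _
  have hσs : Integrable (fun x => ∑ i, ∑ j, mat.cauchy (q x) i j * δε i j)
      (volume.restrict R.domain) :=
    integrable_finsetSum _ fun i _ => integrable_finsetSum _ fun j _ => hσi i j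
  have hDs : Integrable (fun x => ∑ l, mat.localD (q x) l * δE l) (volume.restrict R.domain) :=
    integrable_finsetSum _ fun l _ => hDi l
  have hus : Integrable (fun x => ∑ i, (∑ j, mat.cauchy (q x) i j * (δu i).grad j x
      + ∑ j, ∑ k, mat.doubleStress (q x) i j k * (δu i).hess j k x))
      (volume.restrict R.domain) := integrable_finsetSum _ fun i _ => hui i
  -- Of the three parts of the virtual work, those of `δu^P` and `δφ^P` integrate to zero. In the
  -- macroscopic part the constants leave the integral, and the averages restore the factor of the
  -- box volume.
  simp only [Flexo.virtualWork_variationKin]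
  rw [Flexo.integral_add_add_sub hus hφi hσs hDs,
    integral_finsetSum _ fun i _ => hui i, Finset.sum_eq_zero fun i _ => hu0 i, hφ0,
    integral_finsetSum _ fun l _ => hDi l,
    integral_finsetSum _ fun i _ => integrable_finsetSum _ fun j _ => hσi i j,
    Finset.sum_congr rfl fun i _ => integral_finsetSum _ fun j _ => hσi i j]
  simp only [integral_mul_const, Flexo.macroStress, Flexo.macroD, mul_sub, Finset.mul_sum]
  have hb := R.boxVolume_pos.ne'
  rw [add_zero, zero_add]
  congr 1
  · exact Finset.sum_congr rfl fun i _ => Finset.sum_congr rfl fun j _ => by field_simp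
  · exact Finset.sum_congr rfl fun l _ => by field_simp
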